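/- **Setting.** Let $d\in\mathbb N$ and let $B=\sum_{j<k}B_{jk}\,dx_j\wedge dx_k$ ($B_{kj}=-B_{jk}$) be a regular magnetic field on $\mathbb R^d$, i.e. a closed smooth 2-form whose components are bounded together with all their derivatives. Let $A$ be its vector potential in the transversal gauge, $A_k(x)=\sum_j\int_0^1 s\,x_jB_{jk}(sx)\,ds$, and let $\varphi(x,y)=\int_{[y,x]}A$ be the circulation of $A$ along the segment from $y$ to $x$. For Schwartz functions $\psi\in\mathscr S(\mathbb R^{2d})$ and $\Phi\in\mathscr S(\mathbb R^{4d})$ put $$k^A\psi(x,y)=(2\pi)^{-d}\int_{\mathbb R^d} e^{i\xi\cdot(x-y)}e^{i\varphi(x,y)}\,\psi\big(\tfrac{x+y}2,\xi\big)\,d\xi ,$$ $$K^A\Phi(x_L,x_R,y_L,y_R)=(2\pi)^{-2d}\int_{\mathbb R^{2d}} e^{i[\xi_L\cdot(x_L-y_L)-\xi_R\cdot(x_R-y_R)]}\,e^{i[\varphi(x_L,y_L)-\varphi(x_R,y_R)]}\,\Phi\big(\tfrac{x_L+y_L}2,\xi_L,\tfrac{x_R+y_R}2,\xi_R\big)\,d\xi_L\,d\xi_R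 .$$ These are automorphisms of the Schwartz spaces, and they extend by duality (through their transposes for the bilinear pairing $\int fg$) to automorphisms of the spaces of tempered distributions. For $K\in\mathscr S'(\mathbb R^{4d})$ let $\mathfrak{Int}(K):\mathscr S(\mathbb R^{2d})\to\mathscr S'(\mathbb R^{2d})$ be the operator with kernel $K$, $\langle \mathfrak{Int}(K)f,g\rangle=\langle K,g\otimes f\rangle$. For $\Phi\in\mathscr S'(\mathbb R^{4d})$ and $\psi\in\mathscr S(\mathbb R^{2d})$ the *magnetic semi-super Weyl product* is $$\Phi\bullet^B\psi=(k^A)^{-1}\,\mathfrak{Int}(K^A\Phi)\,k^A\psi\in\mathscr S'(\mathbb R^{2d}).$$ The *magnetic semi-super Moyal space* $\mathfrak m^B(\mathbb R^{4d})$ consists of all $\Phi\in\mathscr S'(\mathbb R^{4d})$ for which there is a continuous linear operator $T_\Phi$ on $\mathscr S(\mathbb R^{2d})$ with $\langle\Phi\bullet^B\psi,\chi\rangle=\langle\psi,T_\Phi\chi\rangle$ for all $\psi,\chi\in\mathscr S(\mathbb R^{2d})$. Such a $T_\Phi$ is unique, and for $\Phi\in\mathfrak m^B(\mathbb R^{4d})$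 the product is extended to all $\psi\in\mathscr S'(\mathbb R^{2d})$ by $\langle\Phi\bullet^B\psi,\chi\rangle=\langle\psi,T_\Phi\chi\rangle$. A *tempered weight* on $\mathbb R^n$ is a function $m:\mathbb R^n\to(0,\infty)$ such that for some $a,C>0$ one has $m(u+v)\le C\,m(u)\,(1+|v|^2)^{a/2}$ for all $u,v$. For a tempered weight $m$ on $\mathbb R^{2d}$, the Hörmander class $s_0(m)$ is the space of smooth $\psi:\mathbb R^{2d}\to\mathbb C$ with $\sup_X m(X)^{-1}|\partial^\gamma\psi(X)|<\infty$ for every multi-index $\gamma$, with the Fréchet topology given by these seminorms; for a tempered weight $M$ on $\mathbb R^{4d}$, the Hörmander super class $S_0(M)$ is defined in the same way on $\mathbb R^{4d}$. Put $S_0(\infty)=\bigcup_M S_0(M)$, the union over all tempered weights $M$ on $\mathbb R^{4d}$. Elements of these classes are regarded as tempered distributions through the pairing $\int fg$. **Proposition.** (1) $S_0(\infty)\subseteq\mathfrak m^B(\mathbb R^{4d})$. (2) Let $M$ and $m$ be tempered weights on $\mathbb R^{4d}=\mathbb R^{2d}\times\mathbb R^{2d}$ and $\mathbb R^{2d}$,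 respectively, and let $\tilde m(X)=M(X,X)\,m(X)$ for $X\in\mathbb R^{2d}$. Then $\Phi\bullet^B\psi\in s_0(\tilde m)$ for all $\Phi\in S_0(M)$ and $\psi\in s_0(m)$, and the bilinear map $$S_0(M)\times s_0(m)\to s_0(\tilde m),\qquad(\Phi,\psi)\mapsto\Phi\bullet^B\psi,$$ is continuous. -/

import Mathlib

open SchwartzMap MeasureTheory FourierTransform
open scoped ContDiff Real InnerProductSpace

noncomputable section
namespace SuperWeyl


section PartialFourier
variable {Z V G : Type} [NormedAddCommGroup Z] [NormedSpace ℝ Z]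
  [NormedAddCommGroup V] [InnerProductSpace ℝ V] [FiniteDimensional ℝ V]
  [MeasurableSpace V] [BorelSpace V]
  [NormedAddCommGroup G] [NormedSpace ℂ G]

/-- Schwartz functions with values in a complex normed space. -/
abbrev SchwartzC (E G : Type) [NormedAddCommGroup E] [NormedSpace ℝ E] [NormedAddCommGroup G]
    [NormedSpace ℂ G] := 𝓢(E, G)

/-- The slice `v ↦ f (z, v)` of a Schwartz function. -/
def slice (z : Z) : 𝓢(Z × V, G) →L[ℂ] 𝓢(V, G) :=
  compCLM ℂ (g := fun v : V => (z, v))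
    (by
      refine .of_fderiv (k := 1) (C := 1 + ‖z‖) ?_ (by fun_prop) ?_
      · have : fderiv ℝ (fun v : V => (z, v)) = fun _ => ContinuousLinearMap.inr ℝ Z V := by
          ext1 v
          exact (hasFDerivAt_prodMk_right z v).fderiv
        rw [this]
        exact .const _
      · intro v
        have h1 : 0 ≤ ‖z‖ * ‖v‖ := by positivity
        rw [Prod.norm_mk, pow_one]
        refine max_le ?_ ?_ <;> nlinarith [norm_nonneg z, norm_nonneg v])
    ⟨1, 1, fun v => by
      rw [Prod.norm_mk]
      have := le_max_right ‖z‖ ‖v‖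
      linarith⟩

@[simp] lemma slice_apply (z : Z) (f : 𝓢(Z × V, G)) (v : V) : slice z f v = f (z, v) := rfl

/-- Pointwise bound used for domination: decay in the second variable, uniform in the first. -/
lemma exists_decay (k l : ℕ) : ∃ (s : Finset (ℕ × ℕ)) (C : ℝ), 0 ≤ C ∧
    ∀ (f : 𝓢(Z × V, G)) (z : Z) (v : V),
      ‖z‖ ^ k * ‖f (z, v)‖ ≤ C * s.sup (schwartzSeminormFamily ℂ (Z × V) G) f *
        (1 + ‖v‖) ^ (-(l : ℝ)) := by
  refine ⟨Finset.Iic (k + l, 0), 2 ^ (k + l), by positivity, fun f z v => ?_⟩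
  have h := one_add_le_sup_seminorm_apply (𝕜 := ℂ) (m := (k + l, 0)) le_rfl le_rfl f (z, v)
  rw [norm_iteratedFDeriv_zero] at h
  have hz : ‖z‖ ≤ 1 + ‖(z, v)‖ := by
    have := le_max_left ‖z‖ ‖v‖
    rw [Prod.norm_mk]; linarith
  have hv : 1 + ‖v‖ ≤ 1 + ‖(z, v)‖ := by
    have := le_max_right ‖z‖ ‖v‖
    rw [Prod.norm_mk]; linarith
  have hpos : 0 < (1 + ‖v‖) ^ l := by positivity
  rw [Real.rpow_neg (by positivity), Real.rpow_natCast, ← div_eq_mul_inv, le_div_iff₀ hpos]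
  refine le_trans ?_ h
  calc ‖z‖ ^ k * ‖f (z, v)‖ * (1 + ‖v‖) ^ l = ‖z‖ ^ k * (1 + ‖v‖) ^ l * ‖f (z, v)‖ := by ring
    _ ≤ (1 + ‖(z, v)‖) ^ k * (1 + ‖(z, v)‖) ^ l * ‖f (z, v)‖ := by gcongr
    _ = _ := by rw [← pow_add]

/-- The partial Fourier transform in the second variable, as a function. -/
def pF (f : 𝓢(Z × V, G)) (x : Z × V) : G := 𝓕 (slice x.1 f) x.2

lemma pF_eq (f : 𝓢(Z × V, G)) (x : Z × V) :
    pF f x = ∫ v, Real.fourierChar (-⟪v, x.2⟫_ℝ) • f (x.1, v) := rfl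

lemma norm_pF_le (k : ℕ) : ∃ (s : Finset (ℕ × ℕ)) (C : ℝ), 0 ≤ C ∧
    ∀ (f : 𝓢(Z × V, G)) (x : Z × V),
      ‖x.1‖ ^ k * ‖pF f x‖ ≤ C * s.sup (schwartzSeminormFamily ℂ (Z × V) G) f := by
  set l := (volume : Measure V).integrablePower
  obtain ⟨s, C, hC, h⟩ := exists_decay (Z := Z) (V := V) (G := G) k l
  have hI : 0 ≤ ∫ v : V, (1 + ‖v‖) ^ (-(l : ℝ)) := integral_nonneg fun v => by positivity
  refine ⟨s, C * ∫ v : V, (1 + ‖v‖) ^ (-(l : ℝ)), by positivity, fun f x => ?_⟩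
  rw [pF_eq]
  calc ‖x.1‖ ^ k * ‖∫ v, Real.fourierChar (-⟪v, x.2⟫_ℝ) • f (x.1, v)‖
      ≤ ‖x.1‖ ^ k * ∫ v, ‖f (x.1, v)‖ := by
        gcongr
        refine (norm_integral_le_integral_norm _).trans (le_of_eq ?_)
        simp only [Circle.norm_smul]
    _ = ∫ v, ‖x.1‖ ^ k * ‖f (x.1, v)‖ := by rw [integral_const_mul]
    _ ≤ ∫ v, C * s.sup (schwartzSeminormFamily ℂ (Z × V) G) f * (1 + ‖v‖) ^ (-(l : ℝ)) := by
        refine integral_mono_of_nonneg (.of_forall fun v => by positivity) ?_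
          (.of_forall fun v => h f x.1 v)
        exact (Measure.integrable_pow_neg_integrablePower volume).const_mul _
    _ = _ := by rw [integral_const_mul]; ring

/-- Precomposition with a real-linear map, as a complex-linear map. -/
def preL {W W' : Type} [NormedAddCommGroup W] [NormedSpace ℝ W] [NormedAddCommGroup W']
    [NormedSpace ℝ W'] (L : W →L[ℝ] W') : (W' →L[ℝ] G) →L[ℂ] (W →L[ℝ] G) :=
  LinearMap.mkContinuous
    { toFun := fun T => T.comp L
      map_add' := fun _ _ => rfl
      map_smul' := fun _ _ => rfl } ‖L‖
    (fun T => by rw [mul_comm]; exact T.opNorm_comp_le L)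

@[simp] lemma preL_apply {W W' : Type} [NormedAddCommGroup W] [NormedSpace ℝ W]
    [NormedAddCommGroup W'] [NormedSpace ℝ W'] (L : W →L[ℝ] W') (T : W' →L[ℝ] G) :
    preL L T = T.comp L := rfl

/-- Derivative in the second variable. -/
def dSnd : 𝓢(Z × V, G) →L[ℂ] SchwartzC (Z × V) (V →L[ℝ] G) :=
  postcompCLM (preL (ContinuousLinearMap.inr ℝ Z V)) ∘L fderivCLM ℂ (Z × V) G

lemma slice_dSnd (f : 𝓢(Z × V, G)) (z : Z) : slice z (dSnd f) = fderivCLM ℂ V G (slice z f) := by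
  ext1 v
  have h := (f.hasFDerivAt (z, v)).comp v (hasFDerivAt_prodMk_right z v)
  rw [fderivCLM_apply]
  exact h.fderiv.symm

lemma norm_snd_mul_pF (f : 𝓢(Z × V, G)) (x : Z × V) :
    ‖x.2‖ * ‖pF f x‖ = (2 * π)⁻¹ * ‖pF (dSnd f) x‖ := by
  have : pF (dSnd f) x = (2 * π * Complex.I) • (innerSL ℝ x.2).smulRight (pF f x) := by
    unfold pF
    rw [slice_dSnd, fourier_fderivCLM_eq]
    rfl
  rw [this, norm_smul, ContinuousLinearMap.norm_smulRight_apply, innerSL_apply_norm]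
  have hp : (π : ℝ) ≠ 0 := Real.pi_ne_zero
  simp [abs_of_pos Real.pi_pos]
  field_simp

/-- The Schwartz function whose partial Fourier transform is the derivative of that of `f`. -/
def dF : 𝓢(Z × V, G) →L[ℂ] SchwartzC (Z × V) ((Z × V) →L[ℝ] G) :=
  postcompCLM (preL ((ContinuousLinearMap.inl ℝ Z V).comp (ContinuousLinearMap.fst ℝ Z V))) ∘L
      fderivCLM ℂ (Z × V) G -
    (2 * π * Complex.I) • smulRightCLM ℂ G
      ((innerSL ℝ : V →L[ℝ] V →L[ℝ] ℝ).bilinearComp (ContinuousLinearMap.snd ℝ Z V)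
        (ContinuousLinearMap.snd ℝ Z V))

lemma sup_comp_le {E₁ E₂ G₁ G₂ : Type} [NormedAddCommGroup E₁] [NormedSpace ℝ E₁]
    [NormedAddCommGroup E₂] [NormedSpace ℝ E₂] [NormedAddCommGroup G₁] [NormedSpace ℂ G₁]
    [NormedAddCommGroup G₂] [NormedSpace ℂ G₂]
    (T : 𝓢(E₁, G₁) →L[ℂ] 𝓢(E₂, G₂)) (s : Finset (ℕ × ℕ)) :
    ∃ (t : Finset (ℕ × ℕ)) (C : ℝ), 0 ≤ C ∧ ∀ f,
      s.sup (schwartzSeminormFamily ℂ E₂ G₂) (T f) ≤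
        C * t.sup (schwartzSeminormFamily ℂ E₁ G₁) f := by
  have hc : Continuous ((s.sup (schwartzSeminormFamily ℂ E₂ G₂)).comp T.toLinearMap) := by
    have h1 : Continuous (s.sup (schwartzSeminormFamily ℂ E₂ G₂) : Seminorm ℂ 𝓢(E₂, G₂)) := by
      refine Finset.sup_induction (p := fun q : Seminorm ℂ 𝓢(E₂, G₂) => Continuous q)
        continuous_const (fun p hp q hq => hp.sup hq)
        fun i _ => (schwartz_withSeminorms ℂ E₂ G₂).continuous_seminorm i
    exact h1.comp T.continuous
  obtain ⟨t, C, -, h⟩ := Seminorm.bound_of_continuous (schwartz_withSeminorms ℂ E₁ G₁) _ hc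
  exact ⟨t, C, C.2, fun f => h f⟩

lemma norm_pF_le' (k j : ℕ) : ∀ (G : Type) [NormedAddCommGroup G] [NormedSpace ℂ G],
    ∃ (s : Finset (ℕ × ℕ)) (C : ℝ), 0 ≤ C ∧ ∀ (f : 𝓢(Z × V, G)) (x : Z × V),
      ‖x.1‖ ^ k * ‖x.2‖ ^ j * ‖pF f x‖ ≤ C * s.sup (schwartzSeminormFamily ℂ (Z × V) G) f := by
  induction j with
  | zero =>
    intro G _ _
    simpa using norm_pF_le (Z := Z) (V := V) (G := G) k
  | succ j ih =>
    intro G _ _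
    obtain ⟨s, C, hC, h⟩ := ih (V →L[ℝ] G)
    obtain ⟨t, C', hC', h'⟩ := sup_comp_le (dSnd (Z := Z) (V := V) (G := G)) s
    refine ⟨t, (2 * π)⁻¹ * (C * C'), by positivity, fun f x => ?_⟩
    calc ‖x.1‖ ^ k * ‖x.2‖ ^ (j + 1) * ‖pF f x‖
        = ‖x.1‖ ^ k * ‖x.2‖ ^ j * (‖x.2‖ * ‖pF f x‖) := by ring
      _ = (2 * π)⁻¹ * (‖x.1‖ ^ k * ‖x.2‖ ^ j * ‖pF (dSnd f) x‖) := by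
          rw [norm_snd_mul_pF]; ring
      _ ≤ (2 * π)⁻¹ * (C * (C' * t.sup (schwartzSeminormFamily ℂ (Z × V) G) f)) := by
          refine mul_le_mul_of_nonneg_left ?_ (by positivity)
          exact (h _ x).trans (mul_le_mul_of_nonneg_left (h' f) hC)
      _ = _ := by ring

lemma integrable_pF (f : 𝓢(Z × V, G)) (x : Z × V) :
    Integrable (fun v => Real.fourierChar (-⟪v, x.2⟫_ℝ) • f (x.1, v)) (volume : Measure V) := by
  have hm : AEStronglyMeasurable (fun v => Real.fourierChar (-⟪v, x.2⟫_ℝ) • f (x.1, v))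
      (volume : Measure V) := by
    refine Continuous.aestronglyMeasurable ?_
    have := Real.continuous_fourierChar
    fun_prop
  have hi : Integrable (fun v => f (x.1, v)) (volume : Measure V) := (slice x.1 f).integrable
  exact hi.norm.mono' hm (.of_forall fun v => (Circle.norm_smul _ _).le)

def pFIntegrand (f : 𝓢(Z × V, G)) (x : Z × V) (v : V) : G :=
  ((Real.fourierChar (-⟪v, x.2⟫_ℝ) : Circle) : ℂ) • f (x.1, v)

lemma aesm_pFIntegrand (f : 𝓢(Z × V, G)) (x : Z × V) :
    AEStronglyMeasurable (pFIntegrand f x) (volume : Measure V) :=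
  (integrable_pF f x).aestronglyMeasurable

lemma norm_pFIntegrand (f : 𝓢(Z × V, G)) (x : Z × V) (v : V) :
    ‖pFIntegrand f x v‖ = ‖f (x.1, v)‖ := by
  rw [pFIntegrand, norm_smul, Circle.norm_coe, one_mul]

lemma hasFDerivAt_pF (f : 𝓢(Z × V, G)) (x : Z × V) : HasFDerivAt (pF f) (pF (G := (Z × V) →L[ℝ] G) (dF f) x) x := by
  set l := (volume : Measure V).integrablePower
  obtain ⟨s, C, hC, h⟩ := exists_decay (Z := Z) (V := V) (G := (Z × V) →L[ℝ] G) 0 l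
  refine hasFDerivAt_integral_of_dominated_of_fderiv_le (μ := (volume : Measure V))
    (F := fun (x : Z × V) v => Real.fourierChar (-⟪v, x.2⟫_ℝ) • f (x.1, v))
    (F' := fun x v => pFIntegrand (G := (Z × V) →L[ℝ] G) (dF f) x v)
    (bound := fun v => C * s.sup (schwartzSeminormFamily ℂ (Z × V) ((Z × V) →L[ℝ] G)) (dF f) *
      (1 + ‖v‖) ^ (-(l : ℝ))) (s := Set.univ) Filter.univ_mem ?_ ?_ ?_ ?_ ?_ ?_
  · exact .of_forall fun x => (integrable_pF f x).aestronglyMeasurable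
  · exact integrable_pF f x
  · exact aesm_pFIntegrand (G := (Z × V) →L[ℝ] G) (dF f) x
  · refine .of_forall fun v x _ => ?_
    have h0 := h (dF f) x.1 v
    rw [pow_zero, one_mul] at h0
    exact (norm_pFIntegrand _ _ _).trans_le h0
  · exact (Measure.integrable_pow_neg_integrablePower volume).const_mul _
  · refine .of_forall fun v x _ => ?_
    have h1 : HasFDerivAt (fun x : Z × V => f (x.1, v))
        ((fderiv ℝ f (x.1, v)).comp ((ContinuousLinearMap.inl ℝ Z V).comp
          (ContinuousLinearMap.fst ℝ Z V))) x :=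
      (f.hasFDerivAt (x.1, v)).comp x
        ((hasFDerivAt_prodMk_left x.1 v).comp x (hasFDerivAt_fst (𝕜 := ℝ)))
    have h2 : HasFDerivAt (fun x : Z × V => ((Real.fourierChar (-⟪v, x.2⟫_ℝ) : Circle) : ℂ))
        ((-2 * π * Complex.I * Real.fourierChar (-⟪v, x.2⟫_ℝ)) •
          Complex.ofRealCLM.comp ((innerSL ℝ v).comp (ContinuousLinearMap.snd ℝ Z V))) x := by
      exact (Real.hasFDerivAt_fourierChar_neg_bilinear_right (innerSL ℝ) v x.2).comp x hasFDerivAt_snd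
    have h3 := h2.smul h1
    refine h3.congr_fderiv ?_
    ext w
    · simp [dF, pFIntegrand, smul_sub, smul_smul]
    · simp only [dF, pFIntegrand]
      simp [smul_sub, smul_smul]
      rw [sub_eq_add_neg, ← Complex.coe_smul, smul_smul]
      congr 3
      ring

lemma fderiv_pF (f : 𝓢(Z × V, G)) : fderiv ℝ (pF f) = pF (G := (Z × V) →L[ℝ] G) (dF f) :=
  funext fun x => (hasFDerivAt_pF f x).fderiv

lemma contDiff_pF (n : ℕ) : ∀ (G : Type) [NormedAddCommGroup G] [NormedSpace ℂ G]
    (f : 𝓢(Z × V, G)), ContDiff ℝ n (pF f) := by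
  induction n with
  | zero =>
    intro G _ _ f
    exact contDiff_zero.2 (continuous_iff_continuousAt.2 fun x => (hasFDerivAt_pF f x).continuousAt)
  | succ n ih =>
    intro G _ _ f
    rw [Nat.cast_succ, contDiff_succ_iff_fderiv]
    refine ⟨fun x => (hasFDerivAt_pF f x).differentiableAt, by simp, ?_⟩
    rw [fderiv_pF]
    exact ih _ _

lemma bound_pF (k n : ℕ) : ∀ (G : Type) [NormedAddCommGroup G] [NormedSpace ℂ G],
    ∃ (s : Finset (ℕ × ℕ)) (C : ℝ), 0 ≤ C ∧ ∀ (f : 𝓢(Z × V, G)) (x : Z × V),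
      ‖x‖ ^ k * ‖iteratedFDeriv ℝ n (pF f) x‖ ≤
        C * s.sup (schwartzSeminormFamily ℂ (Z × V) G) f := by
  induction n with
  | zero =>
    intro G _ _
    obtain ⟨s, C, hC, h⟩ := norm_pF_le' (Z := Z) (V := V) k 0 G
    obtain ⟨t, C', hC', h'⟩ := norm_pF_le' (Z := Z) (V := V) 0 k G
    refine ⟨s ∪ t, C + C', by positivity, fun f x => ?_⟩
    rw [norm_iteratedFDeriv_zero]
    have hx : ‖x‖ ^ k ≤ ‖x.1‖ ^ k + ‖x.2‖ ^ k := by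
      rw [Prod.norm_def]
      rcases max_cases ‖x.1‖ ‖x.2‖ with ⟨h, -⟩ | ⟨h, -⟩ <;> rw [h]
      · exact le_add_of_nonneg_right (by positivity)
      · exact le_add_of_nonneg_left (by positivity)
    have hs := Seminorm.le_def.1 (Finset.sup_mono (f := schwartzSeminormFamily ℂ (Z × V) G)
      (Finset.subset_union_left (s₁ := s) (s₂ := t))) f
    have ht := Seminorm.le_def.1 (Finset.sup_mono (f := schwartzSeminormFamily ℂ (Z × V) G)
      (Finset.subset_union_right (s₁ := s) (s₂ := t))) f
    have h1 := h f x
    have h2 := h' f x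
    rw [pow_zero, mul_one] at h1
    rw [pow_zero, one_mul] at h2
    calc ‖x‖ ^ k * ‖pF f x‖ ≤ (‖x.1‖ ^ k + ‖x.2‖ ^ k) * ‖pF f x‖ := by gcongr
      _ = ‖x.1‖ ^ k * ‖pF f x‖ + ‖x.2‖ ^ k * ‖pF f x‖ := by ring
      _ ≤ C * (s ∪ t).sup (schwartzSeminormFamily ℂ (Z × V) G) f +
          C' * (s ∪ t).sup (schwartzSeminormFamily ℂ (Z × V) G) f :=
        add_le_add (h1.trans (by gcongr)) (h2.trans (by gcongr))
      _ = _ := by ring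
  | succ n ih =>
    intro G _ _
    obtain ⟨s, C, hC, h⟩ := ih ((Z × V) →L[ℝ] G)
    obtain ⟨t, C', hC', h'⟩ := sup_comp_le (G₂ := (Z × V) →L[ℝ] G) (dF (Z := Z) (V := V) (G := G)) s
    refine ⟨t, C * C', by positivity, fun f x => ?_⟩
    rw [← norm_iteratedFDeriv_fderiv, fderiv_pF, mul_assoc]
    exact (h _ x).trans (by gcongr; exact h' f)

/-- The partial Fourier transform in the second variable on Schwartz space. -/
def partialFourier : 𝓢(Z × V, G) →L[ℂ] 𝓢(Z × V, G) :=
  mkCLM pF (fun f g x => by simp [pF, FourierTransform.fourier_add])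
    (fun a f x => by simp [pF, FourierTransform.fourier_smul])
    (fun f => contDiff_infty.2 fun n => contDiff_pF n G f)
    (fun n => bound_pF n.1 n.2 G)

lemma partialFourier_apply (f : 𝓢(Z × V, G)) (x : Z × V) :
    partialFourier f x = 𝓕 (slice x.1 f) x.2 := rfl

end PartialFourier


section Parametric
variable {V : Type} [NormedAddCommGroup V] [NormedSpace ℝ V]

lemma hasFDerivAt_paramIntegral {G : Type} [NormedAddCommGroup G] [NormedSpace ℝ G]
    {f : ℝ × V → G} (hf : f.HasTemperateGrowth) (v : V) :
    HasFDerivAt (fun v => ∫ s in (0 : ℝ)..1, f (s, v))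
      (∫ s in (0 : ℝ)..1, (fderiv ℝ f (s, v)).comp (ContinuousLinearMap.inr ℝ ℝ V)) v := by
  have hc : Continuous f := hf.1.continuous
  have hc' : Continuous (fun x => (fderiv ℝ f x).comp (ContinuousLinearMap.inr ℝ ℝ V)) := by
    have := hf.1.continuous_fderiv (by simp)
    fun_prop
  obtain ⟨k, C, hC⟩ := hf.2 1
  have hC0 : 0 ≤ C := by
    have := (norm_nonneg _).trans (hC 0)
    simpa using this
  refine (intervalIntegral.hasFDerivAt_integral_of_dominated_of_fderiv_le
    (F := fun v s => f (s, v))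
    (F' := fun v s => (fderiv ℝ f (s, v)).comp (ContinuousLinearMap.inr ℝ ℝ V))
    (bound := fun _ => C * (1 + (1 + (‖v‖ + 1))) ^ k) (s := Metric.ball v 1)
    (Metric.ball_mem_nhds v one_pos) ?_ ?_ ?_ ?_ ?_ ?_)
  · exact .of_forall fun w => (hc.comp (by fun_prop)).aestronglyMeasurable
  · exact (hc.comp (by fun_prop)).intervalIntegrable _ _
  · exact (hc'.comp (f := fun s : ℝ => (s, v)) (by fun_prop)).aestronglyMeasurable
  · refine .of_forall fun s hs w hw => ?_
    have h1 : ‖fderiv ℝ f (s, w)‖ ≤ C * (1 + ‖(s, w)‖) ^ k := by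
      have := hC (s, w)
      rwa [← norm_iteratedFDeriv_fderiv, norm_iteratedFDeriv_zero] at this
    have h2 : ‖(s, w)‖ ≤ 1 + (‖v‖ + 1) := by
      rw [Set.uIoc_of_le zero_le_one] at hs
      have h3 : ‖s‖ ≤ 1 := by
        rw [Real.norm_of_nonneg hs.1.le]; exact hs.2
      have h4 : ‖w‖ ≤ ‖v‖ + 1 := by
        have := norm_le_norm_add_norm_sub' w v
        rw [mem_ball_iff_norm] at hw
        linarith
      rw [Prod.norm_mk]
      have := norm_nonneg v
      exact max_le (by linarith) (by linarith)
    calc _ ≤ ‖fderiv ℝ f (s, w)‖ * ‖ContinuousLinearMap.inr ℝ ℝ V‖ :=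
          ContinuousLinearMap.opNorm_comp_le _ _
      _ ≤ ‖fderiv ℝ f (s, w)‖ * 1 := by
          gcongr
          exact ContinuousLinearMap.norm_inr_le_one ℝ ℝ V
      _ ≤ C * (1 + ‖(s, w)‖) ^ k := by rw [mul_one]; exact h1
      _ ≤ _ := by gcongr
  · exact intervalIntegrable_const
  · refine .of_forall fun s _ w _ => ?_
    exact ((hf.1.differentiable (by simp)) (s, w)).hasFDerivAt.comp w (hasFDerivAt_prodMk_right s w)

lemma paramIntegral_aux (n : ℕ) : ∀ (G : Type) [NormedAddCommGroup G] [NormedSpace ℝ G]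
    (f : ℝ × V → G), f.HasTemperateGrowth →
    ContDiff ℝ n (fun v => ∫ s in (0 : ℝ)..1, f (s, v)) ∧
    ∃ (k : ℕ) (C : ℝ), ∀ v, ‖iteratedFDeriv ℝ n (fun v => ∫ s in (0 : ℝ)..1, f (s, v)) v‖ ≤
      C * (1 + ‖v‖) ^ k := by
  induction n with
  | zero =>
    intro G _ _ f hf
    refine ⟨contDiff_zero.2 (continuous_iff_continuousAt.2 fun v =>
      (hasFDerivAt_paramIntegral hf v).continuousAt), ?_⟩
    obtain ⟨k, C, hC⟩ := hf.2 0
    have hC0 : 0 ≤ C := by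
      have := (norm_nonneg _).trans (hC 0)
      simpa using this
    refine ⟨k, C * 2 ^ k, fun v => ?_⟩
    rw [norm_iteratedFDeriv_zero]
    have := intervalIntegral.norm_integral_le_of_norm_le_const (a := 0) (b := 1)
      (C := C * 2 ^ k * (1 + ‖v‖) ^ k) (f := fun s => f (s, v)) (fun s hs => ?_)
    · simpa using this
    · have h := hC (s, v)
      rw [norm_iteratedFDeriv_zero] at h
      refine h.trans ?_
      rw [mul_assoc, ← mul_pow]
      gcongr
      rw [Set.uIoc_of_le zero_le_one] at hs
      have h3 : ‖s‖ ≤ 1 := by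
        rw [Real.norm_of_nonneg hs.1.le]; exact hs.2
      rw [Prod.norm_mk]
      have := norm_nonneg v
      have := max_le (a := ‖s‖) (b := ‖v‖) (c := 1 + ‖v‖) (by linarith) (by linarith)
      linarith
  | succ n ih =>
    intro G _ _ f hf
    have hf' : (fun x => (fderiv ℝ f x).comp (ContinuousLinearMap.inr ℝ ℝ V)).HasTemperateGrowth := by
      have h1 : (fderiv ℝ f).HasTemperateGrowth := by
        refine ⟨hf.1.fderiv_right (by simp), fun n => ?_⟩
        obtain ⟨k, C, h⟩ := hf.2 (n + 1)
        exact ⟨k, C, fun x => by rw [norm_iteratedFDeriv_fderiv]; exact h x⟩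
      exact (((ContinuousLinearMap.compL ℝ V (ℝ × V) G).flip
        (ContinuousLinearMap.inr ℝ ℝ V)).hasTemperateGrowth).comp h1
    have hd : fderiv ℝ (fun v => ∫ s in (0 : ℝ)..1, f (s, v)) =
        fun v => ∫ s in (0 : ℝ)..1, (fderiv ℝ f (s, v)).comp (ContinuousLinearMap.inr ℝ ℝ V) :=
      funext fun v => (hasFDerivAt_paramIntegral hf v).fderiv
    obtain ⟨h1, k, C, h2⟩ := ih _ _ hf'
    refine ⟨?_, k, C, fun v => ?_⟩
    · rw [Nat.cast_succ, contDiff_succ_iff_fderiv]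
      refine ⟨fun x => (hasFDerivAt_paramIntegral hf x).differentiableAt, by simp, ?_⟩
      rw [hd]
      exact h1
    · rw [← norm_iteratedFDeriv_fderiv, hd]
      exact h2 v

lemma hasTemperateGrowth_paramIntegral {G : Type} [NormedAddCommGroup G] [NormedSpace ℝ G]
    {f : ℝ × V → G} (hf : f.HasTemperateGrowth) :
    (fun v => ∫ s in (0 : ℝ)..1, f (s, v)).HasTemperateGrowth :=
  ⟨contDiff_infty.2 fun n => (paramIntegral_aux n G f hf).1,
    fun n => (paramIntegral_aux n G f hf).2⟩

lemma hasTemperateGrowth_expI : (fun t : ℝ => Complex.exp (t * Complex.I)).HasTemperateGrowth := by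
  have hd : ∀ n : ℕ, iteratedDeriv n (fun t : ℝ => Complex.exp (t * Complex.I)) =
      fun t : ℝ => Complex.I ^ n * Complex.exp (t * Complex.I) := by
    intro n
    induction n with
    | zero => simp
    | succ n ih =>
      rw [iteratedDeriv_succ, ih]
      ext1 t
      have h : HasDerivAt (fun t : ℝ => Complex.I ^ n * Complex.exp (t * Complex.I))
          (Complex.I ^ n * (Complex.exp (t * Complex.I) * (1 * Complex.I))) t :=
        (((hasDerivAt_id t).ofReal_comp.mul_const Complex.I).cexp).const_mul _
      rw [h.deriv]; ring
  refine ⟨(Complex.ofRealCLM.contDiff.mul contDiff_const).cexp, fun n => ⟨0, 1, fun t => ?_⟩⟩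
  rw [norm_iteratedFDeriv_eq_norm_iteratedDeriv, hd]
  simp [Complex.norm_exp]

end Parametric

/-- Position space `ℝ^d`. -/
abbrev Pos (d : ℕ) : Type := EuclideanSpace ℝ (Fin d)

/-- Phase space `ℝ^{2d}`; a point is `X = (x, ξ)`. -/
abbrev Phase (d : ℕ) : Type := Pos d × Pos d

/-- A regular magnetic field on `ℝ^d`: a closed `2`-form
`B = ∑_{j<k} B_{jk} dx_j ∧ dx_k` whose components are smooth and bounded with all derivatives. -/
structure MagneticField (d : ℕ) where
  /-- The components `B_{jk}`. -/
  comp : Fin d → Fin d → Pos d → ℝ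
  antisymm : ∀ j k x, comp j k x = -comp k j x
  smooth : ∀ j k, ContDiff ℝ ∞ (comp j k)
  bounded : ∀ j k (n : ℕ), ∃ C : ℝ, ∀ x, ‖iteratedFDeriv ℝ n (comp j k) x‖ ≤ C
  closed : ∀ i j k x,
    fderiv ℝ (comp j k) x (EuclideanSpace.single i 1) +
      fderiv ℝ (comp k i) x (EuclideanSpace.single j 1) +
        fderiv ℝ (comp i j) x (EuclideanSpace.single k 1) = 0

namespace MagneticField
variable {d : ℕ} (B : MagneticField d)

/-- The vector potential in the transversal gauge,
`A_k(x) = ∑_j ∫₀¹ s x_j B_{jk}(s x) ds`. -/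
def potential (k : Fin d) (x : Pos d) : ℝ :=
  ∑ j, ∫ s in (0 : ℝ)..1, s * x j * B.comp j k (s • x)

/-- The circulation of the vector potential along the segment from `y` to `x`. -/
def circulation (x y : Pos d) : ℝ :=
  ∫ s in (0 : ℝ)..1, ∑ k, (x k - y k) * B.potential k (y + s • (x - y))

lemma comp_temperate (j k : Fin d) : (B.comp j k).HasTemperateGrowth :=
  ⟨B.smooth j k, fun n => by
    obtain ⟨C, h⟩ := B.bounded j k n
    exact ⟨0, C, fun x => by simpa using h x⟩⟩

lemma coord_temperate (j : Fin d) : (fun x : Pos d => x j).HasTemperateGrowth :=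
  (EuclideanSpace.proj j : Pos d →L[ℝ] ℝ).hasTemperateGrowth

lemma potential_temperate (k : Fin d) : (B.potential k).HasTemperateGrowth := by
  unfold potential
  refine .sum fun j _ => ?_
  refine hasTemperateGrowth_paramIntegral (f := fun p : ℝ × Pos d =>
    p.1 * p.2 j * B.comp j k (p.1 • p.2)) ?_
  have h1 : (fun p : ℝ × Pos d => p.1).HasTemperateGrowth :=
    (ContinuousLinearMap.fst ℝ ℝ (Pos d)).hasTemperateGrowth
  have h2 : (fun p : ℝ × Pos d => p.2).HasTemperateGrowth :=
    (ContinuousLinearMap.snd ℝ ℝ (Pos d)).hasTemperateGrowth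
  exact (h1.mul ((coord_temperate j).comp h2)).mul ((B.comp_temperate j k).comp (h1.smul h2))

lemma circulation_temperate :
    (fun p : Phase d => B.circulation p.1 p.2).HasTemperateGrowth := by
  unfold circulation
  refine hasTemperateGrowth_paramIntegral (f := fun p : ℝ × Phase d =>
    ∑ k, (p.2.1 k - p.2.2 k) * B.potential k (p.2.2 + p.1 • (p.2.1 - p.2.2))) ?_
  have h1 : (fun p : ℝ × Phase d => p.1).HasTemperateGrowth :=
    (ContinuousLinearMap.fst ℝ ℝ (Phase d)).hasTemperateGrowth
  have h2 : (fun p : ℝ × Phase d => p.2.1).HasTemperateGrowth :=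
    ((ContinuousLinearMap.fst ℝ (Pos d) (Pos d)).comp
      (ContinuousLinearMap.snd ℝ ℝ (Phase d))).hasTemperateGrowth
  have h3 : (fun p : ℝ × Phase d => p.2.2).HasTemperateGrowth :=
    ((ContinuousLinearMap.snd ℝ (Pos d) (Pos d)).comp
      (ContinuousLinearMap.snd ℝ ℝ (Phase d))).hasTemperateGrowth
  refine .sum fun k _ => ?_
  exact (((coord_temperate k).comp h2).sub ((coord_temperate k).comp h3)).mul
    ((B.potential_temperate k).comp (h3.add (h1.smul (h2.sub h3))))

end MagneticField


section Equivs
variable {D E : Type} [NormedAddCommGroup D] [NormedSpace ℝ D] [NormedAddCommGroup E]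
  [NormedSpace ℝ E]

/-- Change of variables by a linear isomorphism, `f ↦ f ∘ g`. -/
def compEquiv (g : D ≃L[ℝ] E) : 𝓢(E, ℂ) ≃L[ℂ] 𝓢(D, ℂ) :=
  .equivOfInverse (compCLMOfContinuousLinearEquiv ℂ g) (compCLMOfContinuousLinearEquiv ℂ g.symm)
    (fun f => by ext x; simp) (fun f => by ext x; simp)

@[simp] lemma compEquiv_apply (g : D ≃L[ℝ] E) (f : 𝓢(E, ℂ)) (x : D) :
    compEquiv g f x = f (g x) := rfl

@[simp] lemma compEquiv_symm_apply (g : D ≃L[ℝ] E) (f : 𝓢(D, ℂ)) (x : E) :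
    (compEquiv g).symm f x = f (g.symm x) := rfl

lemma phase_temperate {θ : E → ℝ} (hθ : θ.HasTemperateGrowth) :
    (fun x => Complex.exp (θ x * Complex.I)).HasTemperateGrowth :=
  hasTemperateGrowth_expI.comp hθ

lemma phase_temperate' {θ : E → ℝ} (hθ : θ.HasTemperateGrowth) :
    (fun x => Complex.exp (-(θ x * Complex.I))).HasTemperateGrowth := by
  simpa using phase_temperate hθ.neg

/-- Multiplication by the phase `exp(iθ)`. -/
def phaseEquiv (θ : E → ℝ) (hθ : θ.HasTemperateGrowth) : 𝓢(E, ℂ) ≃L[ℂ] 𝓢(E, ℂ) :=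
  .equivOfInverse (smulLeftCLM ℂ fun x => Complex.exp (θ x * Complex.I))
    (smulLeftCLM ℂ fun x => Complex.exp (-(θ x * Complex.I)))
    (fun f => by
      ext x
      rw [smulLeftCLM_apply_apply (phase_temperate' hθ), smulLeftCLM_apply_apply (phase_temperate hθ),
        smul_smul, ← Complex.exp_add]
      simp)
    (fun f => by
      ext x
      rw [smulLeftCLM_apply_apply (phase_temperate hθ), smulLeftCLM_apply_apply (phase_temperate' hθ),
        smul_smul, ← Complex.exp_add]
      simp)

@[simp] lemma phaseEquiv_apply (θ : E → ℝ) (hθ : θ.HasTemperateGrowth) (f : 𝓢(E, ℂ)) (x : E) :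
    phaseEquiv θ hθ f x = Complex.exp (θ x * Complex.I) * f x :=
  smulLeftCLM_apply_apply (phase_temperate hθ) f x

end Equivs

section Weyl
variable {Z V : Type} [NormedAddCommGroup Z] [NormedSpace ℝ Z]
  [NormedAddCommGroup V] [InnerProductSpace ℝ V] [FiniteDimensional ℝ V]
  [MeasurableSpace V] [BorelSpace V]

lemma slice_partialFourier (f : 𝓢(Z × V, ℂ)) (z : Z) :
    slice z (partialFourier f) = 𝓕 (slice z f) := by
  ext v; rfl

/-- Reflection of the second variable. -/
def negSnd : (Z × V) ≃L[ℝ] (Z × V) :=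
  (ContinuousLinearEquiv.refl ℝ Z).prodCongr (ContinuousLinearEquiv.neg ℝ)

/-- The partial Fourier transform as an automorphism of Schwartz space. -/
def partialFourierEquiv : 𝓢(Z × V, ℂ) ≃L[ℂ] 𝓢(Z × V, ℂ) :=
  .equivOfInverse partialFourier
    ((compCLMOfContinuousLinearEquiv ℂ negSnd).comp partialFourier)
    (fun f => by
      ext ⟨z, v⟩
      change partialFourier (partialFourier f) (z, -v) = f (z, v)
      rw [partialFourier_apply, slice_partialFourier]
      have h : 𝓕⁻ (𝓕 (slice z f)) = slice z f := FourierTransform.fourierInv_fourier_eq _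
      exact congrArg (fun g : 𝓢(V, ℂ) => g v) h)
    (fun f => by
      ext ⟨z, v⟩
      change partialFourier (compCLMOfContinuousLinearEquiv ℂ negSnd (partialFourier f)) (z, v)
        = f (z, v)
      rw [partialFourier_apply]
      have h1 : slice z (compCLMOfContinuousLinearEquiv ℂ negSnd (partialFourier f)) =
          𝓕⁻ (slice z f) := by
        ext w; rfl
      have h : 𝓕 (𝓕⁻ (slice z f)) = slice z f := FourierTransform.fourier_fourierInv_eq _
      simp only [h1, h]
      rfl)

/-- Dilation of the second variable by `2π`. -/
def scaleSnd : (Z × V) ≃L[ℝ] (Z × V) :=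
  (ContinuousLinearEquiv.refl ℝ Z).prodCongr
    (ContinuousLinearEquiv.smulLeft (Units.mk0 (2 * π) (by positivity)))

/-- The normalised partial Fourier transform
`f ↦ ((z, v) ↦ (2π)^{-dim V} ∫ exp(i ξ·v) f(z, ξ) dξ)` on Schwartz space. -/
def momentumFourier : 𝓢(Z × V, ℂ) ≃L[ℂ] 𝓢(Z × V, ℂ) :=
  (compEquiv scaleSnd).trans partialFourierEquiv.symm

lemma slice_momentumFourier (f : 𝓢(Z × V, ℂ)) (z : Z) :
    slice z (momentumFourier f) = 𝓕⁻ (slice z (compEquiv scaleSnd f)) := by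
  ext v; rfl

lemma momentumFourier_apply (f : 𝓢(Z × V, ℂ)) (z : Z) (v : V) :
    momentumFourier f (z, v) = ((2 * π : ℂ) ^ Module.finrank ℝ V)⁻¹ *
      ∫ ξ : V, Complex.exp (⟪ξ, v⟫_ℝ * Complex.I) * f (z, ξ) := by
  have h : momentumFourier f (z, v) = 𝓕⁻ (slice z (compEquiv scaleSnd f)) v := rfl
  rw [h, fourierInv_coe, Real.fourierInv_eq']
  have h2 := Measure.integral_comp_smul (volume : Measure V)
    (fun ξ => Complex.exp (⟪ξ, v⟫_ℝ * Complex.I) * f (z, ξ)) (2 * π)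
  have hpos : (0 : ℝ) ≤ ((2 * π) ^ Module.finrank ℝ V)⁻¹ := by positivity
  rw [abs_of_nonneg hpos, Complex.real_smul] at h2
  push_cast at h2
  rw [← h2]
  refine integral_congr_ae (.of_forall fun ξ => ?_)
  simp only [smul_eq_mul, slice_apply, compEquiv_apply, real_inner_smul_left]
  rfl

lemma integral_momentumFourier_mul [MeasurableSpace Z] [BorelSpace Z] (μ : Measure Z)
    [FiniteDimensional ℝ Z] [μ.IsAddHaarMeasure] (f g : 𝓢(Z × V, ℂ)) :
    ∫ x, momentumFourier f x * g x ∂(μ.prod volume) =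
      ∫ x, f x * momentumFourier g x ∂(μ.prod volume) := by
  have hI : ∀ f g : 𝓢(Z × V, ℂ), Integrable (fun x => f x * g x) (μ.prod volume) := fun f g =>
    (SchwartzMap.pairing (ContinuousLinearMap.mul ℂ ℂ) f g).integrable
  rw [integral_prod _ (hI _ _), integral_prod _ (hI _ _)]
  refine integral_congr_ae (.of_forall fun z => ?_)
  change ∫ v, slice z (momentumFourier f) v * slice z g v = _
  rw [slice_momentumFourier, integral_fourierInv_mul_eq]
  have h2 := Measure.integral_comp_smul (volume : Measure V)
    (fun ξ => f (z, ξ) * 𝓕⁻ (slice z g) ((2 * π)⁻¹ • ξ)) (2 * π)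
  have hpi : (2 * π : ℝ) ≠ 0 := by positivity
  simp only [inv_smul_smul₀ hpi] at h2
  refine h2.trans ?_
  have hpos : (0 : ℝ) ≤ ((2 * π) ^ Module.finrank ℝ V)⁻¹ := by positivity
  rw [abs_of_nonneg hpos, ← integral_smul]
  refine integral_congr_ae (.of_forall fun ξ => ?_)
  simp only [momentumFourier_apply, Complex.real_smul]
  rw [fourierInv_coe, Real.fourierInv_eq']
  push_cast
  rw [mul_left_comm]
  congr 3
  ext v
  have h3 : (2 * π * ((2 * π)⁻¹ * ⟪v, ξ⟫_ℝ : ℝ) : ℂ) = ⟪v, ξ⟫_ℝ := by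
    rw [← Complex.ofReal_ofNat, ← Complex.ofReal_mul, ← Complex.ofReal_mul,
      mul_inv_cancel_left₀ hpi]
  rw [real_inner_smul_right, h3]
  rfl

/-- Centre and difference coordinates `(x, y) ↦ ((x + y) / 2, x - y)`. -/
def centerEquiv (V : Type) [NormedAddCommGroup V] [NormedSpace ℝ V] : (V × V) ≃L[ℝ] (V × V) where
  toFun p := ((2⁻¹ : ℝ) • (p.1 + p.2), p.1 - p.2)
  invFun p := (p.1 + (2⁻¹ : ℝ) • p.2, p.1 - (2⁻¹ : ℝ) • p.2)
  map_add' p q := by ext <;> simp <;> module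
  map_smul' c p := by ext <;> simp <;> module
  left_inv p := by ext <;> simp <;> module
  right_inv p := by ext <;> simp <;> module
  continuous_toFun := by fun_prop
  continuous_invFun := by fun_prop

lemma measurePreserving_centerEquiv :
    MeasurePreserving (centerEquiv V) (volume : Measure (V × V)) volume := by
  have h1 : MeasurePreserving (fun p : V × V => (p.2, p.1 - p.2)) volume volume :=
    measurePreserving_prod_sub_swap volume volume
  have h2 : MeasurePreserving (fun p : V × V => (p.2, p.1 + (2⁻¹ : ℝ) • p.2)) volume volume := by
    have := (MeasurePreserving.id (volume : Measure V)).skew_product (μc := (volume : Measure V))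
      (μd := (volume : Measure V)) (g := fun x y => y + (2⁻¹ : ℝ) • x) (by fun_prop)
      (.of_forall fun x => map_add_right_eq_self _ _)
    exact this.comp Measure.measurePreserving_swap
  have h3 : MeasurePreserving (Prod.swap : V × V → V × V) volume volume :=
    Measure.measurePreserving_swap
  have h4 : ⇑(centerEquiv V) = Prod.swap ∘ (fun p : V × V => (p.2, p.1 + (2⁻¹ : ℝ) • p.2)) ∘
      fun p : V × V => (p.2, p.1 - p.2) := by
    ext1 p
    refine Prod.ext ?_ rfl
    change (2⁻¹ : ℝ) • (p.1 + p.2) = p.2 + (2⁻¹ : ℝ) • (p.1 - p.2)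
    module
  rw [h4]
  exact h3.comp (h2.comp h1)

/-- The Weyl transform with phase `θ`: it sends the symbol `f` to the kernel
`(x, y) ↦ (2π)^{-dim V} ∫ exp(i ξ·(x-y)) exp(i θ(x,y)) f((x+y)/2, ξ) dξ`. -/
def phaseWeyl (θ : V × V → ℝ) (hθ : θ.HasTemperateGrowth) : 𝓢(V × V, ℂ) ≃L[ℂ] 𝓢(V × V, ℂ) :=
  (momentumFourier.trans (compEquiv (centerEquiv V))).trans (phaseEquiv θ hθ)

/-- The transpose of `phaseWeyl` for the bilinear pairing `∫ f g`. -/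
def phaseWeylT (θ : V × V → ℝ) (hθ : θ.HasTemperateGrowth) : 𝓢(V × V, ℂ) ≃L[ℂ] 𝓢(V × V, ℂ) :=
  ((phaseEquiv θ hθ).trans (compEquiv (centerEquiv V)).symm).trans momentumFourier

lemma phaseWeyl_apply (θ : V × V → ℝ) (hθ : θ.HasTemperateGrowth) (f : 𝓢(V × V, ℂ)) (x y : V) :
    phaseWeyl θ hθ f (x, y) = ((2 * π : ℂ) ^ Module.finrank ℝ V)⁻¹ *
      ∫ ξ : V, Complex.exp (⟪ξ, x - y⟫_ℝ * Complex.I) * Complex.exp (θ (x, y) * Complex.I) *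
        f ((2⁻¹ : ℝ) • (x + y), ξ) := by
  have h : phaseWeyl θ hθ f (x, y) = Complex.exp (θ (x, y) * Complex.I) *
      momentumFourier f ((2⁻¹ : ℝ) • (x + y), x - y) := phaseEquiv_apply _ _ _ _
  rw [h, momentumFourier_apply, mul_left_comm, ← integral_const_mul]
  congr 2
  ext ξ
  ring

lemma integral_phaseWeyl_mul (θ : V × V → ℝ) (hθ : θ.HasTemperateGrowth) (f g : 𝓢(V × V, ℂ)) :
    ∫ p, phaseWeyl θ hθ f p * g p = ∫ p, f p * phaseWeylT θ hθ g p := by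
  have h1 := integral_momentumFourier_mul (volume : Measure V) f
    ((compEquiv (centerEquiv V)).symm (phaseEquiv θ hθ g))
  refine Eq.trans ?_ h1
  have hm := measurePreserving_centerEquiv (V := V)
  have h2 := hm.integral_comp (centerEquiv V).toHomeomorph.measurableEmbedding
    (fun q => momentumFourier f q * (compEquiv (centerEquiv V)).symm (phaseEquiv θ hθ g) q)
  refine Eq.trans ?_ h2
  refine integral_congr_ae (.of_forall fun p => ?_)
  have h : phaseWeyl θ hθ f p = Complex.exp (θ p * Complex.I) *
      momentumFourier f (centerEquiv V p) := phaseEquiv_apply _ _ _ _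
  simp [h]
  ring

end Weyl


lemma isAddHaarMeasure_prod {V W : Type} [NormedAddCommGroup V] [NormedSpace ℝ V]
    [FiniteDimensional ℝ V] [MeasureSpace V] [BorelSpace V] [(volume : Measure V).IsAddHaarMeasure]
    [NormedAddCommGroup W] [NormedSpace ℝ W] [FiniteDimensional ℝ W] [MeasureSpace W] [BorelSpace W]
    [(volume : Measure W).IsAddHaarMeasure] : (volume : Measure (V × W)).IsAddHaarMeasure :=
  Measure.prod.instIsAddHaarMeasure volume volume

instance (d : ℕ) : (volume : Measure (Phase d)).IsAddHaarMeasure := isAddHaarMeasure_prod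

instance (d : ℕ) : (volume : Measure (Phase d × Phase d)).IsAddHaarMeasure := isAddHaarMeasure_prod

section Hormander
variable {V : Type} [NormedAddCommGroup V]

/-- The bracket `⟨v⟩ = √(1 + ‖v‖²)`. -/
def bracket (v : V) : ℝ := √(1 + ‖v‖ ^ 2)

lemma one_le_bracket (v : V) : 1 ≤ bracket v := by
  rw [bracket, Real.one_le_sqrt]
  nlinarith [sq_nonneg ‖v‖]

lemma bracket_le (v : V) : bracket v ≤ 1 + ‖v‖ := by
  rw [bracket, Real.sqrt_le_left (by positivity)]
  nlinarith [norm_nonneg v]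

/-- A tempered weight: a positive function `m` with `m (u + v) ≤ C m(u) ⟨v⟩^a`. Replacing the norm
by an equivalent one only changes `C`, so on a product of Euclidean spaces it does not matter that
Mathlib's norm is the maximum of the norms of the components. -/
structure TemperedWeight (V : Type) [NormedAddCommGroup V] where
  /-- The underlying function. -/
  toFun : V → ℝ
  pos : ∀ x, 0 < toFun x
  tempered : ∃ a C : ℝ, 0 < a ∧ 0 < C ∧ ∀ u v, toFun (u + v) ≤ C * toFun u * bracket v ^ a

instance : CoeFun (TemperedWeight V) fun _ => V → ℝ := ⟨TemperedWeight.toFun⟩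

lemma TemperedWeight.exists_le (m : TemperedWeight V) :
    ∃ (k : ℕ) (C : ℝ), 0 < C ∧ ∀ x, m x ≤ C * (1 + ‖x‖) ^ k := by
  obtain ⟨a, C, ha, hC, h⟩ := m.tempered
  refine ⟨⌈a⌉₊, C * m 0, mul_pos hC (m.pos 0), fun x => ?_⟩
  have h1 := h 0 x
  rw [zero_add] at h1
  refine h1.trans (mul_le_mul_of_nonneg_left ?_ (mul_pos hC (m.pos 0)).le)
  calc bracket x ^ a ≤ bracket x ^ (⌈a⌉₊ : ℝ) :=
        Real.rpow_le_rpow_of_exponent_le (one_le_bracket x) (Nat.le_ceil a)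
    _ = bracket x ^ ⌈a⌉₊ := Real.rpow_natCast _ _
    _ ≤ _ := pow_le_pow_left₀ (zero_le_one.trans (one_le_bracket x)) (bracket_le x) _

/-- For tempered weights `M` on `V × V` and `m` on `V`, the weight `X ↦ M (X, X) m(X)`. -/
def TemperedWeight.diagMul (M : TemperedWeight (V × V)) (m : TemperedWeight V) :
    TemperedWeight V where
  toFun X := M (X, X) * m X
  pos X := mul_pos (M.pos _) (m.pos _)
  tempered := by
    obtain ⟨a, C, ha, hC, h⟩ := M.tempered
    obtain ⟨b, D, hb, hD, k⟩ := m.tempered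
    refine ⟨a + b, C * D, add_pos ha hb, mul_pos hC hD, fun u v => ?_⟩
    have h1 := h (u, u) (v, v)
    have h2 : bracket (v, v) = bracket v := by simp [bracket]
    have h3 : 0 < bracket v := zero_lt_one.trans_le (one_le_bracket v)
    rw [h2, Prod.mk_add_mk] at h1
    rw [Real.rpow_add h3]
    calc M (u + v, u + v) * m (u + v)
        ≤ (C * M (u, u) * bracket v ^ a) * (D * m u * bracket v ^ b) :=
          mul_le_mul h1 (k u v) (m.pos _).le
            (mul_nonneg (mul_pos hC (M.pos _)).le (Real.rpow_nonneg h3.le _))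
      _ = _ := by ring

variable [NormedSpace ℝ V]

/-- The smooth functions all of whose derivatives are dominated by the weight `m`. -/
def hormanderSubmodule (m : TemperedWeight V) : Submodule ℂ (V → ℂ) where
  carrier := {φ | ContDiff ℝ ∞ φ ∧ ∀ n : ℕ, ∃ C : ℝ, ∀ x, (m x)⁻¹ * ‖iteratedFDeriv ℝ n φ x‖ ≤ C}
  zero_mem' := ⟨contDiff_const, fun n => ⟨0, fun x => by
    rw [show (0 : V → ℂ) = fun _ => 0 from rfl, iteratedFDeriv_fun_zero]; simp⟩⟩
  add_mem' := by
    rintro φ ψ ⟨h1, h2⟩ ⟨k1, k2⟩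
    refine ⟨h1.add k1, fun n => ?_⟩
    obtain ⟨C, hC⟩ := h2 n
    obtain ⟨D, hD⟩ := k2 n
    refine ⟨C + D, fun x => ?_⟩
    rw [iteratedFDeriv_add_apply (h1.of_le (by exact_mod_cast le_top)).contDiffAt
      (k1.of_le (by exact_mod_cast le_top)).contDiffAt]
    refine le_trans ?_ (add_le_add (hC x) (hD x))
    rw [← mul_add]
    exact mul_le_mul_of_nonneg_left (norm_add_le _ _) (inv_pos.2 (m.pos x)).le
  smul_mem' := by
    rintro c φ ⟨h1, h2⟩
    refine ⟨h1.const_smul c, fun n => ?_⟩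
    obtain ⟨C, hC⟩ := h2 n
    refine ⟨‖c‖ * C, fun x => ?_⟩
    rw [iteratedFDeriv_const_smul_apply (h1.of_le (by exact_mod_cast le_top)).contDiffAt,
      norm_smul, mul_left_comm]
    exact mul_le_mul_of_nonneg_left (hC x) (norm_nonneg c)

/-- The Hörmander class of the weight `m`, with its Fréchet topology (defined below). -/
def HormanderSpace (m : TemperedWeight V) : Type := hormanderSubmodule m

namespace HormanderSpace
variable {m : TemperedWeight V}

instance : AddCommGroup (HormanderSpace m) := inferInstanceAs (AddCommGroup (hormanderSubmodule m))
instance : Module ℂ (HormanderSpace m) := inferInstanceAs (Module ℂ (hormanderSubmodule m))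
instance : CoeFun (HormanderSpace m) fun _ => V → ℂ := ⟨fun φ => φ.1⟩

/-- The seminorm `φ ↦ sup_X m(X)⁻¹ ‖D^n φ(X)‖`. -/
def seminorm (m : TemperedWeight V) (n : ℕ) : Seminorm ℂ (HormanderSpace m) :=
  Seminorm.of (fun φ => ⨆ x, (m x)⁻¹ * ‖iteratedFDeriv ℝ n φ x‖)
    (fun φ ψ => by
      have hb : ∀ χ : HormanderSpace m,
          BddAbove (Set.range fun x => (m x)⁻¹ * ‖iteratedFDeriv ℝ n χ x‖) := fun χ => by
        obtain ⟨C, hC⟩ := χ.2.2 n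
        exact ⟨C, by rintro _ ⟨x, rfl⟩; exact hC x⟩
      refine ciSup_le fun x => ?_
      refine le_trans ?_ (add_le_add (le_ciSup (hb φ) x) (le_ciSup (hb ψ) x))
      have h : iteratedFDeriv ℝ n (φ + ψ : HormanderSpace m) x =
          iteratedFDeriv ℝ n φ x + iteratedFDeriv ℝ n ψ x :=
        iteratedFDeriv_add_apply (φ.2.1.of_le (by exact_mod_cast le_top)).contDiffAt
          (ψ.2.1.of_le (by exact_mod_cast le_top)).contDiffAt
      rw [h, ← mul_add]
      exact mul_le_mul_of_nonneg_left (norm_add_le _ _) (inv_pos.2 (m.pos x)).le)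
    (fun c φ => by
      rw [Real.mul_iSup_of_nonneg (norm_nonneg c)]
      refine iSup_congr fun x => ?_
      have h : iteratedFDeriv ℝ n (c • φ : HormanderSpace m) x = c • iteratedFDeriv ℝ n φ x :=
        iteratedFDeriv_const_smul_apply (φ.2.1.of_le (by exact_mod_cast le_top)).contDiffAt
      rw [h, norm_smul, mul_left_comm])

/-- The topology of the Hörmander class, generated by the seminorms `sup_X m(X)⁻¹ ‖D^n φ(X)‖`,
`n ∈ ℕ`. They are equivalent to those built from the partial derivatives `∂^γ φ`, `|γ| ≤ n`. -/
instance : TopologicalSpace (HormanderSpace m) :=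
  SeminormFamily.addGroupFilterBasis (R := ℂ) (fun n : ℕ => seminorm m n) |>.topology

lemma withSeminorms (m : TemperedWeight V) :
    WithSeminorms (𝕜 := ℂ) (E := HormanderSpace m) (fun n : ℕ => seminorm m n) := ⟨rfl⟩

lemma hasTemperateGrowth (φ : HormanderSpace m) : Function.HasTemperateGrowth (φ : V → ℂ) := by
  refine ⟨φ.2.1, fun n => ?_⟩
  obtain ⟨k, D, hD, hm⟩ := m.exists_le
  obtain ⟨C, hC⟩ := φ.2.2 n
  have hC0 : 0 ≤ C :=
    (mul_nonneg (inv_pos.2 (m.pos 0)).le (norm_nonneg _)).trans (hC 0)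
  refine ⟨k, C * D, fun x => ?_⟩
  have h := hC x
  rw [inv_mul_le_iff₀ (m.pos x)] at h
  calc _ ≤ m x * C := h
    _ ≤ (D * (1 + ‖x‖) ^ k) * C := mul_le_mul_of_nonneg_right (hm x) hC0
    _ = _ := by ring

variable [FiniteDimensional ℝ V] [MeasureSpace V] [BorelSpace V]
  [(volume : Measure V).IsAddHaarMeasure]

/-- An element of a Hörmander class as the tempered distribution `χ ↦ ∫ φ χ`. -/
def toDist (φ : HormanderSpace m) : 𝓢'(V, ℂ) :=
  φ.hasTemperateGrowth.toTemperedDistribution volume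

lemma toDist_apply (φ : HormanderSpace m) (χ : 𝓢(V, ℂ)) : φ.toDist χ = ∫ x, χ x * φ x := rfl

end HormanderSpace

/-- The union over all tempered weights of the Hörmander classes, as tempered distributions. -/
def hormanderUnion (V : Type) [NormedAddCommGroup V] [NormedSpace ℝ V] [FiniteDimensional ℝ V]
    [MeasureSpace V] [BorelSpace V] [(volume : Measure V).IsAddHaarMeasure] : Set 𝓢'(V, ℂ) :=
  ⋃ m : TemperedWeight V, Set.range (HormanderSpace.toDist (m := m))

end Hormander

section Tensor
variable {V W : Type} [NormedAddCommGroup V] [NormedSpace ℝ V] [NormedAddCommGroup W]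
  [NormedSpace ℝ W]

/-- The map `g ↦ g ⊗ f`, where `(g ⊗ f)(x, y) = g(x) f(y)`. -/
def tensorRight (f : 𝓢(W, ℂ)) : 𝓢(V, ℂ) →L[ℂ] 𝓢(V × W, ℂ) :=
  mkCLM (fun g p => g p.1 * f p.2) (fun _ _ _ => by simp [add_mul])
    (fun _ _ _ => by simp [mul_assoc])
    (fun g => ((g.smooth ⊤).comp contDiff_fst).mul ((f.smooth ⊤).comp contDiff_snd))
    (fun ⟨k, n⟩ => by
      refine ⟨Finset.Iic (k, n), ∑ i ∈ Finset.range (n + 1), (n.choose i : ℝ) * (2 ^ k *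
        (2 ^ k * (Finset.Iic (k, n)).sup (schwartzSeminormFamily ℂ W ℂ) f)), ?_, fun g p => ?_⟩
      · exact Finset.sum_nonneg fun i _ => by positivity
      · have hg : ContDiff ℝ n (fun p : V × W => g p.1) := (g.smooth n).comp contDiff_fst
        have hf : ContDiff ℝ n (fun p : V × W => f p.2) := (f.smooth n).comp contDiff_snd
        have h1 := norm_iteratedFDeriv_mul_le hg hf p (n := n) le_rfl
        have hfst : ∀ i, ‖iteratedFDeriv ℝ i (fun p : V × W => g p.1) p‖ ≤
            ‖iteratedFDeriv ℝ i g p.1‖ := fun i => by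
          have h := (ContinuousLinearMap.fst ℝ V W).iteratedFDeriv_comp_right (g.smooth i) p le_rfl
          have h' : (fun p : V × W => g p.1) = g ∘ ContinuousLinearMap.fst ℝ V W := rfl
          rw [h', h]
          refine (ContinuousMultilinearMap.norm_compContinuousLinearMap_le _ _).trans ?_
          refine mul_le_of_le_one_right (norm_nonneg _) ?_
          exact Finset.prod_le_one (fun _ _ => norm_nonneg _)
            fun _ _ => ContinuousLinearMap.norm_fst_le ℝ V W
        have hsnd : ∀ i, ‖iteratedFDeriv ℝ i (fun p : V × W => f p.2) p‖ ≤
            ‖iteratedFDeriv ℝ i f p.2‖ := fun i => by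
          have h := (ContinuousLinearMap.snd ℝ V W).iteratedFDeriv_comp_right (f.smooth i) p le_rfl
          have h' : (fun p : V × W => f p.2) = f ∘ ContinuousLinearMap.snd ℝ V W := rfl
          rw [h', h]
          refine (ContinuousMultilinearMap.norm_compContinuousLinearMap_le _ _).trans ?_
          refine mul_le_of_le_one_right (norm_nonneg _) ?_
          exact Finset.prod_le_one (fun _ _ => norm_nonneg _)
            fun _ _ => ContinuousLinearMap.norm_snd_le ℝ V W
        have hp : ‖p‖ ^ k ≤ (1 + ‖p.1‖) ^ k * (1 + ‖p.2‖) ^ k := by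
          rw [← mul_pow]
          refine pow_le_pow_left₀ (norm_nonneg _) ?_ _
          rw [Prod.norm_def]
          have a1 := norm_nonneg p.1
          have a2 := norm_nonneg p.2
          refine max_le ?_ ?_ <;> nlinarith [mul_nonneg a1 a2]
        rw [Finset.sum_mul]
        refine (mul_le_mul hp h1 (norm_nonneg _) (by positivity)).trans ?_
        rw [Finset.mul_sum]
        refine Finset.sum_le_sum fun i hi => ?_
        rw [Finset.mem_range] at hi
        have b1 := one_add_le_sup_seminorm_apply (𝕜 := ℂ) (m := (k, n)) (k := k) (n := i) le_rfl
          (by simp only; omega) g p.1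
        have b2 := one_add_le_sup_seminorm_apply (𝕜 := ℂ) (m := (k, n)) (k := k) (n := n - i) le_rfl
          (by simp only; omega) f p.2
        calc (1 + ‖p.1‖) ^ k * (1 + ‖p.2‖) ^ k *
              ((n.choose i : ℝ) * ‖iteratedFDeriv ℝ i (fun p : V × W => g p.1) p‖ *
                ‖iteratedFDeriv ℝ (n - i) (fun p : V × W => f p.2) p‖)
            ≤ (1 + ‖p.1‖) ^ k * (1 + ‖p.2‖) ^ k *
              ((n.choose i : ℝ) * ‖iteratedFDeriv ℝ i g p.1‖ *
                ‖iteratedFDeriv ℝ (n - i) f p.2‖) := by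
              gcongr
              · exact hfst i
              · exact hsnd (n - i)
          _ = (n.choose i : ℝ) * (((1 + ‖p.1‖) ^ k * ‖iteratedFDeriv ℝ i g p.1‖) *
              ((1 + ‖p.2‖) ^ k * ‖iteratedFDeriv ℝ (n - i) f p.2‖)) := by ring
          _ ≤ (n.choose i : ℝ) * ((2 ^ k * (Finset.Iic (k, n)).sup
                (schwartzSeminormFamily ℂ V ℂ) g) *
              (2 ^ k * (Finset.Iic (k, n)).sup (schwartzSeminormFamily ℂ W ℂ) f)) :=
              mul_le_mul_of_nonneg_left (mul_le_mul b1 b2 (by positivity) (by positivity))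
                (Nat.cast_nonneg _)
          _ = _ := by ring)

@[simp] lemma tensorRight_apply (f : 𝓢(W, ℂ)) (g : 𝓢(V, ℂ)) (x : V) (y : W) :
    tensorRight f g (x, y) = g x * f y := rfl

/-- The operator with distributional kernel `K`: `⟨kernelOp K f, g⟩ = ⟨K, g ⊗ f⟩`. -/
def kernelOp (K : 𝓢'(V × W, ℂ)) (f : 𝓢(W, ℂ)) : 𝓢'(V, ℂ) :=
  PointwiseConvergenceCLM.precomp ℂ (tensorRight f) K

@[simp] lemma kernelOp_apply (K : 𝓢'(V × W, ℂ)) (f : 𝓢(W, ℂ)) (g : 𝓢(V, ℂ)) :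
    kernelOp K f g = K (tensorRight f g) := rfl

end Tensor


section Measure
variable {α β γ δ : Type} [MeasureSpace α] [MeasureSpace β] [MeasureSpace γ] [MeasureSpace δ]
  [SigmaFinite (volume : Measure α)] [SigmaFinite (volume : Measure β)]
  [SigmaFinite (volume : Measure γ)] [SigmaFinite (volume : Measure δ)]

lemma measurePreserving_prodComm :
    MeasurePreserving (fun p : (α × β) × (γ × δ) => ((p.1.1, p.2.1), (p.1.2, p.2.2)))
      volume volume := by
  have h1 := measurePreserving_prodAssoc (volume : Measure α) (volume : Measure β)
    (volume : Measure (γ × δ))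
  have h2 := (measurePreserving_prodAssoc (volume : Measure β) (volume : Measure γ)
    (volume : Measure δ)).symm
  have h3 : MeasurePreserving (Prod.swap : β × γ → γ × β) volume volume :=
    Measure.measurePreserving_swap
  have h4 := h3.prod (MeasurePreserving.id (volume : Measure δ))
  have h5 := measurePreserving_prodAssoc (volume : Measure γ) (volume : Measure β)
    (volume : Measure δ)
  have h6 := (MeasurePreserving.id (volume : Measure α)).prod (h5.comp (h4.comp h2))
  have h7 := (measurePreserving_prodAssoc (volume : Measure α) (volume : Measure γ)
    (volume : Measure (β × δ))).symm
  exact h7.comp (h6.comp h1)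

end Measure

section Magnetic
variable {d : ℕ} (B : MagneticField d)

/-- The magnetic Weyl transform `k^A` on Schwartz functions, see `weylTransform_apply`. -/
def weylTransform : 𝓢(Phase d, ℂ) ≃L[ℂ] 𝓢(Phase d, ℂ) :=
  phaseWeyl (fun p => B.circulation p.1 p.2) B.circulation_temperate

/-- The transpose of `k^A`, see `integral_weylTransform_mul`. -/
def weylTransformT : 𝓢(Phase d, ℂ) ≃L[ℂ] 𝓢(Phase d, ℂ) :=
  phaseWeylT (fun p => B.circulation p.1 p.2) B.circulation_temperate

lemma weylTransform_apply (ψ : 𝓢(Phase d, ℂ)) (x y : Pos d) :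
    weylTransform B ψ (x, y) = ((2 * π : ℂ) ^ d)⁻¹ *
      ∫ ξ : Pos d, Complex.exp (⟪ξ, x - y⟫_ℝ * Complex.I) *
        Complex.exp (B.circulation x y * Complex.I) * ψ ((2⁻¹ : ℝ) • (x + y), ξ) := by
  have h := phaseWeyl_apply (fun p : Phase d => B.circulation p.1 p.2) B.circulation_temperate ψ x y
  rwa [finrank_euclideanSpace_fin] at h

lemma integral_weylTransform_mul (ψ χ : 𝓢(Phase d, ℂ)) :
    ∫ X, weylTransform B ψ X * χ X = ∫ X, ψ X * weylTransformT B χ X :=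
  integral_phaseWeyl_mul _ _ ψ χ

/-- The Euclidean space of pairs `(x_L, x_R)`. -/
abbrev PosPair (d : ℕ) : Type := WithLp 2 (Pos d × Pos d)

/-- The rearrangement `((z_L, z_R), (ζ_L, ζ_R)) ↦ ((z_L, ζ_L), (z_R, -ζ_R))`. -/
def symbolEquiv (d : ℕ) : (PosPair d × PosPair d) ≃L[ℝ] (Phase d × Phase d) :=
  (((WithLp.prodContinuousLinearEquiv 2 ℝ (Pos d) (Pos d)).prodCongr
      (WithLp.prodContinuousLinearEquiv 2 ℝ (Pos d) (Pos d))).trans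
    (ContinuousLinearEquiv.prodProdProdComm ℝ (Pos d) (Pos d) (Pos d) (Pos d))).trans
    ((ContinuousLinearEquiv.refl ℝ (Phase d)).prodCongr
      ((ContinuousLinearEquiv.refl ℝ (Pos d)).prodCongr (ContinuousLinearEquiv.neg ℝ)))

/-- The identification of the coordinates `((x_L, x_R), (y_L, y_R))` of a super kernel. -/
def kernelEquiv (d : ℕ) : (Phase d × Phase d) ≃L[ℝ] (PosPair d × PosPair d) :=
  (WithLp.prodContinuousLinearEquiv 2 ℝ (Pos d) (Pos d)).symm.prodCongr
    (WithLp.prodContinuousLinearEquiv 2 ℝ (Pos d) (Pos d)).symm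

/-- The phase `φ(x_L, y_L) - φ(x_R, y_R)` of the super Weyl transform. -/
def superPhase (p : PosPair d × PosPair d) : ℝ :=
  B.circulation p.1.fst p.2.fst - B.circulation p.1.snd p.2.snd

lemma superPhase_temperate : (superPhase B).HasTemperateGrowth := by
  have h : ∀ L : (PosPair d × PosPair d) →L[ℝ] Phase d,
      (fun p => B.circulation (L p).1 (L p).2).HasTemperateGrowth := fun L =>
    B.circulation_temperate.comp L.hasTemperateGrowth
  let e := WithLp.prodContinuousLinearEquiv 2 ℝ (Pos d) (Pos d)
  let l := (ContinuousLinearMap.fst ℝ (Pos d) (Pos d)).comp (e : PosPair d →L[ℝ] Phase d)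
  let r := (ContinuousLinearMap.snd ℝ (Pos d) (Pos d)).comp (e : PosPair d →L[ℝ] Phase d)
  exact (h (l.prodMap l)).sub (h (r.prodMap r))

/-- The magnetic super Weyl transform `K^A` on Schwartz functions, from super symbols in the
variables `((x_L, ξ_L), (x_R, ξ_R))` to super kernels in the variables `((x_L, x_R), (y_L, y_R))`,
see `superWeylTransform_apply`. -/
def superWeylTransform : 𝓢(Phase d × Phase d, ℂ) ≃L[ℂ] 𝓢(Phase d × Phase d, ℂ) :=
  ((compEquiv (symbolEquiv d)).trans (phaseWeyl (superPhase B) (superPhase_temperate B))).trans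
    (compEquiv (kernelEquiv d))

/-- The transpose of `K^A`, see `integral_superWeylTransform_mul`. -/
def superWeylTransformT : 𝓢(Phase d × Phase d, ℂ) ≃L[ℂ] 𝓢(Phase d × Phase d, ℂ) :=
  ((compEquiv (kernelEquiv d)).symm.trans
    (phaseWeylT (superPhase B) (superPhase_temperate B))).trans (compEquiv (symbolEquiv d)).symm

lemma superWeylTransform_apply (Φ : 𝓢(Phase d × Phase d, ℂ)) (xL xR yL yR : Pos d) :
    superWeylTransform B Φ ((xL, xR), (yL, yR)) = ((2 * π : ℂ) ^ (2 * d))⁻¹ *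
      ∫ ξ : Pos d × Pos d,
        Complex.exp ((⟪ξ.1, xL - yL⟫_ℝ - ⟪ξ.2, xR - yR⟫_ℝ : ℝ) * Complex.I) *
        Complex.exp ((B.circulation xL yL - B.circulation xR yR : ℝ) * Complex.I) *
        Φ (((2⁻¹ : ℝ) • (xL + yL), ξ.1), ((2⁻¹ : ℝ) • (xR + yR), ξ.2)) := by
  have h := phaseWeyl_apply (superPhase B) (superPhase_temperate B) (compEquiv (symbolEquiv d) Φ)
    (WithLp.toLp 2 (xL, xR)) (WithLp.toLp 2 (yL, yR))
  refine Eq.trans h ?_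
  have hr : Module.finrank ℝ (PosPair d) = 2 * d := by
    rw [(WithLp.linearEquiv 2 ℝ (Pos d × Pos d)).finrank_eq, Module.finrank_prod,
      finrank_euclideanSpace_fin, two_mul]
  rw [hr]
  congr 1
  let e : (Pos d × Pos d) ≃L[ℝ] PosPair d :=
    ((ContinuousLinearEquiv.refl ℝ (Pos d)).prodCongr (ContinuousLinearEquiv.neg ℝ)).trans
      (WithLp.prodContinuousLinearEquiv 2 ℝ (Pos d) (Pos d)).symm
  have hm : MeasurePreserving e volume volume :=
    (WithLp.volume_preserving_toLp (Pos d) (Pos d)).comp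
      ((MeasurePreserving.id volume).prod (Measure.measurePreserving_neg volume))
  rw [← hm.integral_comp e.toHomeomorph.measurableEmbedding]
  refine integral_congr_ae (.of_forall fun ξ => ?_)
  have h1 : ⟪e ξ, WithLp.toLp 2 (xL, xR) - WithLp.toLp 2 (yL, yR)⟫_ℝ =
      ⟪ξ.1, xL - yL⟫_ℝ - ⟪ξ.2, xR - yR⟫_ℝ := by
    have : e ξ = WithLp.toLp 2 (ξ.1, -ξ.2) := rfl
    rw [this, WithLp.prod_inner_apply]
    simp [sub_eq_add_neg]
  have h2 : symbolEquiv d ((2⁻¹ : ℝ) • (WithLp.toLp 2 (xL, xR) + WithLp.toLp 2 (yL, yR)), e ξ) =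
      (((2⁻¹ : ℝ) • (xL + yL), ξ.1), ((2⁻¹ : ℝ) • (xR + yR), - -ξ.2)) := rfl
  simp only [h1, compEquiv_apply, h2, neg_neg]
  rfl

lemma integral_superWeylTransform_mul (Φ G : 𝓢(Phase d × Phase d, ℂ)) :
    ∫ p, superWeylTransform B Φ p * G p = ∫ p, Φ p * superWeylTransformT B G p := by
  have hk : MeasurePreserving (kernelEquiv d) volume volume :=
    (WithLp.volume_preserving_toLp (Pos d) (Pos d)).prod
      (WithLp.volume_preserving_toLp (Pos d) (Pos d))
  have hs : MeasurePreserving (symbolEquiv d) volume volume := by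
    have h3 : MeasurePreserving (fun q : Phase d × Phase d => (q.1, (q.2.1, -q.2.2)))
        volume volume := (MeasurePreserving.id (volume : Measure (Phase d))).prod
      ((MeasurePreserving.id (volume : Measure (Pos d))).prod
        (Measure.measurePreserving_neg (volume : Measure (Pos d))))
    exact h3.comp (measurePreserving_prodComm.comp
      ((WithLp.volume_preserving_ofLp (Pos d) (Pos d)).prod
        (WithLp.volume_preserving_ofLp (Pos d) (Pos d))))
  have h1 := hk.integral_comp (kernelEquiv d).toHomeomorph.measurableEmbedding fun q =>
    phaseWeyl (superPhase B) (superPhase_temperate B) (compEquiv (symbolEquiv d) Φ) q *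
      (compEquiv (kernelEquiv d)).symm G q
  have h2 := hs.integral_comp (symbolEquiv d).toHomeomorph.measurableEmbedding fun q =>
    Φ q * superWeylTransformT B G q
  rw [← h2]
  refine Eq.trans ?_ (h1.trans ((integral_phaseWeyl_mul _ _ _ _).trans ?_))
  · refine integral_congr_ae (.of_forall fun p => ?_)
    simp [superWeylTransform]
  · refine integral_congr_ae (.of_forall fun p => ?_)
    simp [superWeylTransformT]

/-- The extension of `K^A` to tempered distributions by duality. -/
def superWeylDist (Φ : 𝓢'(Phase d × Phase d, ℂ)) : 𝓢'(Phase d × Phase d, ℂ) :=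
  PointwiseConvergenceCLM.precomp ℂ (superWeylTransformT B : _ →L[ℂ] _) Φ

/-- The extension of `k^A` to tempered distributions by duality, as a bijection. -/
def weylDist : 𝓢'(Phase d, ℂ) ≃ₗ[ℂ] 𝓢'(Phase d, ℂ) :=
  { (PointwiseConvergenceCLM.precomp ℂ (weylTransformT B : _ →L[ℂ] _)).toLinearMap with
    invFun := PointwiseConvergenceCLM.precomp ℂ ((weylTransformT B).symm : _ →L[ℂ] _)
    left_inv := fun u => by
      ext χ
      change u (weylTransformT B ((weylTransformT B).symm χ)) = u χ
      rw [ContinuousLinearEquiv.apply_symm_apply]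
    right_inv := fun u => by
      ext χ
      change u ((weylTransformT B).symm (weylTransformT B χ)) = u χ
      rw [ContinuousLinearEquiv.symm_apply_apply] }

lemma weylDist_apply (u : 𝓢'(Phase d, ℂ)) (χ : 𝓢(Phase d, ℂ)) :
    weylDist B u χ = u (weylTransformT B χ) := rfl

/-- The extension of `k^A` to tempered distributions agrees with `k^A` on Schwartz functions. -/
lemma weylDist_schwartz (ψ : 𝓢(Phase d, ℂ)) :
    weylDist B (toTemperedDistributionCLM (Phase d) ℂ volume ψ) =
      toTemperedDistributionCLM (Phase d) ℂ volume (weylTransform B ψ) := by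
  ext χ
  have h := integral_weylTransform_mul B ψ χ
  simp only [weylDist_apply, toTemperedDistributionCLM_apply_apply, smul_eq_mul]
  simpa only [mul_comm] using h.symm

lemma superWeylDist_schwartz (Φ : 𝓢(Phase d × Phase d, ℂ)) :
    superWeylDist B (toTemperedDistributionCLM (Phase d × Phase d) ℂ volume Φ) =
      toTemperedDistributionCLM (Phase d × Phase d) ℂ volume (superWeylTransform B Φ) := by
  ext χ
  have h := integral_superWeylTransform_mul B Φ χ
  change toTemperedDistributionCLM (Phase d × Phase d) ℂ volume Φ (superWeylTransformT B χ) = _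
  simp only [toTemperedDistributionCLM_apply_apply, smul_eq_mul]
  simpa only [mul_comm] using h.symm

/-- The magnetic semi-super Weyl product of a tempered distribution `Φ` and a Schwartz function `ψ`,
`Φ • ψ = (k^A)⁻¹ (Int (K^A Φ) (k^A ψ))`. -/
def semiSuperProduct (Φ : 𝓢'(Phase d × Phase d, ℂ)) (ψ : 𝓢(Phase d, ℂ)) : 𝓢'(Phase d, ℂ) :=
  (weylDist B).symm (kernelOp (superWeylDist B Φ) (weylTransform B ψ))

/-- `T` is a formal transpose of the map `ψ ↦ Φ • ψ`, i.e. `⟨Φ • ψ, χ⟩ = ⟨ψ, T χ⟩`. -/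
def IsFormalTranspose (Φ : 𝓢'(Phase d × Phase d, ℂ)) (T : 𝓢(Phase d, ℂ) →L[ℂ] 𝓢(Phase d, ℂ)) :
    Prop :=
  ∀ ψ χ : 𝓢(Phase d, ℂ), semiSuperProduct B Φ ψ χ = ∫ X, ψ X * T χ X

lemma IsFormalTranspose.unique {Φ : 𝓢'(Phase d × Phase d, ℂ)}
    {T T' : 𝓢(Phase d, ℂ) →L[ℂ] 𝓢(Phase d, ℂ)} (h : IsFormalTranspose B Φ T)
    (h' : IsFormalTranspose B Φ T') : T = T' := by
  ext1 χ
  have h0 : toTemperedDistributionCLM (Phase d) ℂ volume (T χ) =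
      toTemperedDistributionCLM (Phase d) ℂ volume (T' χ) := by
    ext ψ
    simp only [toTemperedDistributionCLM_apply_apply, smul_eq_mul]
    exact (h ψ χ).symm.trans (h' ψ χ)
  have h1 : (T χ).toLp 2 volume = (T' χ).toLp 2 volume := by
    have hk := LinearMap.ker_eq_bot.1
      (Lp.ker_toTemperedDistributionCLM_eq_bot (F := ℂ) (μ := (volume : Measure (Phase d))) (p := 2))
    apply hk
    ext ψ
    have := congrArg (fun u : 𝓢'(Phase d, ℂ) => u ψ) h0
    simpa using this
  exact SchwartzMap.injective_toLp 2 volume h1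

/-- The magnetic semi-super Moyal space: the tempered distributions `Φ` for which `ψ ↦ Φ • ψ` has a
formal transpose that is a continuous operator on Schwartz space. -/
def semiSuperMoyal : Set 𝓢'(Phase d × Phase d, ℂ) := {Φ | ∃ T, IsFormalTranspose B Φ T}

/-- The semi-super product of `Φ` in the semi-super Moyal space with a tempered distribution `ψ`:
`⟨Φ • ψ, χ⟩ = ⟨ψ, T χ⟩`, where `T` is the (unique) formal transpose. -/
def semiSuperProductDist (Φ : semiSuperMoyal B) (ψ : 𝓢'(Phase d, ℂ)) : 𝓢'(Phase d, ℂ) :=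
  PointwiseConvergenceCLM.precomp ℂ Φ.2.choose ψ

lemma semiSuperProductDist_schwartz (Φ : semiSuperMoyal B) (ψ : 𝓢(Phase d, ℂ)) :
    semiSuperProductDist B Φ (toTemperedDistributionCLM (Phase d) ℂ volume ψ) =
      semiSuperProduct B Φ ψ := by
  ext χ
  rw [Φ.2.choose_spec ψ χ]
  change toTemperedDistributionCLM (Phase d) ℂ volume ψ (Φ.2.choose χ) = _
  simp only [toTemperedDistributionCLM_apply_apply, smul_eq_mul]
  simp only [mul_comm]

end Magnetic

end SuperWeyl
end

open SuperWeyl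

/-!
On Schwartz functions the semi-super product is computed by composing kernels. Written in centre and
difference coordinates, it is `(2π)^{-3d}` times the oscillatory integral over `a, b, w ∈ ℝ^d` and
`η₁, η₂, η₃ ∈ ℝ^d` of

`exp i(η₁·a - η₂·b + η₃·w) exp(iF) Φ((x_L + y_L)/2, ξ + η₁, (x_R + y_R)/2, ξ + η₂) ψ((y_L + y_R)/2, ξ + η₃)`,

where `x_L, y_L, y_R, x_R` is the quadrilateral with sides `a, w, b` and `(x_L + x_R)/2 = x`, and `F`
is the circulation of the vector potential along it. As the quadrilateral is closed, `F` is the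
magnetic flux through it: its differential contains no values of the potential, only averages of the
field `B` along the edges (`hasFDerivAt_flux`), so that all derivatives of `exp(iF)` are bounded
uniformly in `x` by powers of the side lengths (`exists_derivBound_fluxPhase`). This is where the
boundedness of `B` and `dB = 0` enter.

The phase is a nondegenerate bilinear form in `(a, b, w)` and `(η₁, η₂, η₃)`, so the integral makes
sense for all symbols, and integration by parts shows that the result is dominated by the weight of
the integrand at `a = b = w = η = 0`, which is `M(X, X) m(X)` (`exists_derivBound_oscIntegral`,
`exists_derivBound_symbolProduct`). Regularisation by a continuous partition of unity in `η`
(`oscIntegral`) makes the integral linear and absolutely convergent.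

It remains to identify this integral with the product defined by duality. For Schwartz functions
this is a change of variables (`integral_symbolProduct_mul_schwartz`). Reversing the quadrilateral
shows that the transpose of the product with `Φ` is the product with `Φ(Y, X)`. Multiplying a symbol
by dilated cutoffs approximates it by Schwartz functions in the topology of a slightly larger weight,
for which the estimates still hold, so both identities extend to all symbols
(`IsSymbol.eq_zero_of_schwartz`, `integral_symbolProduct_mul`, `integral_symbolProduct_mul_comm`).
By the estimate, the product with `Φ(Y, X)` preserves Schwartz space (`schwartzProduct`), so it is the
formal transpose; and for a symbol `ψ` the extended product is given by the same oscillatory integral.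
-/

noncomputable section
set_option linter.unusedSectionVars false
set_option maxSynthPendingDepth 3
namespace SuperWeyl

/-! ### Weighted bounds on derivatives -/

section DerivBound
variable {E E' G G₁ G₂ : Type} [NormedAddCommGroup E] [NormedSpace ℝ E]
  [NormedAddCommGroup E'] [NormedSpace ℝ E']
  [NormedAddCommGroup G] [NormedSpace ℝ G] [NormedAddCommGroup G₁] [NormedSpace ℝ G₁]
  [NormedAddCommGroup G₂] [NormedSpace ℝ G₂]

/-- The function `f` is of class `C^N`, and its derivatives of order at most `N` are dominated by
`A` times the weight `W`. -/
structure DerivBound (W : E → ℝ) (N : ℕ) (A : ℝ) (f : E → G) : Prop where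
  nonneg : 0 ≤ A
  contDiff : ContDiff ℝ N f
  bound : ∀ n ≤ N, ∀ x, ‖iteratedFDeriv ℝ n f x‖ ≤ A * W x

namespace DerivBound
variable {W W' : E → ℝ} {N : ℕ} {A A' : ℝ} {f g : E → G}

lemma norm_le (h : DerivBound W N A f) (x : E) : ‖f x‖ ≤ A * W x := by
  simpa using h.bound 0 (Nat.zero_le _) x

lemma congr (h : DerivBound W N A f) (e : ∀ x, f x = g x) : DerivBound W N A g :=
  funext e ▸ h

lemma mono_order {N' : ℕ} (h : DerivBound W N A f) (hN : N' ≤ N) : DerivBound W N' A f :=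
  ⟨h.nonneg, h.contDiff.of_le (by exact_mod_cast hN), fun n hn => h.bound n (hn.trans hN)⟩

lemma mono_weight (h : DerivBound W N A f) {C : ℝ} (hC : 0 ≤ C) (hW : ∀ x, W x ≤ C * W' x) :
    DerivBound W' N (A * C) f :=
  ⟨mul_nonneg h.nonneg hC, h.contDiff, fun n hn x => (h.bound n hn x).trans (by
    rw [mul_assoc]; exact mul_le_mul_of_nonneg_left (hW x) h.nonneg)⟩

lemma mono_weight_one (h : DerivBound W N A f) (hW : ∀ x, W x ≤ W' x) :
    DerivBound W' N A f := by
  simpa using h.mono_weight zero_le_one (W' := W') (by simpa using hW)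

lemma mono_const (h : DerivBound W N A f) (hW : ∀ x, 0 ≤ W x) (hA : A ≤ A') :
    DerivBound W N A' f :=
  ⟨h.nonneg.trans hA, h.contDiff, fun n hn x => (h.bound n hn x).trans
    (mul_le_mul_of_nonneg_right hA (hW x))⟩

lemma add (hf : DerivBound W N A f) (hg : DerivBound W N A' g) :
    DerivBound W N (A + A') (fun x => f x + g x) := by
  refine ⟨add_nonneg hf.nonneg hg.nonneg, hf.contDiff.add hg.contDiff, fun n hn x => ?_⟩
  have hn' : (n : ℕ∞ω) ≤ N := by exact_mod_cast hn
  have h : iteratedFDeriv ℝ n (fun x => f x + g x) x =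
      iteratedFDeriv ℝ n f x + iteratedFDeriv ℝ n g x :=
    iteratedFDeriv_add_apply (hf.contDiff.of_le hn').contDiffAt (hg.contDiff.of_le hn').contDiffAt
  rw [h, add_mul]
  exact (norm_add_le _ _).trans (add_le_add (hf.bound n hn x) (hg.bound n hn x))

lemma clm_comp (L : G →L[ℝ] G₁) (hf : DerivBound W N A f) :
    DerivBound W N (‖L‖ * A) (fun x => L (f x)) := by
  refine ⟨mul_nonneg (norm_nonneg _) hf.nonneg, L.contDiff.comp hf.contDiff, fun n hn x => ?_⟩
  have h := L.norm_iteratedFDeriv_comp_left (f := f) (x := x) hf.contDiff.contDiffAt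
    (n := n) (by exact_mod_cast hn)
  refine h.trans ?_
  rw [mul_assoc]
  exact mul_le_mul_of_nonneg_left (hf.bound n hn x) (norm_nonneg _)

lemma comp_clm (T : E' →L[ℝ] E) (hf : DerivBound W N A f) :
    DerivBound (fun x => W (T x)) N (A * max 1 ‖T‖ ^ N) (fun x => f (T x)) := by
  refine ⟨mul_nonneg hf.nonneg (by positivity), hf.contDiff.comp T.contDiff, fun n hn x => ?_⟩
  have h := T.iteratedFDeriv_comp_right hf.contDiff x (i := n) (by exact_mod_cast hn)
  have h' : (fun x => f (T x)) = f ∘ T := rfl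
  rw [h', h]
  refine (ContinuousMultilinearMap.norm_compContinuousLinearMap_le _ _).trans ?_
  rw [Finset.prod_const, Finset.card_univ, Fintype.card_fin, mul_right_comm]
  have h1 : ‖T‖ ^ n ≤ max 1 ‖T‖ ^ N :=
    (pow_le_pow_left₀ (norm_nonneg _) (le_max_right _ _) n).trans
      (pow_le_pow_right₀ (le_max_left _ _) hn)
  exact mul_le_mul (hf.bound n hn _) h1 (by positivity)
    ((norm_nonneg _).trans (hf.bound n hn _))

lemma bilinear (B : G →L[ℝ] G₁ →L[ℝ] G₂) {g : E → G₁} (hf : DerivBound W N A f)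
    (hg : DerivBound W' N A' g) :
    DerivBound (fun x => W x * W' x) N (‖B‖ * 2 ^ N * A * A') (fun x => B (f x) (g x)) := by
  have := hf.nonneg
  have := hg.nonneg
  refine ⟨by positivity, (B.isBoundedBilinearMap.contDiff).comp₂ hf.contDiff hg.contDiff,
    fun n hn x => ?_⟩
  have h := B.norm_iteratedFDeriv_le_of_bilinear hf.contDiff hg.contDiff x (n := n)
    (by exact_mod_cast hn)
  have hW : 0 ≤ A * W x := (norm_nonneg _).trans (hf.norm_le x)
  have hW' : 0 ≤ A' * W' x := (norm_nonneg _).trans (hg.norm_le x)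
  calc _ ≤ ‖B‖ * ∑ i ∈ Finset.range (n + 1), (n.choose i : ℝ) * ‖iteratedFDeriv ℝ i f x‖ *
        ‖iteratedFDeriv ℝ (n - i) g x‖ := h
    _ ≤ ‖B‖ * ∑ i ∈ Finset.range (n + 1), (n.choose i : ℝ) * (A * W x) * (A' * W' x) := by
        refine mul_le_mul_of_nonneg_left (Finset.sum_le_sum fun i hi => ?_) (norm_nonneg B)
        have hi' := Finset.mem_range.1 hi
        exact mul_le_mul (mul_le_mul_of_nonneg_left (hf.bound i (by omega) x) (Nat.cast_nonneg _))
          (hg.bound (n - i) (by omega) x) (norm_nonneg _) (by positivity)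
    _ = ‖B‖ * 2 ^ n * ((A * W x) * (A' * W' x)) := by
        simp_rw [mul_assoc]
        rw [← Finset.sum_mul]
        have := Nat.sum_range_choose n
        have h2 : ∑ i ∈ Finset.range (n + 1), (n.choose i : ℝ) = 2 ^ n := by exact_mod_cast this
        rw [h2]
    _ ≤ ‖B‖ * 2 ^ N * ((A * W x) * (A' * W' x)) := by
        gcongr
        exact one_le_two
    _ = _ := by ring

/-- The product estimate with a constant depending on the bilinear map only. -/
lemma exists_bilinear (B : G →L[ℝ] G₁ →L[ℝ] G₂) : ∃ K : ℝ, 0 ≤ K ∧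
      ∀ (W W' : E → ℝ) (N : ℕ) (A A' : ℝ) (f : E → G) (g : E → G₁),
      DerivBound W N A f → DerivBound W' N A' g →
      DerivBound (fun x => W x * W' x) N (K * 2 ^ N * A * A') (fun x => B (f x) (g x)) :=
  ⟨‖B‖, norm_nonneg B, fun _ _ _ _ _ _ _ hf hg => hf.bilinear B hg⟩

lemma exists_smulRight (E' G : Type) [NormedAddCommGroup E'] [NormedSpace ℝ E']
    [NormedAddCommGroup G] [NormedSpace ℝ G] : ∃ K : ℝ, 0 ≤ K ∧
      ∀ (W W' : E → ℝ) (N : ℕ) (A A' : ℝ) (f : E → E' →L[ℝ] ℝ) (g : E → G),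
      DerivBound W N A f → DerivBound W' N A' g →
      DerivBound (fun x => W x * W' x) N (K * 2 ^ N * A * A') (fun x => (f x).smulRight (g x)) :=
  exists_bilinear (ContinuousLinearMap.smulRightL ℝ E' G)

lemma fderiv (hf : DerivBound W (N + 1) A f) : DerivBound W N A (fderiv ℝ f) :=
  ⟨hf.nonneg, hf.contDiff.fderiv_right (by norm_cast), fun n hn x => by
    rw [norm_iteratedFDeriv_fderiv]
    exact hf.bound (n + 1) (by omega) x⟩

/-- A bound on the function and on the derivatives of its derivative, for induction on the order. -/
lemma of_hasFDerivAt {f' : E → E →L[ℝ] G} (h0 : ∀ x, ‖f x‖ ≤ A * W x)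
    (hd : ∀ x, HasFDerivAt f (f' x) x) (hf : DerivBound W N A f') : DerivBound W (N + 1) A f := by
  have he : _root_.fderiv ℝ f = f' := funext fun x => (hd x).fderiv
  refine ⟨hf.nonneg, ?_, fun n hn x => ?_⟩
  · rw [Nat.cast_succ, contDiff_succ_iff_fderiv]
    exact ⟨fun x => (hd x).differentiableAt, by simp, he ▸ hf.contDiff⟩
  · cases n with
    | zero => simpa using h0 x
    | succ n =>
      rw [← norm_iteratedFDeriv_fderiv, he]
      exact hf.bound n (by omega) x

lemma of_continuous (hA : 0 ≤ A) (hc : Continuous f) (h0 : ∀ x, ‖f x‖ ≤ A * W x) :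
    DerivBound W 0 A f :=
  ⟨hA, contDiff_zero.2 hc, fun n hn x => by
    obtain rfl : n = 0 := by omega
    simpa using h0 x⟩

lemma const (c : G) : DerivBound (fun _ : E => 1) N ‖c‖ (fun _ => c) := by
  refine ⟨norm_nonneg _, contDiff_const, fun n _ x => ?_⟩
  cases n with
  | zero => simp
  | succ n => rw [iteratedFDeriv_const_of_ne n.succ_ne_zero]; simp

lemma clm (L : E →L[ℝ] G) : DerivBound (fun x => 1 + ‖x‖) N ‖L‖ L := by
  have h0 : ∀ x, ‖L x‖ ≤ ‖L‖ * (1 + ‖x‖) := fun x => (L.le_opNorm x).trans (by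
    have := norm_nonneg L; nlinarith)
  have h1 : DerivBound (fun x => 1 + ‖x‖) (N + 1) ‖L‖ L :=
    of_hasFDerivAt (f' := fun _ => L) h0 (fun x => L.hasFDerivAt)
      ((const L).mono_weight_one fun x => by simp)
  exact h1.mono_order (Nat.le_succ N)

/-- Bounds on the derivatives of each order give a common bound up to any finite order. -/
lemma exists_of_forall (hW : ∀ x, 0 ≤ W x) (hf : ContDiff ℝ ∞ f)
    (h : ∀ n : ℕ, ∃ C : ℝ, ∀ x, ‖iteratedFDeriv ℝ n f x‖ ≤ C * W x) (N : ℕ) :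
    ∃ A, DerivBound W N A f := by
  choose C hC using h
  refine ⟨∑ n ∈ Finset.range (N + 1), |C n|, Finset.sum_nonneg fun _ _ => abs_nonneg _,
    hf.of_le (by exact_mod_cast le_top), fun n hn x => (hC n x).trans ?_⟩
  refine mul_le_mul_of_nonneg_right ((le_abs_self _).trans ?_) (hW x)
  exact Finset.single_le_sum (f := fun n => |C n|) (fun _ _ => abs_nonneg _)
    (Finset.mem_range.2 (by omega))

end DerivBound
end DerivBound

/-! ### Tempered weights -/

section Weights
variable {E E' : Type} [NormedAddCommGroup E] [NormedSpace ℝ E]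
  [NormedAddCommGroup E'] [NormedSpace ℝ E']

/-- Tempered weights, with the moderateness condition stated with an integral power of `1 + ‖v‖`
rather than a real power of the bracket. -/
structure IsTempered (w : E → ℝ) : Prop where
  pos : ∀ x, 0 < w x
  moderate : ∃ (k : ℕ) (C : ℝ), 0 < C ∧ ∀ u v, w (u + v) ≤ C * w u * (1 + ‖v‖) ^ k

lemma TemperedWeight.isTempered (m : TemperedWeight E) : IsTempered m := by
  refine ⟨m.pos, ?_⟩
  obtain ⟨a, C, ha, hC, h⟩ := m.tempered
  refine ⟨⌈a⌉₊, C, hC, fun u v => ?_⟩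
  refine (h u v).trans (mul_le_mul_of_nonneg_left ?_ (mul_pos hC (m.pos _)).le)
  calc bracket v ^ a ≤ bracket v ^ (⌈a⌉₊ : ℝ) :=
        Real.rpow_le_rpow_of_exponent_le (one_le_bracket v) (Nat.le_ceil a)
    _ = bracket v ^ ⌈a⌉₊ := Real.rpow_natCast _ _
    _ ≤ _ := pow_le_pow_left₀ (zero_le_one.trans (one_le_bracket v)) (bracket_le v) _

namespace IsTempered
variable {w w' : E → ℝ}

lemma mul (h : IsTempered w) (h' : IsTempered w') : IsTempered (fun x => w x * w' x) := by
  refine ⟨fun x => mul_pos (h.pos x) (h'.pos x), ?_⟩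
  obtain ⟨k, C, hC, hw⟩ := h.moderate
  obtain ⟨k', C', hC', hw'⟩ := h'.moderate
  refine ⟨k + k', C * C', by positivity, fun u v => ?_⟩
  have := h.pos u
  calc w (u + v) * w' (u + v) ≤ (C * w u * (1 + ‖v‖) ^ k) * (C' * w' u * (1 + ‖v‖) ^ k') :=
        mul_le_mul (hw u v) (hw' u v) (h'.pos _).le (by positivity)
    _ = _ := by ring

lemma comp_clm (h : IsTempered w) (T : E' →L[ℝ] E) : IsTempered (fun x => w (T x)) := by
  refine ⟨fun x => h.pos _, ?_⟩
  obtain ⟨k, C, hC, hw⟩ := h.moderate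
  refine ⟨k, C * max 1 ‖T‖ ^ k, by positivity, fun u v => ?_⟩
  have := h.pos (T u)
  have h1 : 1 + ‖T v‖ ≤ max 1 ‖T‖ * (1 + ‖v‖) := by
    rw [mul_add, mul_one]
    exact add_le_add (le_max_left _ _) ((T.le_opNorm v).trans
      (mul_le_mul_of_nonneg_right (le_max_right _ _) (norm_nonneg v)))
  rw [map_add]
  calc w (T u + T v) ≤ C * w (T u) * (1 + ‖T v‖) ^ k := hw _ _
    _ ≤ C * w (T u) * (max 1 ‖T‖ * (1 + ‖v‖)) ^ k := by gcongr
    _ = _ := by rw [mul_pow]; ring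

lemma inv (h : IsTempered w) : IsTempered (fun x => (w x)⁻¹) := by
  refine ⟨fun x => inv_pos.2 (h.pos x), ?_⟩
  obtain ⟨k, C, hC, hw⟩ := h.moderate
  refine ⟨k, C, hC, fun u v => ?_⟩
  have h1 := hw (u + v) (-v)
  rw [add_neg_cancel_right, norm_neg] at h1
  have h2 := h.pos u
  have h3 := h.pos (u + v)
  rw [mul_right_comm, ← div_eq_mul_inv, inv_le_comm₀ h3 (by positivity), inv_div,
    div_le_iff₀ (by positivity)]
  linarith

lemma one_add_norm_pow (k : ℕ) : IsTempered (fun x : E => (1 + ‖x‖) ^ k) := by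
  refine ⟨fun x => by positivity, k, 1, one_pos, fun u v => ?_⟩
  rw [one_mul, ← mul_pow]
  gcongr
  nlinarith [norm_add_le u v, mul_nonneg (norm_nonneg u) (norm_nonneg v)]

end IsTempered

/-- The weight `(1 + ‖v‖)^{-l}`. -/
def decay (l : ℕ) (v : E) : ℝ := ((1 + ‖v‖) ^ l)⁻¹

lemma decay_pos (l : ℕ) (v : E) : 0 < decay l v := by unfold decay; positivity

lemma isTempered_decay (l : ℕ) : IsTempered (decay l : E → ℝ) :=
  (IsTempered.one_add_norm_pow l).inv

lemma decay_anti {l l' : ℕ} (h : l ≤ l') (v : E) : decay l' v ≤ decay l v := by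
  unfold decay
  gcongr
  simp

lemma one_add_norm_pow_mul_decay (k l : ℕ) (v : E) :
    (1 + ‖v‖) ^ k * decay (l + k) v = decay l v := by
  unfold decay
  rw [pow_add, mul_inv]
  field_simp

lemma decay_zero (v : E) : decay 0 v = 1 := by simp [decay]

lemma continuous_decay (l : ℕ) : Continuous (decay l : E → ℝ) := by
  unfold decay
  exact Continuous.inv₀ (by fun_prop) fun x => by positivity

lemma integrable_decay [FiniteDimensional ℝ E] [MeasureSpace E] [BorelSpace E]
    [(volume : Measure E).IsAddHaarMeasure] {l : ℕ}
    (hl : (volume : Measure E).integrablePower ≤ l) : Integrable (decay l : E → ℝ) := by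
  have h := Measure.integrable_pow_neg_integrablePower (volume : Measure E)
  refine h.mono' (continuous_decay l).aestronglyMeasurable (.of_forall fun v => ?_)
  rw [Real.norm_of_nonneg (decay_pos l v).le, Real.rpow_neg (by positivity), Real.rpow_natCast]
  exact decay_anti hl v

end Weights

/-! ### Integrals against a bilinear phase -/

section PhaseIntegral
variable {P V G : Type} [NormedAddCommGroup P] [NormedSpace ℝ P]
  [NormedAddCommGroup V] [NormedSpace ℝ V] [FiniteDimensional ℝ V] [MeasureSpace V] [BorelSpace V]
  [(volume : Measure V).IsAddHaarMeasure]
  [NormedAddCommGroup G] [NormedSpace ℂ G]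

/-- The unimodular factor `exp(i t)`. -/
def phase (t : ℝ) : ℂ := Complex.exp (t * Complex.I)

@[simp] lemma norm_phase (t : ℝ) : ‖phase t‖ = 1 := Complex.norm_exp_ofReal_mul_I t

lemma phase_add (s t : ℝ) : phase (s + t) = phase s * phase t := by
  simp [phase, add_mul, Complex.exp_add]

lemma continuous_phase : Continuous phase := by unfold phase; fun_prop

lemma hasFDerivAt_phase_comp {E : Type} [NormedAddCommGroup E] [NormedSpace ℝ E] {θ : E → ℝ}
    {θ' : E →L[ℝ] ℝ} {x : E} (h : HasFDerivAt θ θ' x) :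
    HasFDerivAt (fun x => phase (θ x)) ((phase (θ x) * Complex.I) • Complex.ofRealCLM.comp θ') x := by
  have h1 : HasDerivAt phase (phase (θ x) * Complex.I) (θ x) := by
    have h := (((hasDerivAt_id (θ x)).ofReal_comp.mul_const Complex.I).cexp)
    exact h.congr_deriv (by simp [phase])
  have h2 := h1.hasFDerivAt.comp x h
  refine h2.congr_fderiv ?_
  ext v
  simp [mul_comm]

/-- The integral `p ↦ ∫ exp(i Λ(p, v)) f(p, v) dv` of `f` against a bilinear phase `Λ`. -/
def phaseIntegral (Λ : P →L[ℝ] V →L[ℝ] ℝ) (f : P × V → G) (p : P) : G :=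
  ∫ v, phase (Λ p v) • f (p, v)

/-- The integration order for which `decay` is integrable on `V`. -/
abbrev decayOrder (V : Type) [NormedAddCommGroup V] [MeasureSpace V]
    [(volume : Measure V).HasTemperateGrowth] : ℕ := (volume : Measure V).integrablePower

variable {w : P → ℝ} {N : ℕ} {A : ℝ} {f : P × V → G}

lemma integrable_of_decay {l : ℕ} (hl : decayOrder V ≤ l) {C : ℝ} {g : V → G} (hg : Continuous g)
    (h : ∀ v, ‖g v‖ ≤ C * decay l v) : Integrable g :=
  ((integrable_decay hl).const_mul C).mono' hg.aestronglyMeasurable (.of_forall h)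

lemma integrable_phase_smul (Λ : P →L[ℝ] V →L[ℝ] ℝ) {l : ℕ} (hl : decayOrder V ≤ l)
    (hf : DerivBound (fun x : P × V => w x.1 * decay l x.2) N A f) (p : P) :
    Integrable (fun v => phase (Λ p v) • f (p, v)) := by
  have hc := hf.contDiff.continuous
  refine integrable_of_decay hl (C := A * w p) ?_ fun v => ?_
  · exact (continuous_phase.comp (by fun_prop)).smul (by fun_prop)
  · rw [norm_smul, norm_phase, one_mul, mul_assoc]
    exact hf.norm_le (p, v)

lemma norm_phaseIntegral_le (Λ : P →L[ℝ] V →L[ℝ] ℝ) {l : ℕ} (hl : decayOrder V ≤ l)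
    (hf : DerivBound (fun x : P × V => w x.1 * decay l x.2) N A f) (p : P) :
    ‖phaseIntegral Λ f p‖ ≤ A * (∫ v : V, decay l v) * w p := by
  refine (norm_integral_le_of_norm_le (((integrable_decay hl).const_mul (A * w p)))
    (.of_forall fun v => ?_)).trans (le_of_eq ?_)
  · rw [norm_smul, norm_phase, one_mul, mul_assoc]
    exact hf.norm_le (p, v)
  · rw [integral_const_mul]; ring

/-- The partial derivative in the integration variable. -/
def derivSnd (f : P × V → G) (x : P × V) : V →L[ℝ] G :=
  (fderiv ℝ f x).comp (ContinuousLinearMap.inr ℝ P V)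

lemma DerivBound.derivSnd {W : P × V → ℝ} (hf : DerivBound W (N + 1) A f) :
    DerivBound W N (‖(ContinuousLinearMap.compL ℝ V (P × V) G).flip
      (ContinuousLinearMap.inr ℝ P V)‖ * A) (derivSnd f) :=
  hf.fderiv.clm_comp ((ContinuousLinearMap.compL ℝ V (P × V) G).flip
    (ContinuousLinearMap.inr ℝ P V))

/-- Integration by parts: multiplication by the covector `Λ p` amounts to differentiation of the
integrand. -/
lemma norm_mul_norm_phaseIntegral_le (Λ : P →L[ℝ] V →L[ℝ] ℝ) {l : ℕ} (hl : decayOrder V ≤ l)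
    (hf : DerivBound (fun x : P × V => w x.1 * decay l x.2) 1 A f) (p : P) :
    ‖Λ p‖ * ‖phaseIntegral Λ f p‖ ≤ ‖phaseIntegral Λ (derivSnd f) p‖ := by
  have hd : DerivBound (fun x : P × V => w x.1 * decay l x.2) 0 _ (derivSnd f) :=
    DerivBound.derivSnd (N := 0) hf
  have hi := integrable_phase_smul Λ hl hf p
  have hi' := integrable_phase_smul (G := V →L[ℝ] G) Λ hl hd p
  have hfd : ∀ v, HasFDerivAt (fun v => f (p, v)) (derivSnd f (p, v)) v := fun v =>
    ((hf.contDiff.differentiable (by simp)) (p, v)).hasFDerivAt.comp v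
      (hasFDerivAt_prodMk_right p v)
  have key : ∀ u, ‖Λ p u‖ * ‖phaseIntegral Λ f p‖ ≤ ‖phaseIntegral Λ (derivSnd f) p‖ * ‖u‖ := by
    intro u
    have he : ∀ v, HasFDerivAt (fun v => phase (Λ p v))
      ((phase (Λ p v) * Complex.I) • Complex.ofRealCLM.comp (Λ p)) v := fun v =>
        hasFDerivAt_phase_comp (Λ p).hasFDerivAt
    have hu : ∀ v, (phase (Λ p v) • derivSnd f (p, v)) u = phase (Λ p v) • derivSnd f (p, v) u :=
      fun v => rfl
    have hiu : Integrable (fun v => phase (Λ p v) • derivSnd f (p, v) u) := by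
      have := hi'.apply_continuousLinearMap u
      simpa only [hu] using this
    have hparts := integral_bilinear_hasFDerivAt_right_eq_neg_left_of_integrable
      (μ := (volume : Measure V)) (v := u) (B := ContinuousLinearMap.lsmul ℝ ℂ (E := G))
      (f := fun v => phase (Λ p v)) (g := fun v => f (p, v))
      (f' := fun v => (phase (Λ p v) * Complex.I) • Complex.ofRealCLM.comp (Λ p))
      (g' := fun v => derivSnd f (p, v))
      (by
        have := hi.smul (Complex.I * Λ p u : ℂ)
        refine this.congr (.of_forall fun v => ?_)
        simp [smul_smul]
        congr 1; ring) hiu hi (fun v _ => he v) (fun v _ => hfd v)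
    have h1 : ∫ v, phase (Λ p v) • derivSnd f (p, v) u =
        -((Complex.I * Λ p u : ℂ) • phaseIntegral Λ f p) := by
      refine hparts.trans ?_
      rw [phaseIntegral, ← integral_smul]
      congr 2
      ext1 v
      simp [smul_smul]
      congr 1; ring
    have h2 : phaseIntegral Λ (derivSnd f) p u = ∫ v, phase (Λ p v) • derivSnd f (p, v) u := by
      unfold phaseIntegral
      rw [ContinuousLinearMap.integral_apply hi']
      rfl
    calc ‖Λ p u‖ * ‖phaseIntegral Λ f p‖ = ‖phaseIntegral Λ (derivSnd f) p u‖ := by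
          rw [h2, h1, norm_neg, norm_smul]; simp
      _ ≤ _ := ContinuousLinearMap.le_opNorm _ _
  have h3 := ContinuousLinearMap.opNorm_le_bound (‖phaseIntegral Λ f p‖ • Λ p)
    (norm_nonneg (phaseIntegral Λ (derivSnd f) p)) fun u => by
      refine le_trans (le_of_eq ?_) (key u)
      rw [smul_apply, norm_smul, norm_norm, mul_comm]
  rwa [norm_smul, norm_norm, mul_comm] at h3

/-- Integrating by parts `k` times gains `k` powers of `‖Λ p‖`. The statement ranges over all target
spaces because each step replaces `f` by its derivative. -/
lemma exists_decay_bound_phaseIntegral (Λ : P →L[ℝ] V →L[ℝ] ℝ) (k : ℕ) :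
    ∀ (G : Type) [NormedAddCommGroup G] [NormedSpace ℂ G],
    ∃ C : ℝ, 0 ≤ C ∧ ∀ (w : P → ℝ) (A : ℝ) (f : P × V → G),
      DerivBound (fun x : P × V => w x.1 * decay (decayOrder V) x.2) k A f →
      ∀ p, (1 + ‖Λ p‖) ^ k * ‖phaseIntegral Λ f p‖ ≤ A * C * w p := by
  induction k with
  | zero =>
    intro G _ _
    refine ⟨∫ v : V, decay (decayOrder V) v, integral_nonneg fun v => (decay_pos _ v).le,
      fun w A f hf p => ?_⟩
    simpa using norm_phaseIntegral_le Λ le_rfl hf p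
  | succ k ih =>
    intro G _ _
    obtain ⟨C, hC, h⟩ := ih G
    obtain ⟨C', hC', h'⟩ := ih (V →L[ℝ] G)
    set c := ‖(ContinuousLinearMap.compL ℝ V (P × V) G).flip (ContinuousLinearMap.inr ℝ P V)‖
    refine ⟨C + c * C', by positivity, fun w A f hf p => ?_⟩
    have h1 := h w A f (hf.mono_order k.le_succ) p
    have h2 := h' w _ (derivSnd f) hf.derivSnd p
    have h3 := norm_mul_norm_phaseIntegral_le Λ le_rfl (hf.mono_order (by omega)) p
    calc (1 + ‖Λ p‖) ^ (k + 1) * ‖phaseIntegral Λ f p‖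
        = (1 + ‖Λ p‖) ^ k * ‖phaseIntegral Λ f p‖ +
          (1 + ‖Λ p‖) ^ k * (‖Λ p‖ * ‖phaseIntegral Λ f p‖) := by ring
      _ ≤ A * C * w p + (1 + ‖Λ p‖) ^ k * ‖phaseIntegral Λ (derivSnd f) p‖ :=
          add_le_add h1 (mul_le_mul_of_nonneg_left h3 (by positivity))
      _ ≤ A * C * w p + c * A * C' * w p := add_le_add le_rfl h2
      _ = _ := by ring

/-- The integrand whose phase integral is the derivative of that of `f`. -/
def phaseDeriv (Λ : P →L[ℝ] V →L[ℝ] ℝ) (f : P × V → G) (x : P × V) : P →L[ℝ] G :=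
  (fderiv ℝ f x).comp (ContinuousLinearMap.inl ℝ P V) +
    (Λ.flip x.2).smulRight (Complex.I • f x)

/-- Differentiating the phase produces a factor linear in the integration variable, which costs one
power of decay. -/
lemma exists_derivBound_phaseDeriv (Λ : P →L[ℝ] V →L[ℝ] ℝ) (N : ℕ) :
    ∃ C : ℝ, 0 ≤ C ∧ ∀ (w : P → ℝ) (_ : ∀ p, 0 ≤ w p) (l : ℕ) (A : ℝ) (f : P × V → G),
      DerivBound (fun x : P × V => w x.1 * decay (l + 1) x.2) (N + 1) A f →
      DerivBound (fun x : P × V => w x.1 * decay l x.2) N (A * C) (phaseDeriv Λ f) := by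
  set c := ‖(ContinuousLinearMap.compL ℝ P (P × V) G).flip (ContinuousLinearMap.inl ℝ P V)‖
  obtain ⟨K, hK, h0⟩ := DerivBound.exists_smulRight (E := P × V) P G
  set c' := K * 2 ^ N * (‖Λ.flip‖ * max 1 ‖ContinuousLinearMap.snd ℝ P V‖ ^ N) *
      ‖(ContinuousLinearMap.lsmul ℝ ℂ (E := G)) Complex.I‖ with hc'
  refine ⟨c + c', by positivity, fun w hw l A f hf => ?_⟩
  have h1 := hf.fderiv.clm_comp ((ContinuousLinearMap.compL ℝ P (P × V) G).flip
    (ContinuousLinearMap.inl ℝ P V))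
  have h2 : DerivBound (fun x : P × V => 1 + ‖x.2‖) N _ (fun x : P × V => Λ.flip x.2) :=
    (DerivBound.clm (N := N) Λ.flip).comp_clm (ContinuousLinearMap.snd ℝ P V)
  have h3 := (hf.mono_order N.le_succ).clm_comp ((ContinuousLinearMap.lsmul ℝ ℂ (E := G)) Complex.I)
  have h4 := h0 _ _ _ _ _ _ _ h2 h3
  have h5 := (h1.mono_weight_one (W' := fun x : P × V => w x.1 * decay l x.2) fun x =>
    mul_le_mul_of_nonneg_left (decay_anti l.le_succ x.2) (hw _)).add
    (h4.mono_weight_one (W' := fun x : P × V => w x.1 * decay l x.2) fun x => by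
      have := one_add_norm_pow_mul_decay 1 l x.2
      rw [pow_one] at this
      rw [mul_left_comm, this])
  refine (h5.mono_const (fun x => mul_nonneg (hw _) (decay_pos _ _).le) (le_of_eq ?_))
  rw [hc']; ring

lemma hasFDerivAt_phaseIntegral (Λ : P →L[ℝ] V →L[ℝ] ℝ) (hw : IsTempered w) {l : ℕ}
    (hl : decayOrder V ≤ l)
    (hf : DerivBound (fun x : P × V => w x.1 * decay (l + 1) x.2) 1 A f) (p : P) :
    HasFDerivAt (phaseIntegral Λ f) (phaseIntegral Λ (phaseDeriv Λ f) p) p := by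
  obtain ⟨C, hC, hc⟩ := exists_derivBound_phaseDeriv (G := G) Λ 0
  have hf' := hc w (fun p => (hw.pos p).le) l A f hf
  obtain ⟨k, D, hD, hm⟩ := hw.moderate
  have hi := fun p => integrable_phase_smul Λ (hl.trans l.le_succ) hf p
  refine hasFDerivAt_integral_of_dominated_of_fderiv_le (μ := (volume : Measure V))
    (F := fun p v => phase (Λ p v) • f (p, v))
    (F' := fun p v => phase (Λ p v) • phaseDeriv Λ f (p, v))
    (bound := fun v => A * C * (D * w p * 2 ^ k) * decay l v)
    (Metric.ball_mem_nhds p one_pos) ?_ ?_ ?_ ?_ ?_ ?_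
  · exact .of_forall fun p => (hi p).aestronglyMeasurable
  · exact hi p
  · exact (integrable_phase_smul (G := P →L[ℝ] G) Λ hl hf' p).aestronglyMeasurable
  · refine .of_forall fun v q hq => ?_
    have hA := hf'.nonneg
    have hq' : ‖q - p‖ ≤ 1 := by
      rw [mem_ball_iff_norm] at hq; exact hq.le
    have h1 := hm p (q - p)
    rw [add_sub_cancel] at h1
    have hp := hw.pos p
    rw [norm_smul, norm_phase, one_mul]
    refine (hf'.norm_le (q, v)).trans ?_
    rw [mul_assoc (A * C)]
    have h2 : (1 + ‖q - p‖) ^ k ≤ 2 ^ k :=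
      pow_le_pow_left₀ (by positivity) (by linarith) k
    refine mul_le_mul_of_nonneg_left (mul_le_mul_of_nonneg_right (h1.trans ?_)
      (decay_pos _ _).le) hA
    exact mul_le_mul_of_nonneg_left h2 (by positivity)
  · exact (integrable_decay hl).const_mul _
  · refine .of_forall fun v q _ => ?_
    have h1 : HasFDerivAt (fun q => f (q, v))
        ((fderiv ℝ f (q, v)).comp (ContinuousLinearMap.inl ℝ P V)) q :=
      ((hf.contDiff.differentiable (by simp)) (q, v)).hasFDerivAt.comp q
        (hasFDerivAt_prodMk_left q v)
    have h2 : HasFDerivAt (fun q => phase (Λ q v))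
        ((phase (Λ q v) * Complex.I) • Complex.ofRealCLM.comp (Λ.flip v)) q :=
      hasFDerivAt_phase_comp (Λ.flip v).hasFDerivAt
    refine (h2.smul h1).congr_fderiv ?_
    ext u
    simp [phaseDeriv, smul_add]
    rw [← Complex.coe_smul, smul_smul, smul_smul]
    congr 1; ring

/-- Smoothness of phase integrals: each derivative in the parameter costs one power of decay of the
integrand, and `k` integrations by parts gain the factor `(1 + ‖Λ p‖)^{-k}`. -/
theorem exists_derivBound_phaseIntegral (Λ : P →L[ℝ] V →L[ℝ] ℝ) (k N : ℕ) :
    ∀ (G : Type) [NormedAddCommGroup G] [NormedSpace ℂ G],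
    ∃ C : ℝ, 0 ≤ C ∧ ∀ (w : P → ℝ) (_ : IsTempered w) (A : ℝ) (f : P × V → G),
      DerivBound (fun x : P × V => w x.1 * decay (decayOrder V + 1 + N) x.2) (N + 1 + k) A f →
      DerivBound (fun p => w p * decay k (Λ p)) N (A * C) (phaseIntegral Λ f) := by
  have base : ∀ (G : Type) [NormedAddCommGroup G] [NormedSpace ℂ G],
      ∃ C : ℝ, 0 ≤ C ∧ ∀ (w : P → ℝ) (_ : IsTempered w) (A : ℝ) (f : P × V → G) (l : ℕ),
      DerivBound (fun x : P × V => w x.1 * decay (decayOrder V + l) x.2) k A f →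
      ∀ p, ‖phaseIntegral Λ f p‖ ≤ A * C * (w p * decay k (Λ p)) := by
    intro G _ _
    obtain ⟨C, hC, h⟩ := exists_decay_bound_phaseIntegral Λ k G
    refine ⟨C, hC, fun w hw A f l hf p => ?_⟩
    have h1 := h w A f (hf.mono_weight_one fun x =>
      mul_le_mul_of_nonneg_left (decay_anti (by omega) x.2) (hw.pos _).le) p
    rw [decay, ← mul_assoc, ← div_eq_mul_inv, le_div_iff₀ (by positivity), mul_comm]
    exact h1
  induction N with
  | zero =>
    intro G _ _
    obtain ⟨C, hC, h⟩ := base G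
    refine ⟨C, hC, fun w hw A f hf => ?_⟩
    refine .of_continuous (mul_nonneg hf.nonneg hC) ?_
      (h w hw A f 1 (hf.mono_order (by omega)))
    exact continuous_iff_continuousAt.2 fun p =>
      (hasFDerivAt_phaseIntegral Λ hw le_rfl (hf.mono_order (by omega)) p).continuousAt
  | succ N ih =>
    intro G _ _
    obtain ⟨C, hC, h⟩ := base G
    obtain ⟨C', hC', h'⟩ := ih (P →L[ℝ] G)
    obtain ⟨c, hc, hd⟩ := exists_derivBound_phaseDeriv (G := G) Λ (N + 1 + k)
    refine ⟨C + c * C', by positivity, fun w hw A f hf => ?_⟩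
    have hA := hf.nonneg
    have hW : ∀ p, 0 ≤ w p * decay k (Λ p) := fun p =>
      mul_nonneg (hw.pos p).le (decay_pos _ _).le
    have h1 := h w hw A f (1 + (N + 1)) (by
      rw [← add_assoc]; exact hf.mono_order (by omega))
    have h2 := h' w hw _ (phaseDeriv Λ f) (hd w (fun p => (hw.pos p).le) _ A f
      (by rw [show N + 1 + k + 1 = N + 1 + 1 + k by omega]; exact hf))
    refine .of_hasFDerivAt (fun p => (h1 p).trans ?_) (fun p =>
      hasFDerivAt_phaseIntegral Λ hw (l := decayOrder V + 1 + N) (by omega)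
        (hf.mono_order (by omega)) p)
      (h2.mono_const hW ?_)
    · refine mul_le_mul_of_nonneg_right ?_ (hW p)
      rw [mul_add]
      exact le_add_of_nonneg_right (by positivity)
    · rw [mul_add, mul_assoc]
      exact le_add_of_nonneg_left (by positivity)

end PhaseIntegral

/-! ### Symbols -/

section Symbols
variable {E E' G : Type} [NormedAddCommGroup E] [NormedSpace ℝ E]
  [NormedAddCommGroup E'] [NormedSpace ℝ E'] [NormedAddCommGroup G] [NormedSpace ℂ G]

lemma derivBound_schwartz (f : 𝓢(E, G)) (l N : ℕ) :
    DerivBound (decay l) N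
      (2 ^ l * (Finset.Iic (l, N)).sup (schwartzSeminormFamily ℂ E G) f) f := by
  refine ⟨by positivity, f.smooth N, fun n hn x => ?_⟩
  have h := one_add_le_sup_seminorm_apply (𝕜 := ℂ) (m := (l, N)) (k := l) (n := n) le_rfl hn f x
  rw [decay, ← div_eq_mul_inv, le_div_iff₀ (by positivity), mul_comm]
  exact h

/-- The function `f` is smooth, and all of its derivatives are dominated by multiples of `W`. -/
def IsSymbol (W : E → ℝ) (f : E → G) : Prop := ∀ N, ∃ A, DerivBound W N A f

lemma isSymbol_schwartz (f : 𝓢(E, G)) (l : ℕ) : IsSymbol (decay l) f :=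
  fun N => ⟨_, derivBound_schwartz f l N⟩

namespace IsSymbol
variable {W W' : E → ℝ}

lemma contDiff {f : E → G} (h : IsSymbol W f) : ContDiff ℝ ∞ f :=
  contDiff_infty.2 fun n => (h n).choose_spec.contDiff

lemma mono {f : E → G} (h : IsSymbol W f) {C : ℝ} (hC : 0 ≤ C) (hW : ∀ x, W x ≤ C * W' x) :
    IsSymbol W' f := fun N => by
  obtain ⟨A, hA⟩ := h N
  exact ⟨_, hA.mono_weight hC hW⟩

lemma comp_clm {f : E → G} (hf : IsSymbol W f) (T : E' →L[ℝ] E) :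
    IsSymbol (fun x => W (T x)) (fun x => f (T x)) := fun N => by
  obtain ⟨A, hA⟩ := hf N
  exact ⟨_, hA.comp_clm T⟩

end IsSymbol

lemma DerivBound.mul {W W' : E → ℝ} {N : ℕ} {A A' : ℝ} {f g : E → ℂ} (hf : DerivBound W N A f)
    (hg : DerivBound W' N A' g) :
    DerivBound (fun x => W x * W' x) N (2 ^ N * A * A') (fun x => f x * g x) := by
  have := hf.bilinear (ContinuousLinearMap.mul ℝ ℂ) hg
  simpa using this

lemma IsSymbol.mul {W W' : E → ℝ} {f g : E → ℂ} (hf : IsSymbol W f)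
    (hg : IsSymbol W' g) : IsSymbol (fun x => W x * W' x) (fun x => f x * g x) := fun N => by
  obtain ⟨A, hA⟩ := hf N
  obtain ⟨A', hA'⟩ := hg N
  exact ⟨_, hA.mul hA'⟩

end Symbols

/-! ### Oscillatory integrals -/

section Window
variable (V : Type) [NormedAddCommGroup V] [NormedSpace ℝ V] [FiniteDimensional ℝ V]
  [MeasureSpace V] [BorelSpace V] [(volume : Measure V).IsAddHaarMeasure]

/-- A smooth compactly supported function of integral one, used to localise in frequency. -/
def window : 𝓢(V, ℂ) :=
  let b : ContDiffBump (0 : V) := ⟨1, 2, one_pos, one_lt_two⟩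
  HasCompactSupport.toSchwartzMap (f := fun v : V => (b.normed volume v : ℂ))
    (b.hasCompactSupport_normed.comp_left Complex.ofReal_zero)
    (Complex.ofRealCLM.contDiff.comp b.contDiff_normed)

lemma integral_window : ∫ v, window V v = 1 := by
  let b : ContDiffBump (0 : V) := ⟨1, 2, one_pos, one_lt_two⟩
  have h : ∀ v, window V v = (b.normed volume v : ℂ) := fun v => rfl
  simp_rw [h]
  rw [integral_complex_ofReal, b.integral_normed]
  simp

end Window

section Oscillatory
variable {P E V V' : Type} [NormedAddCommGroup P] [NormedSpace ℝ P]
  [NormedAddCommGroup E] [NormedSpace ℝ E] [NormedAddCommGroup V'] [NormedSpace ℝ V']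
  [NormedAddCommGroup V] [NormedSpace ℝ V] [FiniteDimensional ℝ V] [MeasureSpace V] [BorelSpace V]
  [(volume : Measure V).IsAddHaarMeasure]

lemma decay_le_of_norm_le {E E' : Type} [NormedAddCommGroup E] [NormedAddCommGroup E'] (k : ℕ)
    {c : ℝ} (hc : 1 ≤ c) {x : E} {y : E'}
    (h : ‖x‖ ≤ c * ‖y‖) : decay k y ≤ c ^ k * decay k x := by
  unfold decay
  rw [inv_le_iff_one_le_mul₀ (by positivity), mul_right_comm, ← mul_pow, ← div_eq_mul_inv,
    one_le_div (by positivity)]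
  gcongr
  nlinarith [norm_nonneg y]

/-- A phase that controls the linear function `T` of the parameter makes the phase integral decay
in `T`, even if the weight grows polynomially in `T`. -/
lemma exists_derivBound_phaseIntegral_decay (Λ : P →L[ℝ] V →L[ℝ] ℝ) (T : P →L[ℝ] V') {c : ℝ}
    (hc : 1 ≤ c) (hT : ∀ p, ‖T p‖ ≤ c * ‖Λ p‖) {w w' : P → ℝ} (hw : IsTempered w) {K : ℕ} {D : ℝ}
    (hD : 0 ≤ D) (hww : ∀ p, w p ≤ D * w' p * (1 + ‖T p‖) ^ K) (l N : ℕ) :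
    ∃ (l' N' : ℕ) (C : ℝ), decayOrder V ≤ l' ∧ 0 ≤ C ∧ ∀ (A : ℝ) (f : P × V → ℂ),
      DerivBound (fun x : P × V => w x.1 * decay l' x.2) N' A f →
      DerivBound (fun p => w' p * decay l (T p)) N (A * C) (phaseIntegral Λ f) := by
  obtain ⟨C, hC, h⟩ := exists_derivBound_phaseIntegral Λ (l + K) N ℂ
  refine ⟨decayOrder V + 1 + N, N + 1 + (l + K), C * (D * c ^ (l + K)), by omega, by positivity,
    fun A f hf => ?_⟩
  have h1 := (h w hw A f hf).mono_weight (C := D * c ^ (l + K))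
    (W' := fun p => w' p * decay l (T p)) (by positivity) fun p => ?_
  · rwa [mul_assoc] at h1
  · have h2 := decay_le_of_norm_le (l + K) hc (hT p)
    have h3 := one_add_norm_pow_mul_decay K l (T p)
    calc w p * decay (l + K) (Λ p)
        ≤ (D * w' p * (1 + ‖T p‖) ^ K) * (c ^ (l + K) * decay (l + K) (T p)) :=
          mul_le_mul (hww p) h2 (decay_pos _ _).le ((hw.pos p).le.trans (hww p))
      _ = D * c ^ (l + K) * (w' p * ((1 + ‖T p‖) ^ K * decay (l + K) (T p))) := by ring
      _ = _ := by rw [h3]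

variable (L : V →L[ℝ] V →L[ℝ] ℝ) (θ : E × V → ℂ)

/-- The symbol `G(X, a, η)`, localised in frequency near `ζ`. -/
def windowed (G : (E × V) × V → ℂ) (x : ((E × V) × V) × V) : ℂ :=
  window V x.2 * G ((x.1.1.1, x.1.2), x.1.1.2 + x.2)

/-- The Fourier integral in `η` of the symbol localised near `ζ`, as a function of
`((X, ζ), a)`. -/
def localFourier (G : (E × V) × V → ℂ) : (E × V) × V → ℂ :=
  phaseIntegral (L.comp (ContinuousLinearMap.snd ℝ (E × V) V)) (windowed G)

/-- The contribution of the frequencies near `ζ` to the oscillatory integral, as a function of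
`(X, ζ)`. -/
def freqPart (G : (E × V) × V → ℂ) : E × V → ℂ :=
  phaseIntegral (L.flip.comp (ContinuousLinearMap.snd ℝ E V))
    (fun x => θ (x.1.1, x.2) * localFourier L G x)

/-- The oscillatory integral `∫∫ exp(i L(a, η)) θ(X, a) G(X, a, η) da dη`. It is made absolutely
convergent by a partition of unity in `η`: the contributions of the translates of the window are
integrated last. -/
def oscIntegral (G : (E × V) × V → ℂ) : E → ℂ :=
  phaseIntegral (0 : E →L[ℝ] V →L[ℝ] ℝ) (freqPart L θ G)

/-- The linear map underlying `windowed`. -/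
def windowMap (E V : Type) [NormedAddCommGroup E] [NormedSpace ℝ E] [NormedAddCommGroup V]
    [NormedSpace ℝ V] : ((E × V) × V) × V →L[ℝ] (E × V) × V :=
  ((((ContinuousLinearMap.fst ℝ E V).comp (ContinuousLinearMap.fst ℝ (E × V) V)).prod
      (ContinuousLinearMap.snd ℝ (E × V) V)).comp (ContinuousLinearMap.fst ℝ ((E × V) × V) V)).prod
    (((ContinuousLinearMap.snd ℝ E V).comp ((ContinuousLinearMap.fst ℝ (E × V) V).comp
      (ContinuousLinearMap.fst ℝ ((E × V) × V) V))) + ContinuousLinearMap.snd ℝ ((E × V) × V) V)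

/-- The exchange `((X, ζ), a) ↦ ((X, a), ζ)`. -/
def exchange (E V : Type) [NormedAddCommGroup E] [NormedSpace ℝ E] [NormedAddCommGroup V]
    [NormedSpace ℝ V] : (E × V) × V →L[ℝ] (E × V) × V :=
  (((ContinuousLinearMap.fst ℝ E V).comp (ContinuousLinearMap.fst ℝ (E × V) V)).prod
      (ContinuousLinearMap.snd ℝ (E × V) V)).prod
    ((ContinuousLinearMap.snd ℝ E V).comp (ContinuousLinearMap.fst ℝ (E × V) V))

variable {L θ} {W : (E × V) × V → ℝ}

/-- The moderate growth of the weight in `η` is absorbed by the decay of the window, so that the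
weight may be evaluated at the centre `ζ` of the window. -/
lemma exists_derivBound_windowed (hW : IsTempered W) (l N : ℕ) :
    ∃ C : ℝ, 0 ≤ C ∧ ∀ (A : ℝ) (G : (E × V) × V → ℂ), DerivBound W N A G →
      DerivBound (fun x : ((E × V) × V) × V => W (exchange E V x.1) * decay l x.2) N (A * C)
        (windowed G) := by
  obtain ⟨K, D, hD, hm⟩ := hW.moderate
  have h1 := (derivBound_schwartz (window V) (l + K) N).comp_clm
    (ContinuousLinearMap.snd ℝ ((E × V) × V) V)
  set c := 2 ^ (l + K) * (Finset.Iic (l + K, N)).sup (schwartzSeminormFamily ℂ V ℂ) (window V) *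
    max 1 ‖ContinuousLinearMap.snd ℝ ((E × V) × V) V‖ ^ N with hc
  refine ⟨2 ^ N * c * max 1 ‖windowMap E V‖ ^ N * D, by positivity, fun A G hG => ?_⟩
  have h2 := (h1.mul (hG.comp_clm (windowMap E V))).mono_weight (C := D)
    (W' := fun x : ((E × V) × V) × V => W (exchange E V x.1) * decay l x.2) hD.le fun x => ?_
  · have h3 : windowed G = fun x => window V (ContinuousLinearMap.snd ℝ ((E × V) × V) V x) *
        G (windowMap E V x) := rfl
    rw [h3]
    convert h2 using 1
    ring
  · have h4 := hm (exchange E V x.1) (0, x.2)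
    have h5 : exchange E V x.1 + (0, x.2) = windowMap E V x := by
      simp [exchange, windowMap]
    have h6 : ‖((0 : E × V), x.2)‖ = ‖x.2‖ := by simp
    rw [h5, h6] at h4
    have h7 := one_add_norm_pow_mul_decay K l x.2
    calc decay (l + K) x.2 * W (windowMap E V x)
        ≤ decay (l + K) x.2 * (D * W (exchange E V x.1) * (1 + ‖x.2‖) ^ K) :=
          mul_le_mul_of_nonneg_left h4 (decay_pos _ _).le
      _ = D * (W (exchange E V x.1) * ((1 + ‖x.2‖) ^ K * decay (l + K) x.2)) := by ring
      _ = _ := by rw [h7]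

/-- The local Fourier transform decays in `a`; this pays for replacing `a` by zero in the weight. -/
lemma exists_derivBound_localFourier (hL : ∃ c, 1 ≤ c ∧ ∀ a, ‖a‖ ≤ c * ‖L a‖) (hW : IsTempered W)
    (l N : ℕ) :
    ∃ (N' : ℕ) (C : ℝ), 0 ≤ C ∧ ∀ (A : ℝ) (G : (E × V) × V → ℂ), DerivBound W N' A G →
      DerivBound (fun x : (E × V) × V => W ((x.1.1, 0), x.1.2) * decay l x.2) N (A * C)
        (localFourier L G) := by
  obtain ⟨c, hc, hLc⟩ := hL
  obtain ⟨K, D, hD, hm⟩ := hW.moderate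
  obtain ⟨l', N', C, -, hC, h⟩ := exists_derivBound_phaseIntegral_decay
    (L.comp (ContinuousLinearMap.snd ℝ (E × V) V)) (ContinuousLinearMap.snd ℝ (E × V) V) hc
    (fun p => hLc p.2) (w := fun p => W (exchange E V p))
    (w' := fun x : (E × V) × V => W ((x.1.1, 0), x.1.2)) (K := K) (hW.comp_clm _) hD.le
    (fun p => by
      have h := hm ((p.1.1, 0), p.1.2) ((0, p.2), 0)
      simpa [exchange] using h) l N
  obtain ⟨C', hC', h'⟩ := exists_derivBound_windowed hW l' N'
  refine ⟨N', C' * C, by positivity, fun A G hG => ?_⟩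
  have := h _ _ (h' A G hG)
  rwa [mul_assoc] at this

/-- The integral in `a` against the phase decays in `ζ`; this pays for the growth of the phase
factor `θ` in `a` and for replacing `ζ` by zero in the weight. -/
lemma exists_derivBound_freqPart (hL : ∃ c, 1 ≤ c ∧ ∀ a, ‖a‖ ≤ c * ‖L a‖)
    (hL' : ∃ c, 1 ≤ c ∧ ∀ a, ‖a‖ ≤ c * ‖L.flip a‖)
    (hθ : ∀ N, ∃ (k : ℕ) (C : ℝ), DerivBound (fun x : E × V => (1 + ‖x.2‖) ^ k) N C θ)
    (hW : IsTempered W) (l N : ℕ) :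
    ∃ (N' : ℕ) (C : ℝ), 0 ≤ C ∧ ∀ (A : ℝ) (G : (E × V) × V → ℂ), DerivBound W N' A G →
      DerivBound (fun x : E × V => W ((x.1, 0), 0) * decay l x.2) N (A * C) (freqPart L θ G) := by
  obtain ⟨c, hc, hLc⟩ := hL'
  obtain ⟨K, D, hD, hm⟩ := hW.moderate
  let T : E × V →L[ℝ] (E × V) × V := ((ContinuousLinearMap.fst ℝ E V).prod 0).prod
    (ContinuousLinearMap.snd ℝ E V)
  obtain ⟨l', N', C, -, hC, h⟩ := exists_derivBound_phaseIntegral_decay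
    (L.flip.comp (ContinuousLinearMap.snd ℝ E V)) (ContinuousLinearMap.snd ℝ E V) hc
    (fun p => hLc p.2) (w := fun p => W (T p))
    (w' := fun x : E × V => W ((x.1, 0), 0)) (K := K) (hW.comp_clm T) hD.le
    (fun p => by
      have h := hm ((p.1, 0), 0) (0, p.2)
      simpa [T] using h) l N
  obtain ⟨k, B, hB⟩ := hθ N'
  obtain ⟨N'', C', hC', h'⟩ := exists_derivBound_localFourier hL hW (l' + k) N'
  let S : (E × V) × V →L[ℝ] E × V := ((ContinuousLinearMap.fst ℝ E V).comp
    (ContinuousLinearMap.fst ℝ (E × V) V)).prod (ContinuousLinearMap.snd ℝ (E × V) V)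
  have hBS := hB.comp_clm S
  have hB0 := hB.nonneg
  refine ⟨N'', 2 ^ N' * (B * max 1 ‖S‖ ^ N') * C' * C, by positivity, fun A G hG => ?_⟩
  have h1 := (hBS.mul (h' A G hG)).mono_weight_one
    (W' := fun x : (E × V) × V => W (T x.1) * decay l' x.2) (fun x => le_of_eq (by
      have h7 := one_add_norm_pow_mul_decay k l' x.2
      rw [← h7]
      simp [T, S]; ring))
  have h2 := h _ _ h1
  have h3 : freqPart L θ G = phaseIntegral (L.flip.comp (ContinuousLinearMap.snd ℝ E V))
    (fun x => θ (S x) * localFourier L G x) := rfl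
  have h4 : A * (2 ^ N' * (B * max 1 ‖S‖ ^ N') * C' * C) =
    2 ^ N' * (B * max 1 ‖S‖ ^ N') * (A * C') * C := by ring
  rw [h3, h4]
  exact h2

/-- The oscillatory integral of a symbol dominated by the weight `W` is a symbol dominated by the
restriction of `W` to the stationary point `a = η = 0`. -/
theorem exists_derivBound_oscIntegral (hL : ∃ c, 1 ≤ c ∧ ∀ a, ‖a‖ ≤ c * ‖L a‖)
    (hL' : ∃ c, 1 ≤ c ∧ ∀ a, ‖a‖ ≤ c * ‖L.flip a‖)
    (hθ : ∀ N, ∃ (k : ℕ) (C : ℝ), DerivBound (fun x : E × V => (1 + ‖x.2‖) ^ k) N C θ)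
    (hW : IsTempered W) (N : ℕ) :
    ∃ (N' : ℕ) (C : ℝ), 0 ≤ C ∧ ∀ (A : ℝ) (G : (E × V) × V → ℂ), DerivBound W N' A G →
      DerivBound (fun x : E => W ((x, 0), 0)) N (A * C) (oscIntegral L θ G) := by
  obtain ⟨C, hC, h⟩ := exists_derivBound_phaseIntegral (0 : E →L[ℝ] V →L[ℝ] ℝ) 0 N ℂ
  obtain ⟨N', C', hC', h'⟩ := exists_derivBound_freqPart hL hL' hθ hW (decayOrder V + 1 + N) (N + 1)
  let T : E →L[ℝ] (E × V) × V := ((ContinuousLinearMap.id ℝ E).prod 0).prod 0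
  refine ⟨N', C' * C, by positivity, fun A G hG => ?_⟩
  have h1 := h (fun x => W ((x, 0), 0)) (hW.comp_clm T) _ _ (h' A G hG)
  rw [mul_assoc] at h1
  exact h1.mono_weight_one fun x => by rw [decay_zero, mul_one]

lemma phaseIntegral_add (Λ : P →L[ℝ] V →L[ℝ] ℝ) {f g : P × V → ℂ} {w w' : P → ℝ}
    (hf : IsSymbol (fun x : P × V => w x.1 * decay (decayOrder V) x.2) f)
    (hg : IsSymbol (fun x : P × V => w' x.1 * decay (decayOrder V) x.2) g) :
    phaseIntegral Λ (fun x => f x + g x) = fun p => phaseIntegral Λ f p + phaseIntegral Λ g p := by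
  ext p
  obtain ⟨A, hA⟩ := hf 0
  obtain ⟨A', hA'⟩ := hg 0
  unfold phaseIntegral
  rw [← integral_add (integrable_phase_smul Λ le_rfl hA p) (integrable_phase_smul Λ le_rfl hA' p)]
  simp only [smul_add]

lemma phaseIntegral_const_smul (Λ : P →L[ℝ] V →L[ℝ] ℝ) (f : P × V → ℂ) (c : ℂ) :
    phaseIntegral Λ (fun x => c * f x) = fun p => c * phaseIntegral Λ f p := by
  ext p
  unfold phaseIntegral
  rw [← integral_const_mul]
  simp only [smul_eq_mul, mul_left_comm]

lemma oscIntegral_const_mul (G : (E × V) × V → ℂ) (c : ℂ) :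
    oscIntegral L θ (fun x => c * G x) = fun X => c * oscIntegral L θ G X := by
  have h1 : windowed (fun x => c * G x) = fun x => c * windowed G x := by
    ext x; simp only [windowed]; ring
  unfold oscIntegral freqPart localFourier
  rw [h1, phaseIntegral_const_smul]
  simp_rw [mul_left_comm _ c]
  rw [phaseIntegral_const_smul, phaseIntegral_const_smul]

lemma isSymbol_windowed (hW : IsTempered W) (l : ℕ) {G : (E × V) × V → ℂ} (hG : IsSymbol W G) :
    IsSymbol (fun x : ((E × V) × V) × V => W (exchange E V x.1) * decay l x.2) (windowed G) :=
  fun N => by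
    obtain ⟨C, -, h⟩ := exists_derivBound_windowed hW l N
    obtain ⟨A, hA⟩ := hG N
    exact ⟨_, h A G hA⟩

lemma isSymbol_localFourier (hL : ∃ c, 1 ≤ c ∧ ∀ a, ‖a‖ ≤ c * ‖L a‖) (hW : IsTempered W)
    (l : ℕ) {G : (E × V) × V → ℂ} (hG : IsSymbol W G) :
    IsSymbol (fun x : (E × V) × V => W ((x.1.1, 0), x.1.2) * decay l x.2) (localFourier L G) :=
  fun N => by
    obtain ⟨N', C, -, h⟩ := exists_derivBound_localFourier hL hW l N
    obtain ⟨A, hA⟩ := hG N'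
    exact ⟨_, h A G hA⟩

lemma isSymbol_mul_localFourier (hL : ∃ c, 1 ≤ c ∧ ∀ a, ‖a‖ ≤ c * ‖L a‖)
    (hθ : ∀ N, ∃ (k : ℕ) (C : ℝ), DerivBound (fun x : E × V => (1 + ‖x.2‖) ^ k) N C θ)
    (hW : IsTempered W)
    (l : ℕ) {G : (E × V) × V → ℂ} (hG : IsSymbol W G) :
    IsSymbol (fun x : (E × V) × V => W ((x.1.1, 0), x.1.2) * decay l x.2)
      (fun x => θ (x.1.1, x.2) * localFourier L G x) :=
  fun N => by
    obtain ⟨k, B, hB⟩ := hθ N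
    obtain ⟨A, hA⟩ := isSymbol_localFourier hL hW (l + k) hG N
    let S : (E × V) × V →L[ℝ] E × V := ((ContinuousLinearMap.fst ℝ E V).comp
      (ContinuousLinearMap.fst ℝ (E × V) V)).prod (ContinuousLinearMap.snd ℝ (E × V) V)
    have h1 := ((hB.comp_clm S).mul hA).mono_weight_one
      (W' := fun x : (E × V) × V => W ((x.1.1, 0), x.1.2) * decay l x.2) (fun x => le_of_eq (by
        have h7 := one_add_norm_pow_mul_decay k l x.2
        rw [← h7]
        simp [S]; ring))
    exact ⟨_, h1⟩

lemma isSymbol_freqPart (hL : ∃ c, 1 ≤ c ∧ ∀ a, ‖a‖ ≤ c * ‖L a‖)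
    (hL' : ∃ c, 1 ≤ c ∧ ∀ a, ‖a‖ ≤ c * ‖L.flip a‖)
    (hθ : ∀ N, ∃ (k : ℕ) (C : ℝ), DerivBound (fun x : E × V => (1 + ‖x.2‖) ^ k) N C θ)
    (hW : IsTempered W) (l : ℕ) {G : (E × V) × V → ℂ} (hG : IsSymbol W G) :
    IsSymbol (fun x : E × V => W ((x.1, 0), 0) * decay l x.2) (freqPart L θ G) :=
  fun N => by
    obtain ⟨N', C, -, h⟩ := exists_derivBound_freqPart hL hL' hθ hW l N
    obtain ⟨A, hA⟩ := hG N'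
    exact ⟨_, h A G hA⟩

lemma oscIntegral_add (hL : ∃ c, 1 ≤ c ∧ ∀ a, ‖a‖ ≤ c * ‖L a‖)
    (hL' : ∃ c, 1 ≤ c ∧ ∀ a, ‖a‖ ≤ c * ‖L.flip a‖)
    (hθ : ∀ N, ∃ (k : ℕ) (C : ℝ), DerivBound (fun x : E × V => (1 + ‖x.2‖) ^ k) N C θ)
    {W' : (E × V) × V → ℝ} (hW : IsTempered W) (hW' : IsTempered W') {G G' : (E × V) × V → ℂ}
    (hG : IsSymbol W G) (hG' : IsSymbol W' G') :
    oscIntegral L θ (fun x => G x + G' x) =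
      fun X => oscIntegral L θ G X + oscIntegral L θ G' X := by
  have h1 : windowed (fun x => G x + G' x) = fun x => windowed G x + windowed G' x := by
    ext x; simp only [windowed]; ring
  have h2 : localFourier L (fun x => G x + G' x) =
      fun x => localFourier L G x + localFourier L G' x := by
    unfold localFourier
    rw [h1]
    exact phaseIntegral_add _ (w := fun p => W (exchange E V p))
      (w' := fun p => W' (exchange E V p)) (isSymbol_windowed hW _ hG) (isSymbol_windowed hW' _ hG')
  have h3 : freqPart L θ (fun x => G x + G' x) =
      fun x => freqPart L θ G x + freqPart L θ G' x := by
    unfold freqPart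
    simp_rw [h2, mul_add]
    exact phaseIntegral_add _ (w := fun p : E × V => W ((p.1, 0), p.2))
      (w' := fun p : E × V => W' ((p.1, 0), p.2)) (isSymbol_mul_localFourier hL hθ hW _ hG)
      (isSymbol_mul_localFourier hL hθ hW' _ hG')
  unfold oscIntegral
  rw [h3]
  exact phaseIntegral_add _ (w := fun p : E => W ((p, 0), 0))
      (w' := fun p : E => W' ((p, 0), 0)) (isSymbol_freqPart hL hL' hθ hW _ hG)
      (isSymbol_freqPart hL hL' hθ hW' _ hG')

/-- The translates of the window form a continuous partition of unity. -/
lemma integral_window_mul_translate {g : V → ℂ} (hg : Integrable g) :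
    ∫ ζ, ∫ η, window V η * g (ζ + η) = ∫ η, g η := by
  have hi : Integrable (fun z : V × V => window V z.1 * g z.2) (volume.prod volume) :=
    (window V).integrable.mul_prod hg
  have hi' : Integrable (fun z : V × V => window V z.2 * g (z.1 + z.2)) (volume.prod volume) := by
    have h := (measurePreserving_prod_add_swap (volume : Measure V) (volume : Measure V))
    have := h.integrable_comp_of_integrable hi
    refine this.congr (.of_forall fun z => ?_)
    simp [add_comm]
  have h1 := integral_integral_swap (f := fun ζ η => window V η * g (ζ + η)) hi'
  rw [h1]
  simp_rw [integral_const_mul, integral_add_right_eq_self g]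
  rw [integral_mul_const, integral_window, one_mul]

/-- If the symbol is integrable in the frequencies, the oscillatory integral is an iterated
integral. -/
theorem oscIntegral_eq_integral (hL : ∃ c, 1 ≤ c ∧ ∀ a, ‖a‖ ≤ c * ‖L a‖)
    (hθ : ∀ N, ∃ (k : ℕ) (C : ℝ), DerivBound (fun x : E × V => (1 + ‖x.2‖) ^ k) N C θ)
    (hW : IsTempered W) {G : (E × V) × V → ℂ} (hG : IsSymbol W G) (X : E) {C : ℝ}
    (hC : ∀ a η, W ((X, a), η) ≤ C * decay (decayOrder V) η) :
    oscIntegral L θ G X = ∫ a, θ (X, a) * ∫ η, phase (L a η) * G ((X, a), η) := by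
  set D := decayOrder V
  obtain ⟨A, hA⟩ := isSymbol_mul_localFourier hL hθ hW D hG 0
  have hcont : Continuous (fun z : V × V => phase (L z.2 z.1) *
      (θ (X, z.2) * localFourier L G ((X, z.1), z.2))) := by
    have h1 := hA.contDiff.continuous
    have h2 : Continuous fun z : V × V => ((X, z.1), z.2) := by fun_prop
    exact (continuous_phase.comp (by fun_prop)).mul (h1.comp h2)
  have hint : Integrable (fun z : V × V => phase (L z.2 z.1) *
      (θ (X, z.2) * localFourier L G ((X, z.1), z.2))) (volume.prod volume) := by
    have hd : Integrable (fun z : V × V => decay D z.1 * decay D z.2) (volume.prod volume) :=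
      (integrable_decay le_rfl).mul_prod (integrable_decay le_rfl)
    refine (hd.const_mul (A * C)).mono' hcont.aestronglyMeasurable (.of_forall fun z => ?_)
    rw [norm_mul, norm_phase, one_mul]
    refine (hA.norm_le ((X, z.1), z.2)).trans ?_
    have h1 := mul_le_mul_of_nonneg_right (hC 0 z.1) (decay_pos D z.2).le
    calc _ ≤ A * (C * decay D z.1 * decay D z.2) := mul_le_mul_of_nonneg_left h1 hA.nonneg
      _ = _ := by ring
  have h1 : oscIntegral L θ G X = ∫ ζ, ∫ a, phase (L a ζ) *
      (θ (X, a) * localFourier L G ((X, ζ), a)) := by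
    simp [oscIntegral, phaseIntegral, freqPart, phase]
  -- Fubini moves the integral over the centres of the windows next to the one in `η`.
  rw [h1, integral_integral_swap (f := fun ζ a => phase (L a ζ) *
      (θ (X, a) * localFourier L G ((X, ζ), a))) hint]
  refine integral_congr_ae (.of_forall fun a => ?_)
  simp_rw [mul_left_comm _ (θ (X, a))]
  rw [integral_const_mul]
  congr 1
  obtain ⟨A', hA'⟩ := hG 0
  have hg : Integrable (fun η => phase (L a η) * G ((X, a), η)) := by
    have hc := hA'.contDiff.continuous
    refine integrable_of_decay (l := D) le_rfl (C := A' * C) ?_ fun η => ?_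
    · exact (continuous_phase.comp (by fun_prop)).mul (by fun_prop)
    · rw [norm_mul, norm_phase, one_mul, mul_assoc]
      exact (hA'.norm_le _).trans (mul_le_mul_of_nonneg_left (hC a η) hA'.nonneg)
  rw [← integral_window_mul_translate hg]
  refine integral_congr_ae (.of_forall fun ζ => ?_)
  simp only [localFourier, phaseIntegral, windowed]
  rw [← integral_const_mul]
  refine integral_congr_ae (.of_forall fun η => ?_)
  simp [phase_add]
  ring

end Oscillatory

/-! ### The vector potential and its circulation -/

section ParamIntegral
variable {V G : Type} [NormedAddCommGroup V] [NormedSpace ℝ V] [NormedAddCommGroup G]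
  [NormedSpace ℝ G]

lemma hasTemperateGrowth_derivSnd {f : ℝ × V → G} (hf : f.HasTemperateGrowth) :
    (fun x => (fderiv ℝ f x).comp (ContinuousLinearMap.inr ℝ ℝ V)).HasTemperateGrowth := by
  have h1 : (fderiv ℝ f).HasTemperateGrowth := by
    refine ⟨hf.1.fderiv_right (by simp), fun n => ?_⟩
    obtain ⟨k, C, h⟩ := hf.2 (n + 1)
    exact ⟨k, C, fun x => by rw [norm_iteratedFDeriv_fderiv]; exact h x⟩
  exact (((ContinuousLinearMap.compL ℝ V (ℝ × V) G).flip
    (ContinuousLinearMap.inr ℝ ℝ V)).hasTemperateGrowth).comp h1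

lemma fderiv_comp_inr {f : ℝ × V → G} (hf : f.HasTemperateGrowth) (s : ℝ) (v : V) :
    (fderiv ℝ f (s, v)).comp (ContinuousLinearMap.inr ℝ ℝ V) = fderiv ℝ (fun v => f (s, v)) v :=
  (((hf.1.differentiable (by simp)) (s, v)).hasFDerivAt.comp v
    (hasFDerivAt_prodMk_right s v)).fderiv.symm

lemma norm_iteratedFDeriv_paramIntegral_le (n : ℕ) :
    ∀ (G : Type) [NormedAddCommGroup G] [NormedSpace ℝ G] (f : ℝ × V → G)
    (_ : f.HasTemperateGrowth) (v : V) (C : ℝ)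
    (_ : ∀ s ∈ Set.Icc (0 : ℝ) 1, ‖iteratedFDeriv ℝ n (fun v => f (s, v)) v‖ ≤ C),
    ‖iteratedFDeriv ℝ n (fun v => ∫ s in (0 : ℝ)..1, f (s, v)) v‖ ≤ C := by
  induction n with
  | zero =>
    intro G _ _ f hf v C h
    rw [norm_iteratedFDeriv_zero]
    have := intervalIntegral.norm_integral_le_of_norm_le_const (a := 0) (b := 1)
      (C := C) (f := fun s => f (s, v)) (fun s hs => ?_)
    · simpa using this
    · rw [Set.uIoc_of_le zero_le_one] at hs
      simpa using h s ⟨hs.1.le, hs.2⟩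
  | succ n ih =>
    intro G _ _ f hf v C h
    have hd : fderiv ℝ (fun v => ∫ s in (0 : ℝ)..1, f (s, v)) =
        fun v => ∫ s in (0 : ℝ)..1, (fderiv ℝ f (s, v)).comp (ContinuousLinearMap.inr ℝ ℝ V) :=
      funext fun v => (hasFDerivAt_paramIntegral hf v).fderiv
    rw [← norm_iteratedFDeriv_fderiv, hd]
    refine ih _ _ (hasTemperateGrowth_derivSnd hf) v C fun s hs => ?_
    have h1 : (fun v => (fderiv ℝ f (s, v)).comp (ContinuousLinearMap.inr ℝ ℝ V)) =
        fderiv ℝ fun v => f (s, v) := funext fun v => fderiv_comp_inr hf s v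
    have h2 := h s hs
    rw [← norm_iteratedFDeriv_fderiv] at h2
    exact h1 ▸ h2

/-- An average of functions inherits a common bound on their derivatives. -/
lemma DerivBound.paramIntegral {f : ℝ × V → G} (hf : f.HasTemperateGrowth) {W : V → ℝ} {N : ℕ}
    {A : ℝ} (h : ∀ s ∈ Set.Icc (0 : ℝ) 1, DerivBound W N A (fun v => f (s, v))) :
    DerivBound W N A (fun v => ∫ s in (0 : ℝ)..1, f (s, v)) :=
  ⟨(h 0 (by simp)).nonneg, (hasTemperateGrowth_paramIntegral hf).1.of_le (by exact_mod_cast le_top),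
    fun n hn v => norm_iteratedFDeriv_paramIntegral_le n G f hf v _ fun s hs =>
      (h s hs).bound n hn v⟩

end ParamIntegral

namespace MagneticField
variable {d : ℕ} (B : MagneticField d)

/-- The elementary bilinear form `(u, v) ↦ u_j v_k`. -/
def coordForm (j k : Fin d) : Pos d →L[ℝ] Pos d →L[ℝ] ℝ :=
  (EuclideanSpace.proj j : Pos d →L[ℝ] ℝ).smulRight (EuclideanSpace.proj k : Pos d →L[ℝ] ℝ)

lemma coordForm_apply (j k : Fin d) (u v : Pos d) : coordForm j k u v = u j * v k := rfl

/-- The magnetic field as a form-valued function, `B(x)(u, v) = ∑ B_{jk}(x) u_j v_k`. -/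
def form (x : Pos d) : Pos d →L[ℝ] Pos d →L[ℝ] ℝ := ∑ j, ∑ k, B.comp j k x • coordForm j k

lemma form_apply (x u v : Pos d) : B.form x u v = ∑ j, ∑ k, B.comp j k x * (u j * v k) := by
  simp [form, coordForm_apply]

lemma form_swap (x u v : Pos d) : B.form x u v = -B.form x v u := by
  rw [form_apply, form_apply, Finset.sum_comm, ← Finset.sum_neg_distrib]
  refine Finset.sum_congr rfl fun j _ => ?_
  rw [← Finset.sum_neg_distrib]
  refine Finset.sum_congr rfl fun k _ => ?_
  rw [B.antisymm]
  ring

lemma exists_derivBound_form (N : ℕ) : ∃ C, DerivBound (fun _ => 1) N C B.form := by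
  have h1 : ∀ j k, ∃ C, DerivBound (fun _ => 1) N C (fun x => B.comp j k x • coordForm j k) :=
    fun j k => by
      obtain ⟨A, hA⟩ := DerivBound.exists_of_forall (W := fun _ => 1) (fun _ => zero_le_one)
        (B.smooth j k) (by simpa using B.bounded j k) N
      exact ⟨_, hA.clm_comp ((ContinuousLinearMap.lsmul ℝ ℝ).flip (coordForm j k))⟩
  have hs : ∀ (G : Type) [NormedAddCommGroup G] [NormedSpace ℝ G] (f : Fin d → Pos d → G),
      (∀ j, ∃ C, DerivBound (fun _ => 1) N C (f j)) →
      ∃ C, DerivBound (fun _ => 1) N C (fun x => ∑ j, f j x) := by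
    intro G _ _ f hf
    have : ∀ s : Finset (Fin d), ∃ C, DerivBound (fun _ => 1) N C (fun x => ∑ j ∈ s, f j x) := by
      intro s
      induction s using Finset.cons_induction with
      | empty =>
        refine ⟨‖(0 : G)‖, ?_⟩
        simp only [Finset.sum_empty]
        exact DerivBound.const 0
      | cons a s ha ih =>
        obtain ⟨C, hC⟩ := ih
        obtain ⟨C', hC'⟩ := hf a
        simp only [Finset.sum_cons]
        exact ⟨_, hC'.add hC⟩
    exact this _
  exact hs _ _ fun j => hs _ _ fun k => h1 j k

lemma contDiff_form : ContDiff ℝ ∞ B.form :=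
  contDiff_infty.2 fun n => (B.exists_derivBound_form n).choose_spec.contDiff

lemma form_temperate : B.form.HasTemperateGrowth :=
  ⟨B.contDiff_form, fun n => by
    obtain ⟨C, hC⟩ := B.exists_derivBound_form n
    exact ⟨0, C, fun x => by simpa using hC.bound n le_rfl x⟩⟩

lemma hasFDerivAt_form (x : Pos d) : HasFDerivAt B.form (fderiv ℝ B.form x) x :=
  ((B.contDiff_form.differentiable (by simp)) x).hasFDerivAt

lemma fderiv_form_apply (x h u v : Pos d) :
    fderiv ℝ B.form x h u v =
      ∑ i, ∑ j, ∑ k, h i * u j * v k * fderiv ℝ (B.comp j k) x (EuclideanSpace.single i 1) := by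
  have h1 : HasFDerivAt B.form (∑ j, ∑ k, (fderiv ℝ (B.comp j k) x).smulRight (coordForm j k)) x :=
    HasFDerivAt.fun_sum fun j _ => HasFDerivAt.fun_sum fun k _ =>
      (((B.smooth j k).differentiable (by simp)) x).hasFDerivAt.smul_const (coordForm j k)
  have h2 : ∀ j k, fderiv ℝ (B.comp j k) x h =
      ∑ i, h i * fderiv ℝ (B.comp j k) x (EuclideanSpace.single i 1) := fun j k => by
    have h3 : h = ∑ i, h i • EuclideanSpace.single i (1 : ℝ) := by
      ext i
      simp [Pi.single_apply]
    conv_lhs => rw [h3]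
    simp only [map_sum, map_smul, smul_eq_mul]
  rw [h1.fderiv]
  simp only [sum_apply, ContinuousLinearMap.smulRight_apply, smul_apply, coordForm_apply,
    smul_eq_mul, h2, Finset.sum_mul]
  rw [Finset.sum_comm_cycle]
  refine Finset.sum_congr rfl fun i _ => Finset.sum_congr rfl fun j _ =>
    Finset.sum_congr rfl fun k _ => by ring

/-- The cyclic form of `dB = 0`. -/
lemma fderiv_form_cyclic (x h u v : Pos d) :
    fderiv ℝ B.form x h u v + fderiv ℝ B.form x u v h + fderiv ℝ B.form x v h u = 0 := by
  rw [fderiv_form_apply, fderiv_form_apply, fderiv_form_apply]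
  have h2 : ∑ i, ∑ j, ∑ k, u i * v j * h k *
      fderiv ℝ (B.comp j k) x (EuclideanSpace.single i 1) =
      ∑ i, ∑ j, ∑ k, h i * u j * v k *
        fderiv ℝ (B.comp k i) x (EuclideanSpace.single j 1) := by
    rw [Finset.sum_comm_cycle]
    refine Finset.sum_congr rfl fun i _ => Finset.sum_congr rfl fun j _ =>
      Finset.sum_congr rfl fun k _ => by ring
  have h3 : ∑ i, ∑ j, ∑ k, v i * h j * u k *
      fderiv ℝ (B.comp j k) x (EuclideanSpace.single i 1) =
      ∑ i, ∑ j, ∑ k, h i * u j * v k *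
        fderiv ℝ (B.comp i j) x (EuclideanSpace.single k 1) := by
    rw [Finset.sum_comm]
    refine Finset.sum_congr rfl fun i _ => ?_
    rw [Finset.sum_comm]
    refine Finset.sum_congr rfl fun j _ => Finset.sum_congr rfl fun k _ => by ring
  rw [h2, h3, ← Finset.sum_add_distrib, ← Finset.sum_add_distrib]
  refine Finset.sum_eq_zero fun i _ => ?_
  rw [← Finset.sum_add_distrib, ← Finset.sum_add_distrib]
  refine Finset.sum_eq_zero fun j _ => ?_
  rw [← Finset.sum_add_distrib, ← Finset.sum_add_distrib]
  refine Finset.sum_eq_zero fun k _ => ?_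
  rw [← mul_add, ← mul_add, B.closed i j k x, mul_zero]

lemma fderiv_form_swap (x h u v : Pos d) :
    fderiv ℝ B.form x h u v = -fderiv ℝ B.form x h v u := by
  have h1 : ∀ j k, fderiv ℝ (B.comp j k) x = -fderiv ℝ (B.comp k j) x := fun j k => by
    have h2 : B.comp j k = fun x => -B.comp k j x := funext fun x => B.antisymm j k x
    rw [h2, fderiv_fun_neg]
  rw [fderiv_form_apply, fderiv_form_apply, ← Finset.sum_neg_distrib]
  refine Finset.sum_congr rfl fun i _ => ?_
  rw [Finset.sum_comm, ← Finset.sum_neg_distrib]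
  refine Finset.sum_congr rfl fun j _ => ?_
  rw [← Finset.sum_neg_distrib]
  refine Finset.sum_congr rfl fun k _ => ?_
  rw [h1 k j, neg_apply]
  ring

/-- The integrand of the potential in the transversal gauge centred at `y`. -/
def gaugeIntegrand (q : ℝ × (Pos d × Pos d)) : Pos d →L[ℝ] ℝ :=
  q.1 • B.form (q.2.1 + q.1 • q.2.2) q.2.2

/-- The potential in the transversal gauge centred at `y`, evaluated at `y + u`. -/
def gauge (p : Pos d × Pos d) : Pos d →L[ℝ] ℝ :=
  ∫ s in (0 : ℝ)..1, B.gaugeIntegrand (s, p)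

lemma gaugeIntegrand_temperate : B.gaugeIntegrand.HasTemperateGrowth := by
  have h1 : (fun q : ℝ × (Pos d × Pos d) => q.1).HasTemperateGrowth :=
    (ContinuousLinearMap.fst ℝ ℝ (Pos d × Pos d)).hasTemperateGrowth
  have h2 : (fun q : ℝ × (Pos d × Pos d) => q.2.1).HasTemperateGrowth :=
    ((ContinuousLinearMap.fst ℝ (Pos d) (Pos d)).comp
      (ContinuousLinearMap.snd ℝ ℝ (Pos d × Pos d))).hasTemperateGrowth
  have h3 : (fun q : ℝ × (Pos d × Pos d) => q.2.2).HasTemperateGrowth :=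
    ((ContinuousLinearMap.snd ℝ (Pos d) (Pos d)).comp
      (ContinuousLinearMap.snd ℝ ℝ (Pos d × Pos d))).hasTemperateGrowth
  have h4 := B.form_temperate.comp (h2.add (h1.smul h3))
  have h5 := (ContinuousLinearMap.id ℝ (Pos d →L[ℝ] Pos d →L[ℝ] ℝ)).bilinear_hasTemperateGrowth
    h4 h3
  exact h1.smul h5

lemma gauge_temperate : B.gauge.HasTemperateGrowth :=
  hasTemperateGrowth_paramIntegral B.gaugeIntegrand_temperate

/-- The derivatives of the gauge potential grow only with the distance from its centre,
uniformly in the centre. -/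
lemma exists_derivBound_gauge (N : ℕ) :
    ∃ C, DerivBound (fun p : Pos d × Pos d => 1 + ‖p.2‖) N C B.gauge := by
  obtain ⟨C, hC⟩ := B.exists_derivBound_form N
  have h2 : DerivBound (fun p : Pos d × Pos d => 1 + ‖p.2‖) N _
      (fun p : Pos d × Pos d => p.2) :=
    (DerivBound.clm (N := N) (ContinuousLinearMap.id ℝ (Pos d))).comp_clm
      (ContinuousLinearMap.snd ℝ (Pos d) (Pos d))
  obtain ⟨K, hK, hb⟩ := DerivBound.exists_bilinear (E := Pos d × Pos d)
    (ContinuousLinearMap.id ℝ (Pos d →L[ℝ] Pos d →L[ℝ] ℝ))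
  set c := ‖ContinuousLinearMap.id ℝ (Pos d)‖ *
    max 1 ‖ContinuousLinearMap.snd ℝ (Pos d) (Pos d)‖ ^ N
  refine ⟨K * 2 ^ N * (C * 2 ^ N) * c, .paramIntegral B.gaugeIntegrand_temperate fun s hs => ?_⟩
  let T : Pos d × Pos d →L[ℝ] Pos d := ContinuousLinearMap.fst ℝ (Pos d) (Pos d) +
    s • ContinuousLinearMap.snd ℝ (Pos d) (Pos d)
  have hs1 : ‖s‖ ≤ 1 := by rw [Real.norm_of_nonneg hs.1]; exact hs.2
  have hT : max 1 ‖T‖ ≤ 2 := by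
    refine max_le one_le_two ((norm_add_le _ _).trans ?_)
    rw [norm_smul]
    have h3 := ContinuousLinearMap.norm_fst_le ℝ (Pos d) (Pos d)
    have h4 := mul_le_one₀ hs1 (norm_nonneg _) (ContinuousLinearMap.norm_snd_le ℝ (Pos d) (Pos d))
    linarith
  have h1 := (hC.comp_clm T).mono_const (A' := C * 2 ^ N) (fun _ => zero_le_one)
    (mul_le_mul_of_nonneg_left (pow_le_pow_left₀ (by positivity) hT N) hC.nonneg)
  have h3 := (hb _ _ _ _ _ _ _ h1 h2).clm_comp (s • ContinuousLinearMap.id ℝ (Pos d →L[ℝ] ℝ))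
  have h4 := h3.mono_weight_one (W' := fun p : Pos d × Pos d => 1 + ‖p.2‖)
    (fun p => by simp)
  refine h4.mono_const (fun p => by positivity) ?_
  refine mul_le_of_le_one_left (hb _ _ _ _ _ _ _ h1 h2).nonneg ?_
  rw [norm_smul]
  exact mul_le_one₀ hs1 (norm_nonneg _) ContinuousLinearMap.norm_id_le

/-- The potential in the transversal gauge as a covector. -/
def potentialForm (x : Pos d) : Pos d →L[ℝ] ℝ := B.gauge (0, x)

lemma potentialForm_temperate : B.potentialForm.HasTemperateGrowth :=
  B.gauge_temperate.comp (ContinuousLinearMap.inr ℝ (Pos d) (Pos d)).hasTemperateGrowth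

lemma gauge_apply (p : Pos d × Pos d) (v : Pos d) :
    B.gauge p v = ∫ s in (0 : ℝ)..1, s * B.form (p.1 + s • p.2) p.2 v := by
  have hc : Continuous fun s : ℝ => B.gaugeIntegrand (s, p) :=
    B.gaugeIntegrand_temperate.1.continuous.comp (by fun_prop)
  have h1 := (ContinuousLinearMap.apply ℝ ℝ v).intervalIntegral_comp_comm
    (hc.intervalIntegrable (μ := volume) 0 1)
  exact h1.symm

lemma continuous_form : Continuous B.form := B.contDiff_form.continuous

lemma continuous_fderiv_form : Continuous (fderiv ℝ B.form) :=
  B.contDiff_form.continuous_fderiv (by simp)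

lemma sum_mul_potential (x v : Pos d) : ∑ k, v k * B.potential k x = B.potentialForm x v := by
  have hc := fun j k => (B.smooth j k).continuous
  have hi : ∀ j k, IntervalIntegrable (fun s : ℝ => s * x j * B.comp j k (s • x)) volume 0 1 :=
    fun j k => Continuous.intervalIntegrable (by have := hc j k; fun_prop) _ _
  rw [potentialForm, gauge_apply]
  simp only [potential, zero_add, form_apply, Finset.mul_sum]
  rw [intervalIntegral.integral_finsetSum, Finset.sum_comm]
  · refine Finset.sum_congr rfl fun j _ => ?_
    rw [intervalIntegral.integral_finsetSum]
    · refine Finset.sum_congr rfl fun k _ => ?_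
      rw [← intervalIntegral.integral_const_mul]
      congr 1
      ext s
      ring
    · intro k _
      exact Continuous.intervalIntegrable (by have := hc j k; fun_prop) _ _
  · intro j _
    exact Continuous.intervalIntegrable (by
      refine continuous_finsetSum _ fun k _ => ?_
      have := hc j k; fun_prop) _ _

lemma circulation_eq (x y : Pos d) :
    B.circulation x y = ∫ s in (0 : ℝ)..1, B.potentialForm (y + s • (x - y)) (x - y) := by
  unfold circulation
  simp_rw [← sum_mul_potential]
  rfl

lemma circulation_swap (x y : Pos d) : B.circulation y x = -B.circulation x y := by
  rw [circulation_eq, circulation_eq]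
  have h := intervalIntegral.integral_comp_sub_left
    (fun s => B.potentialForm (y + s • (x - y)) (x - y)) (1 : ℝ) (a := 0) (b := 1)
  simp only [sub_self, sub_zero] at h
  rw [← h, ← intervalIntegral.integral_neg]
  congr 1
  ext s
  rw [← map_neg, neg_sub]
  congr 2
  module

lemma fderiv_potentialForm_apply (x h v : Pos d) :
    fderiv ℝ B.potentialForm x h v = ∫ s in (0 : ℝ)..1,
      (s * B.form (s • x) h v + s ^ 2 * fderiv ℝ B.form (s • x) h x v) := by
  let f : ℝ × Pos d → Pos d →L[ℝ] ℝ := fun q => B.gaugeIntegrand (q.1, (0, q.2))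
  have hf : f.HasTemperateGrowth := B.gaugeIntegrand_temperate.comp
    ((ContinuousLinearMap.fst ℝ ℝ (Pos d)).prod ((0 : ℝ × Pos d →L[ℝ] Pos d).prod
      (ContinuousLinearMap.snd ℝ ℝ (Pos d)))).hasTemperateGrowth
  have h1 := hasFDerivAt_paramIntegral hf x
  have h2 : fderiv ℝ B.potentialForm x = ∫ s in (0 : ℝ)..1, fderiv ℝ (fun v => f (s, v)) x := by
    simp_rw [← fderiv_comp_inr hf]
    exact h1.fderiv
  have h3 : ∀ s : ℝ, HasFDerivAt (fun v => f (s, v))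
      (s • ((B.form (s • x)).comp (ContinuousLinearMap.id ℝ (Pos d)) +
        ((fderiv ℝ B.form (s • x)).comp (s • ContinuousLinearMap.id ℝ (Pos d))).flip x)) x := by
    intro s
    have h4 : HasFDerivAt (fun v : Pos d => B.form (s • v))
        ((fderiv ℝ B.form (s • x)).comp (s • ContinuousLinearMap.id ℝ (Pos d))) x :=
      (B.hasFDerivAt_form (s • x)).comp x (s • ContinuousLinearMap.id ℝ (Pos d)).hasFDerivAt
    have h5 := (h4.clm_apply (hasFDerivAt_id x)).const_smul s
    have h6 : (fun v => f (s, v)) = fun v => s • B.form (s • v) v := by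
      ext v; simp [f, gaugeIntegrand]
    rw [h6]
    exact h5
  have hc : Continuous fun s : ℝ => fderiv ℝ (fun v => f (s, v)) x := by
    have h7 := (hasTemperateGrowth_derivSnd hf).1.continuous.comp
      (f := fun s : ℝ => (s, x)) (by fun_prop)
    refine h7.congr fun s => fderiv_comp_inr hf s x
  rw [h2]
  have h8 := (ContinuousLinearMap.apply ℝ (Pos d →L[ℝ] ℝ) h).intervalIntegral_comp_comm
    (hc.intervalIntegrable (μ := volume) 0 1)
  have h9 := (ContinuousLinearMap.apply ℝ ℝ v).intervalIntegral_comp_comm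
    (((ContinuousLinearMap.apply ℝ (Pos d →L[ℝ] ℝ) h).continuous.comp hc).intervalIntegrable
      (μ := volume) 0 1)
  simp only [ContinuousLinearMap.apply_apply, Function.comp_def] at h8 h9
  rw [← h8, ← h9]
  congr 1
  ext s
  rw [(h3 s).fderiv]
  simp
  ring

/-- The primitive that turns the antisymmetrised derivative of the potential into a boundary term,
as in the proof of the Poincaré lemma. -/
lemma hasDerivAt_sq_mul_form (x h v : Pos d) (s : ℝ) :
    HasDerivAt (fun s : ℝ => s ^ 2 * B.form (s • x) h v)
      (2 * s * B.form (s • x) h v + s ^ 2 * fderiv ℝ B.form (s • x) x h v) s := by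
  have h2 : HasDerivAt (fun s : ℝ => s • x) x s := by
    simpa using (hasDerivAt_id s).smul_const x
  have h1 : HasDerivAt (fun s : ℝ => B.form (s • x)) (fderiv ℝ B.form (s • x) x) s := by
    have h0 := (B.hasFDerivAt_form (s • x)).comp_hasDerivAt s h2
    exact h0
  have h3 : HasDerivAt (fun s : ℝ => B.form (s • x) h) (fderiv ℝ B.form (s • x) x h) s := by
    simpa using h1.clm_apply (hasDerivAt_const s h)
  have h4 : HasDerivAt (fun s : ℝ => B.form (s • x) h v) (fderiv ℝ B.form (s • x) x h v) s := by
    simpa using h3.clm_apply (hasDerivAt_const s v)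
  exact ((hasDerivAt_pow 2 s).mul h4).congr_deriv (by norm_num)

/-- The transversal gauge potential is a potential of the magnetic field, `dA = B`. -/
lemma fderiv_potentialForm_sub (x h v : Pos d) :
    fderiv ℝ B.potentialForm x h v - fderiv ℝ B.potentialForm x v h = B.form x h v := by
  have hc : ∀ h v : Pos d, Continuous fun s : ℝ => s * B.form (s • x) h v := fun h v => by
    have := B.continuous_form
    fun_prop
  have hc' : ∀ u h v : Pos d, Continuous fun s : ℝ => s ^ 2 * fderiv ℝ B.form (s • x) u h v :=
    fun u h v => by
      have := B.continuous_fderiv_form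
      fun_prop
  have hi : ∀ h v, IntervalIntegrable (fun s : ℝ => s * B.form (s • x) h v +
      s ^ 2 * fderiv ℝ B.form (s • x) h x v) volume 0 1 := fun h v =>
    ((hc h v).add (hc' h x v)).intervalIntegrable 0 1
  rw [fderiv_potentialForm_apply, fderiv_potentialForm_apply,
    ← intervalIntegral.integral_sub (hi h v) (hi v h)]
  have h5 := intervalIntegral.integral_eq_sub_of_hasDerivAt (a := 0) (b := 1)
    (fun s _ => B.hasDerivAt_sq_mul_form x h v s)
    ((((hc h v).const_mul 2).add (hc' x h v)).intervalIntegrable 0 1 |>.congr (by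
      intro s _; simp [mul_assoc]))
  simp only [one_smul, one_pow, one_mul, ne_eq, OfNat.ofNat_ne_zero, not_false_eq_true, zero_pow,
    zero_mul, sub_zero] at h5
  rw [← h5]
  congr 1
  ext s
  have e1 := B.form_swap (s • x) v h
  have e2 := B.fderiv_form_cyclic (s • x) x h v
  have e3 := B.fderiv_form_swap (s • x) h x v
  rw [e1]
  linear_combination s ^ 2 * e3 - s ^ 2 * e2

end MagneticField

/-! ### The magnetic phase factor of a quadrilateral -/

section PhaseFactor
variable {E V : Type} [NormedAddCommGroup E] [NormedSpace ℝ E] [NormedAddCommGroup V]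
  [NormedSpace ℝ V]

/-- If the derivative of a real phase is polynomially bounded in the second variable, together with
all its derivatives, then so are the derivatives of the phase factor. -/
lemma exists_derivBound_phase {F : E × V → ℝ} {F' : E × V → E × V →L[ℝ] ℝ}
    (hF : ∀ z, HasFDerivAt F (F' z) z)
    (hF' : ∀ N, ∃ C, DerivBound (fun z : E × V => 1 + ‖z.2‖) N C F') (N : ℕ) :
    ∃ (k : ℕ) (C : ℝ), DerivBound (fun z : E × V => (1 + ‖z.2‖) ^ k) N C
      (fun z => phase (F z)) := by
  induction N with
  | zero =>
    refine ⟨0, 1, .of_continuous zero_le_one ?_ fun z => by simp⟩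
    exact continuous_phase.comp (continuous_iff_continuousAt.2 fun z => (hF z).continuousAt)
  | succ N ih =>
    obtain ⟨k, C, hC⟩ := ih
    obtain ⟨D, hD⟩ := hF' N
    obtain ⟨K, hK, hb⟩ := DerivBound.exists_bilinear (E := E × V)
      (ContinuousLinearMap.lsmul ℝ ℂ (E := E × V →L[ℝ] ℂ))
    have h1 := hD.clm_comp (ContinuousLinearMap.compL ℝ (E × V) ℝ ℂ (Complex.I • Complex.ofRealCLM))
    have h2 := (hb _ _ _ _ _ _ _ hC h1).mono_const (fun z => by positivity) (le_max_left _ 1)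
    refine ⟨k + 1, _, .of_hasFDerivAt (f' := _) (fun z => ?_) (fun z => ?_)
      (h2.mono_weight_one fun z => (pow_succ _ _).ge)⟩
    · rw [norm_phase]
      exact one_le_mul_of_one_le_of_one_le (le_max_right _ _)
        (one_le_pow₀ (by linarith [norm_nonneg z.2]))
    · refine (hasFDerivAt_phase_comp (hF z)).congr_fderiv ?_
      ext v <;> simp [mul_assoc]

end PhaseFactor

namespace MagneticField
variable {d : ℕ} (B : MagneticField d)

/-- The circulation from a fixed point `y` is a gauge transformation between the potential and the
potential in the transversal gauge centred at `y`. -/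
lemma hasFDerivAt_circulation_left (x y : Pos d) :
    HasFDerivAt (fun x => B.circulation x y) (B.potentialForm x - B.gauge (y, x - y)) x := by
  have hp := B.potentialForm_temperate
  have hd : ∀ z, HasFDerivAt B.potentialForm (fderiv ℝ B.potentialForm z) z := fun z =>
    ((hp.1.differentiable (by simp)) z).hasFDerivAt
  have hc1 : Continuous B.potentialForm := hp.1.continuous
  have hc2 : Continuous (fderiv ℝ B.potentialForm) := hp.1.continuous_fderiv (by simp)
  have hc3 := B.continuous_form
  let f : ℝ × Pos d → ℝ := fun q => B.potentialForm (y + q.1 • (q.2 - y)) (q.2 - y)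
  have hf : f.HasTemperateGrowth := by
    have h1 : (fun q : ℝ × Pos d => q.1).HasTemperateGrowth :=
      (ContinuousLinearMap.fst ℝ ℝ (Pos d)).hasTemperateGrowth
    have h2 : (fun q : ℝ × Pos d => q.2 - y).HasTemperateGrowth :=
      (ContinuousLinearMap.snd ℝ ℝ (Pos d)).hasTemperateGrowth.sub (.const y)
    have h3 : (fun q : ℝ × Pos d => y + q.1 • (q.2 - y)).HasTemperateGrowth :=
      (Function.HasTemperateGrowth.const y).add (h1.smul h2)
    exact (ContinuousLinearMap.id ℝ (Pos d →L[ℝ] ℝ)).bilinear_hasTemperateGrowth (hp.comp h3) h2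
  have h1 := hasFDerivAt_paramIntegral hf x
  have h0 : (fun x => B.circulation x y) = fun x => ∫ s in (0 : ℝ)..1, f (s, x) :=
    funext fun x => B.circulation_eq x y
  rw [h0]
  refine h1.congr_fderiv ?_
  have h3 : ∀ s : ℝ, HasFDerivAt (fun x => f (s, x))
      ((B.potentialForm (y + s • (x - y))).comp (ContinuousLinearMap.id ℝ (Pos d)) +
        ((fderiv ℝ B.potentialForm (y + s • (x - y))).comp
          (s • ContinuousLinearMap.id ℝ (Pos d))).flip (x - y)) x := by
    intro s
    have h4 : HasFDerivAt (fun x : Pos d => y + s • (x - y)) (s • ContinuousLinearMap.id ℝ (Pos d)) x :=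
      (((hasFDerivAt_id x).sub_const y).const_smul s).const_add y
    have h5 := (hd (y + s • (x - y))).comp x h4
    exact h5.clm_apply ((hasFDerivAt_id x).sub_const y)
  have hcd : Continuous fun s : ℝ =>
      (fderiv ℝ f (s, x)).comp (ContinuousLinearMap.inr ℝ ℝ (Pos d)) :=
    (hasTemperateGrowth_derivSnd hf).1.continuous.comp (f := fun s : ℝ => (s, x)) (by fun_prop)
  ext h
  have h8 := (ContinuousLinearMap.apply ℝ ℝ h).intervalIntegral_comp_comm
    (hcd.intervalIntegrable (μ := volume) 0 1)
  simp only [ContinuousLinearMap.apply_apply] at h8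
  rw [← h8]
  have h9 : ∀ s : ℝ, ((fderiv ℝ f (s, x)).comp (ContinuousLinearMap.inr ℝ ℝ (Pos d))) h =
      B.potentialForm (y + s • (x - y)) h +
        s * fderiv ℝ B.potentialForm (y + s • (x - y)) h (x - y) := fun s => by
    rw [fderiv_comp_inr hf, (h3 s).fderiv]
    simp
  simp only [h9]
  -- The closedness `dA = B` makes the integrand a total derivative minus that of the gauge.
  have hder : ∀ s : ℝ, HasDerivAt (fun s : ℝ => s * B.potentialForm (y + s • (x - y)) h)
      (B.potentialForm (y + s • (x - y)) h +
        s * fderiv ℝ B.potentialForm (y + s • (x - y)) (x - y) h) s := by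
    intro s
    have g1 : HasDerivAt (fun s : ℝ => y + s • (x - y)) (x - y) s := by
      simpa using ((hasDerivAt_id s).smul_const (x - y)).const_add y
    have g2 := (hd (y + s • (x - y))).comp_hasDerivAt s g1
    have g3 : HasDerivAt (fun s : ℝ => B.potentialForm (y + s • (x - y)) h)
        (fderiv ℝ B.potentialForm (y + s • (x - y)) (x - y) h) s := by
      simpa using g2.clm_apply (hasDerivAt_const s h)
    exact ((hasDerivAt_id s).mul g3).congr_deriv (by simp)
  have hi1 : IntervalIntegrable (fun s : ℝ => B.potentialForm (y + s • (x - y)) h +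
        s * fderiv ℝ B.potentialForm (y + s • (x - y)) (x - y) h) volume 0 1 :=
    Continuous.intervalIntegrable (by fun_prop) _ _
  have hi2 : IntervalIntegrable (fun s : ℝ => s * B.form (y + s • (x - y)) (x - y) h) volume 0 1 :=
    Continuous.intervalIntegrable (by fun_prop) _ _
  have h10 := intervalIntegral.integral_eq_sub_of_hasDerivAt (a := 0) (b := 1)
    (fun s _ => hder s) hi1
  simp only [one_smul, one_mul, zero_mul, sub_zero, add_sub_cancel] at h10
  rw [sub_apply, gauge_apply, ← h10, ← intervalIntegral.integral_sub hi1 hi2]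
  congr 1
  ext s
  have e1 := B.fderiv_potentialForm_sub (y + s • (x - y)) h (x - y)
  have e2 := B.form_swap (y + s • (x - y)) h (x - y)
  linear_combination s * e1 + s * e2

lemma hasFDerivAt_circulation_right (x y : Pos d) :
    HasFDerivAt (fun y => B.circulation x y) (B.gauge (x, y - x) - B.potentialForm y) y := by
  have h1 : (fun y => B.circulation x y) = fun y => -B.circulation y x :=
    funext fun y => by rw [B.circulation_swap x y, neg_neg]
  rw [h1]
  exact (B.hasFDerivAt_circulation_left y x).neg.congr_fderiv (neg_sub _ _)

/-- The part of the differential of the circulation that is not a difference of values of the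
potential: it does not change under gauge transformations. -/
def gaugeDefect (p : Phase d) : Phase d →L[ℝ] ℝ :=
  (B.gauge (p.1, p.2 - p.1)).comp (ContinuousLinearMap.snd ℝ (Pos d) (Pos d)) -
    (B.gauge (p.2, p.1 - p.2)).comp (ContinuousLinearMap.fst ℝ (Pos d) (Pos d))

lemma hasFDerivAt_circulation (p : Phase d) :
    HasFDerivAt (fun p : Phase d => B.circulation p.1 p.2)
      ((B.potentialForm p.1).comp (ContinuousLinearMap.fst ℝ (Pos d) (Pos d)) -
        (B.potentialForm p.2).comp (ContinuousLinearMap.snd ℝ (Pos d) (Pos d)) +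
          B.gaugeDefect p) p := by
  have h1 := ((B.circulation_temperate.1.differentiable (by simp)) p).hasFDerivAt
  set c := fderiv ℝ (fun p : Phase d => B.circulation p.1 p.2) p
  have hl' := HasFDerivAt.comp (g := fun p : Phase d => B.circulation p.1 p.2)
    (f := fun x => (x, p.2)) p.1 h1 (hasFDerivAt_prodMk_left p.1 p.2)
  have hl : c.comp (ContinuousLinearMap.inl ℝ (Pos d) (Pos d)) =
      B.potentialForm p.1 - B.gauge (p.2, p.1 - p.2) :=
    hl'.unique (B.hasFDerivAt_circulation_left p.1 p.2)
  have hr' := HasFDerivAt.comp (g := fun p : Phase d => B.circulation p.1 p.2)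
    (f := fun y => (p.1, y)) p.2 h1 (hasFDerivAt_prodMk_right p.1 p.2)
  have hr : c.comp (ContinuousLinearMap.inr ℝ (Pos d) (Pos d)) =
      B.gauge (p.1, p.2 - p.1) - B.potentialForm p.2 :=
    hr'.unique (B.hasFDerivAt_circulation_right p.1 p.2)
  refine h1.congr_fderiv ?_
  ext h
  · have := congrArg (fun l : Pos d →L[ℝ] ℝ => l h) hl
    simpa [gaugeDefect, sub_eq_add_neg] using this
  · have := congrArg (fun l : Pos d →L[ℝ] ℝ => l h) hr
    simpa [gaugeDefect, sub_eq_add_neg, add_comm] using this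

/-- Along a segment whose direction depends on the second variable only, the gauge defect is bounded
in terms of the length of the segment, uniformly in its position. -/
lemma exists_derivBound_gaugeDefect {E V : Type} [NormedAddCommGroup E] [NormedSpace ℝ E]
    [NormedAddCommGroup V] [NormedSpace ℝ V] (T : E × V →L[ℝ] Phase d) (S : V →L[ℝ] Pos d)
    (hTS : ∀ z, (T z).1 - (T z).2 = S z.2) (N : ℕ) :
    ∃ C, DerivBound (fun z : E × V => 1 + ‖z.2‖) N C (fun z => (B.gaugeDefect (T z)).comp T) := by
  obtain ⟨C, hC⟩ := B.exists_derivBound_gauge N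
  let p1 := ContinuousLinearMap.fst ℝ (Pos d) (Pos d)
  let p2 := ContinuousLinearMap.snd ℝ (Pos d) (Pos d)
  have hw : ∀ z : E × V, 1 + ‖S z.2‖ ≤ max 1 ‖S‖ * (1 + ‖z.2‖) := fun z => by
    rw [mul_add, mul_one]
    exact add_le_add (le_max_left _ _) ((S.le_opNorm _).trans
      (mul_le_mul_of_nonneg_right (le_max_right _ _) (norm_nonneg _)))
  have h1 := (hC.comp_clm ((p1.comp T).prod (p2.comp T - p1.comp T))).mono_weight
    (W' := fun z : E × V => 1 + ‖z.2‖) (C := max 1 ‖S‖) (by positivity) (fun z => by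
      have : ‖(T z).2 - (T z).1‖ = ‖S z.2‖ := by rw [← hTS, norm_sub_rev]
      refine le_trans (le_of_eq ?_) (hw z)
      rw [← this]; rfl)
  have h2 := (hC.comp_clm ((p2.comp T).prod (p1.comp T - p2.comp T))).mono_weight
    (W' := fun z : E × V => 1 + ‖z.2‖) (C := max 1 ‖S‖) (by positivity) (fun z => by
      refine le_trans (le_of_eq ?_) (hw z)
      rw [← hTS]; rfl)
  have h3 := h1.clm_comp ((ContinuousLinearMap.compL ℝ (E × V) (Pos d) ℝ).flip (p2.comp T))
  have h4 := h2.clm_comp (-(ContinuousLinearMap.compL ℝ (E × V) (Pos d) ℝ).flip (p1.comp T))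
  refine ⟨_, (h3.add h4).congr fun z => ?_⟩
  ext v <;> simp [gaugeDefect, p1, p2, sub_eq_add_neg]

end MagneticField

section Geometry
variable (d : ℕ)

/-- The space of the integration variables `((a, b), w)`, and of their dual variables. -/
abbrev TripleSpace : Type := Phase d × Pos d

/-- The position `x` of `((x, ξ), ((a, b), w))`. -/
def posMap : Phase d × TripleSpace d →L[ℝ] Pos d :=
  (ContinuousLinearMap.fst ℝ (Pos d) (Pos d)).comp (ContinuousLinearMap.fst ℝ _ (TripleSpace d))

/-- The variable `a` of `((a, b), w)`. -/
def tripleA : TripleSpace d →L[ℝ] Pos d :=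
  (ContinuousLinearMap.fst ℝ (Pos d) (Pos d)).comp (ContinuousLinearMap.fst ℝ (Phase d) (Pos d))

/-- The variable `b` of `((a, b), w)`. -/
def tripleB : TripleSpace d →L[ℝ] Pos d :=
  (ContinuousLinearMap.snd ℝ (Pos d) (Pos d)).comp (ContinuousLinearMap.fst ℝ (Phase d) (Pos d))

/-- The variable `w` of `((a, b), w)`. -/
def tripleW : TripleSpace d →L[ℝ] Pos d := ContinuousLinearMap.snd ℝ (Phase d) (Pos d)

/-- The separation `x_L - x_R = w + a - b`. -/
def sepMap : TripleSpace d →L[ℝ] Pos d := tripleW d + tripleA d - tripleB d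

/-- The vertex `x_L = x + (w + a - b) / 2`. -/
def vertexXL : Phase d × TripleSpace d →L[ℝ] Pos d :=
  posMap d + (2⁻¹ : ℝ) • (sepMap d).comp (ContinuousLinearMap.snd ℝ (Phase d) (TripleSpace d))

/-- The vertex `x_R = x - (w + a - b) / 2`. -/
def vertexXR : Phase d × TripleSpace d →L[ℝ] Pos d :=
  posMap d - (2⁻¹ : ℝ) • (sepMap d).comp (ContinuousLinearMap.snd ℝ (Phase d) (TripleSpace d))

/-- The vertex `y_L = x_L - a`. -/
def vertexYL : Phase d × TripleSpace d →L[ℝ] Pos d :=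
  vertexXL d - (tripleA d).comp (ContinuousLinearMap.snd ℝ (Phase d) (TripleSpace d))

/-- The vertex `y_R = x_R - b`. -/
def vertexYR : Phase d × TripleSpace d →L[ℝ] Pos d :=
  vertexXR d - (tripleB d).comp (ContinuousLinearMap.snd ℝ (Phase d) (TripleSpace d))

variable {d} (B : MagneticField d)

/-- The circulation of the potential along the closed quadrilateral `x_L, y_L, y_R, x_R`, that is,
the magnetic flux through it. -/
def flux (z : Phase d × TripleSpace d) : ℝ :=
  B.circulation (vertexXL d z) (vertexYL d z) - B.circulation (vertexXR d z) (vertexYR d z) +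
    B.circulation (vertexYL d z) (vertexYR d z) - B.circulation (vertexXL d z) (vertexXR d z)

/-- The differential of the flux: the values of the potential at the vertices cancel, because the
quadrilateral is closed. -/
def fluxDeriv (z : Phase d × TripleSpace d) : Phase d × TripleSpace d →L[ℝ] ℝ :=
  (B.gaugeDefect ((vertexXL d).prod (vertexYL d) z)).comp ((vertexXL d).prod (vertexYL d)) -
    (B.gaugeDefect ((vertexXR d).prod (vertexYR d) z)).comp ((vertexXR d).prod (vertexYR d)) +
    (B.gaugeDefect ((vertexYL d).prod (vertexYR d) z)).comp ((vertexYL d).prod (vertexYR d)) -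
    (B.gaugeDefect ((vertexXL d).prod (vertexXR d) z)).comp ((vertexXL d).prod (vertexXR d))

lemma hasFDerivAt_flux (z : Phase d × TripleSpace d) :
    HasFDerivAt (flux B) (fluxDeriv B z) z := by
  have h : ∀ T : Phase d × TripleSpace d →L[ℝ] Phase d, HasFDerivAt
      (fun z => B.circulation (T z).1 (T z).2) _ z := fun T =>
    (B.hasFDerivAt_circulation (T z)).comp z T.hasFDerivAt
  refine ((((h ((vertexXL d).prod (vertexYL d))).sub (h ((vertexXR d).prod (vertexYR d)))).add
    (h ((vertexYL d).prod (vertexYR d)))).sub (h ((vertexXL d).prod (vertexXR d)))).congr_fderiv ?_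
  apply ContinuousLinearMap.ext
  intro v
  simp only [fluxDeriv, ContinuousLinearMap.comp_apply, add_apply, sub_apply,
    ContinuousLinearMap.prod_apply, ContinuousLinearMap.coe_fst', ContinuousLinearMap.coe_snd']
  ring

lemma exists_derivBound_fluxDeriv (N : ℕ) : ∃ C,
    DerivBound (fun z : Phase d × TripleSpace d => 1 + ‖z.2‖) N C (fluxDeriv B) := by
  obtain ⟨C1, h1⟩ := B.exists_derivBound_gaugeDefect ((vertexXL d).prod (vertexYL d)) (tripleA d)
    (fun z => by simp [vertexYL]) N
  obtain ⟨C2, h2⟩ := B.exists_derivBound_gaugeDefect ((vertexXR d).prod (vertexYR d)) (tripleB d)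
    (fun z => by simp [vertexYR]) N
  obtain ⟨C3, h3⟩ := B.exists_derivBound_gaugeDefect ((vertexYL d).prod (vertexYR d)) (tripleW d)
    (fun z => by simp [vertexYL, vertexYR, vertexXL, vertexXR, sepMap]; module) N
  obtain ⟨C4, h4⟩ := B.exists_derivBound_gaugeDefect ((vertexXL d).prod (vertexXR d)) (sepMap d)
    (fun z => by simp [vertexXL, vertexXR]; module) N
  let m : (Phase d × TripleSpace d →L[ℝ] ℝ) →L[ℝ] (Phase d × TripleSpace d →L[ℝ] ℝ) :=
    -ContinuousLinearMap.id ℝ _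
  -- The four edges of the quadrilateral are `a`, `b`, `w` and `w + a - b`.
  refine ⟨_, (((h1.add (h2.clm_comp m)).add h3).add (h4.clm_comp m)).congr fun z => ?_⟩
  simp [fluxDeriv, m, sub_eq_add_neg]

/-- The derivatives of the magnetic phase factor are bounded uniformly in the position, and grow at
most polynomially in the size of the quadrilateral. -/
theorem exists_derivBound_fluxPhase (N : ℕ) : ∃ (k : ℕ) (C : ℝ),
    DerivBound (fun z : Phase d × TripleSpace d => (1 + ‖z.2‖) ^ k) N C
      (fun z => phase (flux B z)) :=
  exists_derivBound_phase (hasFDerivAt_flux B) (exists_derivBound_fluxDeriv B) N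

end Geometry

/-! ### The product of symbols as an oscillatory integral -/

instance (d : ℕ) : (volume : Measure (TripleSpace d)).IsAddHaarMeasure := isAddHaarMeasure_prod

section Pairing
variable (d : ℕ)

/-- The duality `⟨((a, b), w), ((η₁, η₂), η₃)⟩ = η₁·a - η₂·b + η₃·w`. -/
def triplePairing : TripleSpace d →L[ℝ] TripleSpace d →L[ℝ] ℝ :=
  (innerSL ℝ : Pos d →L[ℝ] Pos d →L[ℝ] ℝ).bilinearComp (tripleA d) (tripleA d) -
    (innerSL ℝ : Pos d →L[ℝ] Pos d →L[ℝ] ℝ).bilinearComp (tripleB d) (tripleB d) +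
    (innerSL ℝ : Pos d →L[ℝ] Pos d →L[ℝ] ℝ).bilinearComp (tripleW d) (tripleW d)

variable {d}

lemma triplePairing_apply (t η : TripleSpace d) :
    triplePairing d t η = ⟪t.1.1, η.1.1⟫_ℝ - ⟪t.1.2, η.1.2⟫_ℝ + ⟪t.2, η.2⟫_ℝ := rfl

lemma triplePairing_flip : (triplePairing d).flip = triplePairing d := by
  apply ContinuousLinearMap.ext
  intro t
  apply ContinuousLinearMap.ext
  intro η
  rw [ContinuousLinearMap.flip_apply, triplePairing_apply, triplePairing_apply,
    real_inner_comm, real_inner_comm t.1.2, real_inner_comm t.2]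

lemma norm_le_norm_triplePairing (t : TripleSpace d) : ‖t‖ ≤ 1 * ‖triplePairing d t‖ := by
  have key : ∀ (v : Pos d) (η : TripleSpace d), ‖η‖ = ‖v‖ → ‖triplePairing d t η‖ = ‖v‖ * ‖v‖ →
      ‖v‖ ≤ ‖triplePairing d t‖ := fun v η h1 h2 => by
    have h := (triplePairing d t).le_opNorm η
    rw [h1, h2] at h
    rcases eq_or_lt_of_le (norm_nonneg v) with h0 | h0
    · rw [← h0]; positivity
    · exact le_of_mul_le_mul_right h h0
  rw [one_mul, Prod.norm_def, Prod.norm_def]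
  refine max_le (max_le ?_ ?_) ?_
  · exact key _ ((t.1.1, 0), 0) (by simp [Prod.norm_def]) (by simp [triplePairing_apply, sq])
  · exact key _ ((0, t.1.2), 0) (by simp [Prod.norm_def]) (by simp [triplePairing_apply, sq])
  · exact key _ ((0, 0), t.2) (by simp [Prod.norm_def]) (by simp [triplePairing_apply, sq])

lemma exists_norm_le_triplePairing : ∃ c, 1 ≤ c ∧ ∀ a, ‖a‖ ≤ c * ‖triplePairing d a‖ :=
  ⟨1, le_rfl, norm_le_norm_triplePairing⟩

lemma exists_norm_le_triplePairing_flip :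
    ∃ c, 1 ≤ c ∧ ∀ a, ‖a‖ ≤ c * ‖(triplePairing d).flip a‖ := by
  rw [triplePairing_flip]
  exact exists_norm_le_triplePairing

end Pairing

section Symbol
variable (d : ℕ)

/-- The point `((x_L + y_L) / 2, ξ + η₁)` at which the super symbol is evaluated. -/
def leftPoint : (Phase d × TripleSpace d) × TripleSpace d →L[ℝ] Phase d where
  toFun z := (z.1.1.1 + (2⁻¹ : ℝ) • (z.1.2.2 - z.1.2.1.2), z.1.1.2 + z.2.1.1)
  map_add' z z' := by ext <;> simp <;> ring
  map_smul' c z := by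
    ext <;> simp
    ring
  cont := by fun_prop

/-- The point `((x_R + y_R) / 2, ξ + η₂)` at which the super symbol is evaluated. -/
def rightPoint : (Phase d × TripleSpace d) × TripleSpace d →L[ℝ] Phase d where
  toFun z := (z.1.1.1 - (2⁻¹ : ℝ) • (z.1.2.2 + z.1.2.1.1), z.1.1.2 + z.2.1.2)
  map_add' z z' := by ext <;> simp <;> ring
  map_smul' c z := by
    ext <;> simp
    ring
  cont := by fun_prop

/-- The point `((y_L + y_R) / 2, ξ + η₃)` at which the symbol is evaluated. -/
def midPoint : (Phase d × TripleSpace d) × TripleSpace d →L[ℝ] Phase d where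
  toFun z := (z.1.1.1 - (2⁻¹ : ℝ) • (z.1.2.1.1 + z.1.2.1.2), z.1.1.2 + z.2.2)
  map_add' z z' := by ext <;> simp <;> ring
  map_smul' c z := by
    ext <;> simp
    ring
  cont := by fun_prop

variable {d}

/-- The product of the values of a function on `Phase d × Phase d` and a function on `Phase d` that
enters the oscillatory integral for the semi-super product. It is used both for symbols and for
their weights. -/
def amplitude {R : Type} [Mul R] (Φ : Phase d × Phase d → R) (ψ : Phase d → R)
    (z : (Phase d × TripleSpace d) × TripleSpace d) : R :=
  Φ (leftPoint d z, rightPoint d z) * ψ (midPoint d z)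

lemma isTempered_amplitude {M : Phase d × Phase d → ℝ} {m : Phase d → ℝ} (hM : IsTempered M)
    (hm : IsTempered m) : IsTempered (amplitude M m) :=
  (hM.comp_clm ((leftPoint d).prod (rightPoint d))).mul (hm.comp_clm (midPoint d))

lemma exists_derivBound_amplitude (N : ℕ) : ∃ C, 0 ≤ C ∧
    ∀ (M : Phase d × Phase d → ℝ) (m : Phase d → ℝ) (A A' : ℝ) (Φ : Phase d × Phase d → ℂ)
      (ψ : Phase d → ℂ), DerivBound M N A Φ → DerivBound m N A' ψ →
      DerivBound (amplitude M m) N (A * A' * C) (amplitude Φ ψ) := by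
  refine ⟨2 ^ N * max 1 ‖(leftPoint d).prod (rightPoint d)‖ ^ N * max 1 ‖midPoint d‖ ^ N,
    by positivity, fun M m A A' Φ ψ hΦ hψ => ?_⟩
  have h := (hΦ.comp_clm ((leftPoint d).prod (rightPoint d))).mul (hψ.comp_clm (midPoint d))
  have e : A * A' * (2 ^ N * max 1 ‖(leftPoint d).prod (rightPoint d)‖ ^ N *
      max 1 ‖midPoint d‖ ^ N) = 2 ^ N * (A * max 1 ‖(leftPoint d).prod (rightPoint d)‖ ^ N) *
        (A' * max 1 ‖midPoint d‖ ^ N) := by ring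
  rw [e]
  exact h

lemma isSymbol_amplitude {M : Phase d × Phase d → ℝ} {m : Phase d → ℝ}
    {Φ : Phase d × Phase d → ℂ} {ψ : Phase d → ℂ} (hΦ : IsSymbol M Φ) (hψ : IsSymbol m ψ) :
    IsSymbol (amplitude M m) (amplitude Φ ψ) :=
  (hΦ.comp_clm ((leftPoint d).prod (rightPoint d))).mul (hψ.comp_clm (midPoint d))

variable (B : MagneticField d)

/-- The semi-super product of the symbols `Φ` and `ψ`, as an oscillatory integral over the
quadrilaterals `x_L, y_L, y_R, x_R` with `(x_L + x_R) / 2 = x` and over the momenta. -/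
def symbolProduct (Φ : Phase d × Phase d → ℂ) (ψ : Phase d → ℂ) (X : Phase d) : ℂ :=
  ((2 * π : ℂ) ^ (3 * d))⁻¹ *
    oscIntegral (triplePairing d) (fun z => phase (flux B z)) (amplitude Φ ψ) X

/-- The estimate behind the continuity of the semi-super product. At the stationary point
`a = b = w = η = 0` both arguments of `Φ`, and that of `ψ`, equal `X`. -/
theorem exists_derivBound_symbolProduct {M : Phase d × Phase d → ℝ} {m : Phase d → ℝ}
    (hM : IsTempered M) (hm : IsTempered m) (N : ℕ) : ∃ (N' : ℕ) (C : ℝ), 0 ≤ C ∧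
      ∀ (A A' : ℝ) (Φ : Phase d × Phase d → ℂ) (ψ : Phase d → ℂ),
        DerivBound M N' A Φ → DerivBound m N' A' ψ →
        DerivBound (fun X => M (X, X) * m X) N (A * A' * C) (symbolProduct B Φ ψ) := by
  obtain ⟨N', C, hC, h⟩ := exists_derivBound_oscIntegral exists_norm_le_triplePairing
    exists_norm_le_triplePairing_flip (exists_derivBound_fluxPhase B) (isTempered_amplitude hM hm) N
  obtain ⟨C', hC', h'⟩ := exists_derivBound_amplitude (d := d) N'
  let c := ContinuousLinearMap.lsmul ℝ ℂ (E := ℂ) ((2 * π : ℂ) ^ (3 * d))⁻¹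
  refine ⟨N', ‖c‖ * (C' * C), by positivity, fun A A' Φ ψ hΦ hψ => ?_⟩
  have h1 := (h _ _ (h' M m A A' Φ ψ hΦ hψ)).clm_comp c
  have e1 : A * A' * (‖c‖ * (C' * C)) = ‖c‖ * (A * A' * C' * C) := by ring
  have e2 : (fun X : Phase d => amplitude M m ((X, 0), 0)) = fun X => M (X, X) * m X := by
    ext X
    simp [amplitude, leftPoint, rightPoint, midPoint]
  rw [e2] at h1
  rw [e1]
  exact h1

lemma isSymbol_symbolProduct {M : Phase d × Phase d → ℝ} {m : Phase d → ℝ}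
    (hM : IsTempered M) (hm : IsTempered m) {Φ : Phase d × Phase d → ℂ} {ψ : Phase d → ℂ}
    (hΦ : IsSymbol M Φ) (hψ : IsSymbol m ψ) :
    IsSymbol (fun X => M (X, X) * m X) (symbolProduct B Φ ψ) := fun N => by
  obtain ⟨N', C, -, h⟩ := exists_derivBound_symbolProduct B hM hm N
  obtain ⟨A, hA⟩ := hΦ N'
  obtain ⟨A', hA'⟩ := hψ N'
  exact ⟨_, h A A' Φ ψ hA hA'⟩

lemma symbolProduct_add_left {M : Phase d × Phase d → ℝ} {m : Phase d → ℝ}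
    (hM : IsTempered M) (hm : IsTempered m) {Φ Φ' : Phase d × Phase d → ℂ} {ψ : Phase d → ℂ}
    (hΦ : IsSymbol M Φ) (hΦ' : IsSymbol M Φ') (hψ : IsSymbol m ψ) (X : Phase d) :
    symbolProduct B (fun Y => Φ Y + Φ' Y) ψ X =
      symbolProduct B Φ ψ X + symbolProduct B Φ' ψ X := by
  have h1 : amplitude (fun Y => Φ Y + Φ' Y) ψ = fun z => amplitude Φ ψ z + amplitude Φ' ψ z := by
    ext z; simp only [amplitude]; ring
  have hW := isTempered_amplitude hM hm
  rw [symbolProduct, h1, oscIntegral_add exists_norm_le_triplePairing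
    exists_norm_le_triplePairing_flip (exists_derivBound_fluxPhase B) hW hW
    (isSymbol_amplitude hΦ hψ) (isSymbol_amplitude hΦ' hψ), mul_add]
  rfl

lemma symbolProduct_add_right {M : Phase d × Phase d → ℝ} {m : Phase d → ℝ}
    (hM : IsTempered M) (hm : IsTempered m) {Φ : Phase d × Phase d → ℂ} {ψ ψ' : Phase d → ℂ}
    (hΦ : IsSymbol M Φ) (hψ : IsSymbol m ψ) (hψ' : IsSymbol m ψ') (X : Phase d) :
    symbolProduct B Φ (fun Y => ψ Y + ψ' Y) X =
      symbolProduct B Φ ψ X + symbolProduct B Φ ψ' X := by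
  have h1 : amplitude Φ (fun Y => ψ Y + ψ' Y) = fun z => amplitude Φ ψ z + amplitude Φ ψ' z := by
    ext z; simp only [amplitude]; ring
  have hW := isTempered_amplitude hM hm
  rw [symbolProduct, h1, oscIntegral_add exists_norm_le_triplePairing
    exists_norm_le_triplePairing_flip (exists_derivBound_fluxPhase B) hW hW
    (isSymbol_amplitude hΦ hψ) (isSymbol_amplitude hΦ hψ'), mul_add]
  rfl

lemma symbolProduct_const_mul_left (c : ℂ) (Φ : Phase d × Phase d → ℂ) (ψ : Phase d → ℂ)
    (X : Phase d) : symbolProduct B (fun Y => c * Φ Y) ψ X = c * symbolProduct B Φ ψ X := by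
  have h1 : amplitude (fun Y => c * Φ Y) ψ = fun z => c * amplitude Φ ψ z := by
    ext z; simp only [amplitude]; ring
  rw [symbolProduct, h1, oscIntegral_const_mul, symbolProduct]
  ring

lemma symbolProduct_const_mul_right (c : ℂ) (Φ : Phase d × Phase d → ℂ) (ψ : Phase d → ℂ)
    (X : Phase d) : symbolProduct B Φ (fun Y => c * ψ Y) X = c * symbolProduct B Φ ψ X := by
  have h1 : amplitude Φ (fun Y => c * ψ Y) = fun z => c * amplitude Φ ψ z := by
    ext z; simp only [amplitude]; ring
  rw [symbolProduct, h1, oscIntegral_const_mul, symbolProduct]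
  ring

end Symbol

/-! ### The product of Schwartz functions -/

section SchwartzProduct
variable {d : ℕ} (B : MagneticField d)

/-- The three momenta `ξ + η_j` control `η`, so that the amplitude of Schwartz functions is integrable
in `η`. -/
lemma amplitude_decay_le (l : ℕ) (X : Phase d) (t η : TripleSpace d) :
    amplitude (decay l) (decay l) ((X, t), η) ≤ (1 + ‖X‖) ^ l * decay l η := by
  set z := ((X, t), η)
  set P := (leftPoint d z, rightPoint d z)
  set Q := midPoint d z
  have hX : ‖X.2‖ ≤ ‖X‖ := norm_snd_le X
  have e : ∀ u v : Pos d, ‖v‖ ≤ ‖u‖ + ‖u + v‖ := fun u v => by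
    have := norm_add_le (-u) (u + v)
    rwa [neg_add_cancel_left, norm_neg] at this
  have h1 : ‖η.1.1‖ ≤ ‖X‖ + ‖P‖ := (e X.2 _).trans (add_le_add hX
    ((norm_snd_le (leftPoint d z)).trans (norm_fst_le P)))
  have h2 : ‖η.1.2‖ ≤ ‖X‖ + ‖P‖ := (e X.2 _).trans (add_le_add hX
    ((norm_snd_le (rightPoint d z)).trans (norm_snd_le P)))
  have h3 : ‖η.2‖ ≤ ‖X‖ + ‖Q‖ := (e X.2 _).trans (add_le_add hX (norm_snd_le Q))
  have a1 := norm_nonneg X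
  have a2 := norm_nonneg P
  have a3 := norm_nonneg Q
  have h4 : 1 + ‖η‖ ≤ (1 + ‖X‖) * ((1 + ‖P‖) * (1 + ‖Q‖)) := by
    have : ‖η‖ ≤ ‖X‖ + ‖P‖ + ‖Q‖ := by
      rw [Prod.norm_def, Prod.norm_def]
      exact max_le (max_le (by linarith) (by linarith)) (by linarith)
    nlinarith [mul_nonneg a1 a2, mul_nonneg a1 a3, mul_nonneg a2 a3,
      mul_nonneg a1 (mul_nonneg a2 a3)]
  have h5 : (1 + ‖η‖) ^ l ≤ (1 + ‖X‖) ^ l * ((1 + ‖P‖) ^ l * (1 + ‖Q‖) ^ l) := by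
    rw [← mul_pow, ← mul_pow]
    gcongr
  change decay l P * decay l Q ≤ _
  unfold decay
  rw [← mul_inv, ← div_eq_mul_inv, inv_eq_one_div, div_le_div_iff₀ (by positivity) (by positivity),
    one_mul]
  exact h5

/-- For Schwartz functions the integral over the momenta `η` factorises into the integrals that define
`K^A Φ` and `k^A ψ`, and the flux supplies their phases together with that of the segment from `x_R`
to `x_L`. -/
lemma integral_phase_mul_amplitude (Φ : 𝓢(Phase d × Phase d, ℂ)) (ψ : 𝓢(Phase d, ℂ))
    (X : Phase d) (t : TripleSpace d) :
    ((2 * π : ℂ) ^ (3 * d))⁻¹ * (phase (flux B (X, t)) *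
      ∫ η, phase (triplePairing d t η) * amplitude Φ ψ ((X, t), η)) =
    phase (-⟪X.2, sepMap d t⟫_ℝ) *
      phase (-B.circulation (vertexXL d (X, t)) (vertexXR d (X, t))) *
      (superWeylTransform B Φ ((vertexXL d (X, t), vertexXR d (X, t)),
        (vertexYL d (X, t), vertexYR d (X, t))) *
        weylTransform B ψ (vertexYL d (X, t), vertexYR d (X, t))) := by
  obtain ⟨x, ξ⟩ := X
  obtain ⟨⟨a, b⟩, w⟩ := t
  set XL := vertexXL d ((x, ξ), ((a, b), w)) with hXL
  set XR := vertexXR d ((x, ξ), ((a, b), w)) with hXR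
  set YL := vertexYL d ((x, ξ), ((a, b), w)) with hYL
  set YR := vertexYR d ((x, ξ), ((a, b), w)) with hYR
  have eXL : XL = x + (2⁻¹ : ℝ) • (w + a - b) := rfl
  have eXR : XR = x - (2⁻¹ : ℝ) • (w + a - b) := rfl
  have eYL : YL = XL - a := rfl
  have eYR : YR = XR - b := rfl
  let f : Phase d → ℂ := fun p => phase (⟪p.1, a⟫_ℝ - ⟪p.2, b⟫_ℝ) *
    Φ (((2⁻¹ : ℝ) • (XL + YL), p.1), ((2⁻¹ : ℝ) • (XR + YR), p.2))
  let g : Pos d → ℂ := fun η => phase ⟪η, w⟫_ℝ * ψ ((2⁻¹ : ℝ) • (YL + YR), η)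
  have h1 : superWeylTransform B Φ ((XL, XR), (YL, YR)) = ((2 * π : ℂ) ^ (2 * d))⁻¹ *
      (phase (B.circulation XL YL - B.circulation XR YR) * ∫ p, f p) := by
    rw [superWeylTransform_apply,
      ← integral_const_mul (phase (B.circulation XL YL - B.circulation XR YR))]
    congr 1
    refine integral_congr_ae (.of_forall fun p => ?_)
    have e1 : XL - YL = a := by rw [eYL]; module
    have e2 : XR - YR = b := by rw [eYR]; module
    simp only [f, e1, e2, phase]
    ring
  have h2 : weylTransform B ψ (YL, YR) = ((2 * π : ℂ) ^ d)⁻¹ *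
      (phase (B.circulation YL YR) * ∫ η, g η) := by
    rw [weylTransform_apply, ← integral_const_mul (phase (B.circulation YL YR))]
    congr 1
    refine integral_congr_ae (.of_forall fun η => ?_)
    have e1 : YL - YR = w := by rw [eYL, eYR, eXL, eXR]; module
    simp only [g, e1, phase]
    ring
  have h3 : ∫ η : TripleSpace d, phase (triplePairing d ((a, b), w) η) *
      amplitude Φ ψ (((x, ξ), ((a, b), w)), η) =
      phase (-⟪ξ, w + a - b⟫_ℝ) * ((∫ p, f p) * ∫ η, g η) := by
    rw [← integral_add_right_eq_self f (ξ, ξ), ← integral_add_right_eq_self g ξ,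
      ← integral_prod_mul, ← integral_const_mul]
    refine integral_congr_ae (.of_forall fun η => ?_)
    have e1 : (2⁻¹ : ℝ) • (XL + YL) = x + (2⁻¹ : ℝ) • (w - b) := by rw [eYL, eXL]; module
    have e2 : (2⁻¹ : ℝ) • (XR + YR) = x - (2⁻¹ : ℝ) • (w + a) := by rw [eYR, eXR]; module
    have e3 : (2⁻¹ : ℝ) • (YL + YR) = x - (2⁻¹ : ℝ) • (a + b) := by
      rw [eYL, eYR, eXL, eXR]; module
    have e4 : amplitude Φ ψ (((x, ξ), ((a, b), w)), η) =
        Φ ((x + (2⁻¹ : ℝ) • (w - b), ξ + η.1.1), (x - (2⁻¹ : ℝ) • (w + a), ξ + η.1.2)) *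
          ψ (x - (2⁻¹ : ℝ) • (a + b), ξ + η.2) := rfl
    have e5 : phase (triplePairing d ((a, b), w) η) = phase (-⟪ξ, w + a - b⟫_ℝ) *
        (phase (⟪ξ + η.1.1, a⟫_ℝ - ⟪ξ + η.1.2, b⟫_ℝ) * phase ⟪ξ + η.2, w⟫_ℝ) := by
      rw [← phase_add, ← phase_add, triplePairing_apply]
      congr 1
      simp only [inner_add_left, inner_add_right, inner_sub_right]
      rw [real_inner_comm a η.1.1, real_inner_comm b η.1.2, real_inner_comm w η.2]
      ring
    simp only [f, g, Prod.fst_add, Prod.snd_add]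
    rw [e1, e2, e3, e4, e5, add_comm η.1.1, add_comm η.1.2, add_comm η.2]
    ring
  have h4 : phase (flux B ((x, ξ), ((a, b), w))) =
      phase (B.circulation XL YL - B.circulation XR YR) * phase (B.circulation YL YR) *
        phase (-B.circulation XL XR) := by
    rw [← phase_add, ← phase_add]; rfl
  have h5 : ((2 * π : ℂ) ^ (3 * d))⁻¹ = ((2 * π : ℂ) ^ (2 * d))⁻¹ * ((2 * π : ℂ) ^ d)⁻¹ := by
    rw [← mul_inv, ← pow_add]; congr 2; ring
  rw [h1, h2, h3, h4, h5]
  have h6 : sepMap d ((a, b), w) = w + a - b := rfl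
  rw [h6]
  ring

/-- On Schwartz functions, the semi-super product is a position space integral of the kernels. -/
lemma symbolProduct_schwartz (Φ : 𝓢(Phase d × Phase d, ℂ)) (ψ : 𝓢(Phase d, ℂ)) (X : Phase d) :
    symbolProduct B Φ ψ X = ∫ t, phase (-⟪X.2, sepMap d t⟫_ℝ) *
      phase (-B.circulation (vertexXL d (X, t)) (vertexXR d (X, t))) *
      (superWeylTransform B Φ ((vertexXL d (X, t), vertexXR d (X, t)),
        (vertexYL d (X, t), vertexYR d (X, t))) *
        weylTransform B ψ (vertexYL d (X, t), vertexYR d (X, t))) := by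
  simp_rw [← integral_phase_mul_amplitude]
  rw [symbolProduct, oscIntegral_eq_integral exists_norm_le_triplePairing
    (exists_derivBound_fluxPhase B)
    (isTempered_amplitude (isTempered_decay _) (isTempered_decay _))
    (isSymbol_amplitude (isSymbol_schwartz Φ (decayOrder (TripleSpace d)))
      (isSymbol_schwartz ψ (decayOrder (TripleSpace d)))) X
    (amplitude_decay_le (decayOrder (TripleSpace d)) X), integral_const_mul]

end SchwartzProduct

section Kernels
variable {d : ℕ} (B : MagneticField d)

lemma momentumFourier_symm_apply {Z V : Type} [NormedAddCommGroup Z] [NormedSpace ℝ Z]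
    [NormedAddCommGroup V] [InnerProductSpace ℝ V] [FiniteDimensional ℝ V]
    [MeasurableSpace V] [BorelSpace V] (f : 𝓢(Z × V, ℂ)) (z : Z) (v : V) :
    momentumFourier.symm f (z, v) = ∫ ξ : V, phase (-⟪ξ, v⟫_ℝ) * f (z, ξ) := by
  have h : momentumFourier.symm f (z, v) = 𝓕 (slice z f) ((2 * π)⁻¹ • v) := rfl
  rw [h, fourier_coe, Real.fourier_eq']
  refine integral_congr_ae (.of_forall fun ξ => ?_)
  have h2 : -2 * π * ⟪ξ, (2 * π)⁻¹ • v⟫_ℝ = -⟪ξ, v⟫_ℝ := by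
    rw [real_inner_smul_right]
    have := Real.pi_ne_zero
    field_simp
  simp only [h2, smul_eq_mul, slice_apply, phase]

/-- The inverse transpose of `k^A` is, up to a constant, `k^A` followed by the exchange of the
variables of the kernel. -/
lemma weylTransformT_symm_apply (χ : 𝓢(Phase d, ℂ)) (x y : Pos d) :
    (weylTransformT B).symm χ (x, y) = phase (-B.circulation x y) *
      ∫ ξ, phase (-⟪ξ, x - y⟫_ℝ) * χ ((2⁻¹ : ℝ) • (x + y), ξ) := by
  rw [← momentumFourier_symm_apply]
  have h : (weylTransformT B).symm χ (x, y) =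
      smulLeftCLM ℂ (fun p : Phase d => Complex.exp (-(B.circulation p.1 p.2 * Complex.I)))
        (compEquiv (centerEquiv (Pos d)) (momentumFourier.symm χ)) (x, y) := rfl
  rw [h, smulLeftCLM_apply_apply (phase_temperate' B.circulation_temperate)]
  simp only [phase, Complex.ofReal_neg, neg_mul, smul_eq_mul]
  rfl

lemma weylTransformT_symm_eq (χ : 𝓢(Phase d, ℂ)) (x y : Pos d) :
    (weylTransformT B).symm χ (x, y) = (2 * π : ℂ) ^ d * weylTransform B χ (y, x) := by
  rw [weylTransformT_symm_apply, weylTransform_apply, mul_inv_cancel_left₀, ← integral_const_mul]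
  · refine integral_congr_ae (.of_forall fun ξ => ?_)
    have h1 : -⟪ξ, x - y⟫_ℝ = ⟪ξ, y - x⟫_ℝ := by rw [← inner_neg_right, neg_sub]
    simp only [B.circulation_swap x y, h1, add_comm x y, phase]
    ring
  · have := Real.pi_ne_zero
    exact pow_ne_zero _ (by simp [this])

end Kernels

section Quadrilateral
variable {d : ℕ}

/-- The vertices `((x_L, x_R), (y_L, y_R))` of the quadrilateral with `(x_L + x_R) / 2 = x` and sides
`x_L - y_L = a`, `x_R - y_R = b` and `y_L - y_R = w`. -/
def quadrilateral (q : TripleSpace d × Pos d) : Phase d × Phase d :=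
  ((vertexXL d ((q.2, 0), q.1), vertexXR d ((q.2, 0), q.1)),
    (vertexYL d ((q.2, 0), q.1), vertexYR d ((q.2, 0), q.1)))

lemma measurePreserving_quadrilateral :
    MeasurePreserving (quadrilateral (d := d)) volume volume := by
  have h1 := measurePreserving_prodAssoc (volume : Measure (Phase d)) (volume : Measure (Pos d))
    (volume : Measure (Pos d))
  have hc : MeasurePreserving (centerEquiv (Pos d)).symm (volume : Measure (Phase d)) volume :=
    MeasurePreserving.symm (centerEquiv (Pos d)).toHomeomorph.toMeasurableEquiv
      measurePreserving_centerEquiv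
  have h2 : MeasurePreserving (fun p : Phase d × Phase d =>
      (p.1, (centerEquiv (Pos d)).symm (p.2.2, p.2.1 + (p.1.1 - p.1.2)))) volume volume := by
    refine (MeasurePreserving.id (volume : Measure (Phase d))).skew_product
      (μc := (volume : Measure (Phase d))) (μd := (volume : Measure (Phase d)))
      (g := fun ab r => (centerEquiv (Pos d)).symm (r.2, r.1 + (ab.1 - ab.2))) ?_
      (.of_forall fun ab => ?_)
    · have hcont := (centerEquiv (Pos d)).symm.continuous
      exact Continuous.measurable (by fun_prop)
    · have h3 : MeasurePreserving (fun r : Phase d => (r.1, r.2 + (ab.1 - ab.2))) volume volume :=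
        (MeasurePreserving.id (volume : Measure (Pos d))).prod
          (measurePreserving_add_right volume (ab.1 - ab.2))
      exact (hc.comp (h3.comp Measure.measurePreserving_swap)).map_eq
  have h3 : MeasurePreserving (Prod.swap : Phase d × Phase d → Phase d × Phase d) volume volume :=
    Measure.measurePreserving_swap
  have h4 : MeasurePreserving (fun p : Phase d × Phase d => (p.1, p.1 - p.2)) volume volume :=
    (MeasurePreserving.id (volume : Measure (Phase d))).skew_product
      (μc := (volume : Measure (Phase d))) (μd := (volume : Measure (Phase d)))
      (g := fun p q => p - q) (by fun_prop)
      (.of_forall fun p => ((Measure.measurePreserving_sub_left (volume : Measure (Pos d)) p.1).prod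
        (Measure.measurePreserving_sub_left (volume : Measure (Pos d)) p.2)).map_eq)
  have h5 := h4.comp (h3.comp (h2.comp h1))
  have h6 : quadrilateral (d := d) = fun q : TripleSpace d × Pos d =>
      (((centerEquiv (Pos d)).symm (q.2, q.1.2 + (q.1.1.1 - q.1.1.2))),
        (centerEquiv (Pos d)).symm (q.2, q.1.2 + (q.1.1.1 - q.1.1.2)) - q.1.1) := by
    ext1 q
    have e : q.1.2 + (q.1.1.1 - q.1.1.2) = sepMap d q.1 := by
      change _ = q.1.2 + q.1.1.1 - q.1.1.2
      abel
    rw [e]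
    rfl
  rw [h6]
  exact h5

lemma norm_le_norm_quadrilateral (q : TripleSpace d × Pos d) : ‖q.1‖ ≤ 2 * ‖quadrilateral q‖ := by
  set p := quadrilateral q with hp
  have h1 : q.1.1.1 = p.1.1 - p.2.1 := by simp [hp, quadrilateral, vertexYL, tripleA]
  have h2 : q.1.1.2 = p.1.2 - p.2.2 := by simp [hp, quadrilateral, vertexYR, tripleB]
  have h3 : q.1.2 = p.2.1 - p.2.2 := by
    simp [hp, quadrilateral, vertexYL, vertexYR, vertexXL, vertexXR, sepMap, tripleA, tripleB,
      tripleW]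
    module
  have a1 : ‖p.1.1‖ ≤ ‖p‖ := (norm_fst_le _).trans (norm_fst_le _)
  have a2 : ‖p.1.2‖ ≤ ‖p‖ := (norm_snd_le _).trans (norm_fst_le _)
  have a3 : ‖p.2.1‖ ≤ ‖p‖ := (norm_fst_le _).trans (norm_snd_le _)
  have a4 : ‖p.2.2‖ ≤ ‖p‖ := (norm_snd_le _).trans (norm_snd_le _)
  rw [Prod.norm_def, Prod.norm_def, h1, h2, h3]
  refine max_le (max_le ?_ ?_) ?_ <;> refine (norm_sub_le _ _).trans ?_ <;> linarith

end Quadrilateral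

section SchwartzDuality
variable {d : ℕ} (B : MagneticField d)

/-- The integrand of the pairing of `Int(K^A Φ) k^A ψ` with the transformed test function. -/
def kernelPairing (Φ : 𝓢(Phase d × Phase d, ℂ)) (ψ χ : 𝓢(Phase d, ℂ)) (p : Phase d × Phase d) : ℂ :=
  superWeylTransform B Φ p * ((weylTransformT B).symm χ p.1 * weylTransform B ψ p.2)

lemma integrable_kernelPairing (Φ : 𝓢(Phase d × Phase d, ℂ)) (ψ χ : 𝓢(Phase d, ℂ)) :
    Integrable (kernelPairing B Φ ψ χ) :=
  (SchwartzMap.pairing (ContinuousLinearMap.mul ℂ ℂ) (superWeylTransform B Φ)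
    (tensorRight (weylTransform B ψ) ((weylTransformT B).symm χ))).integrable

/-- The integrand of the kernel formula for the semi-super product, paired with `χ`. -/
def pairingIntegrand (Φ : 𝓢(Phase d × Phase d, ℂ)) (ψ χ : 𝓢(Phase d, ℂ))
    (z : Phase d × TripleSpace d) : ℂ :=
  phase (-⟪z.1.2, sepMap d z.2⟫_ℝ) *
    phase (-B.circulation (vertexXL d z) (vertexXR d z)) *
    (superWeylTransform B Φ ((vertexXL d z, vertexXR d z), (vertexYL d z, vertexYR d z)) *
      weylTransform B ψ (vertexYL d z, vertexYR d z)) * χ z.1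

lemma exists_norm_pairingIntegrand_le (Φ : 𝓢(Phase d × Phase d, ℂ)) (ψ χ : 𝓢(Phase d, ℂ)) :
    ∃ C, ∀ z, ‖pairingIntegrand B Φ ψ χ z‖ ≤ C * (‖χ z.1‖ * decay (decayOrder (TripleSpace d)) z.2) := by
  set l := decayOrder (TripleSpace d)
  have h1 := derivBound_schwartz (superWeylTransform B Φ) l 0
  have h2 := derivBound_schwartz (weylTransform B ψ) 0 0
  set C1 := 2 ^ l * (Finset.Iic (l, 0)).sup (schwartzSeminormFamily ℂ (Phase d × Phase d) ℂ)
    (superWeylTransform B Φ)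
  set C2 := 2 ^ 0 * (Finset.Iic (0, 0)).sup (schwartzSeminormFamily ℂ (Phase d) ℂ)
    (weylTransform B ψ)
  have n1 := h1.nonneg
  have n2 := h2.nonneg
  refine ⟨C1 * 2 ^ l * C2, fun z => ?_⟩
  have h3 := h1.norm_le (quadrilateral (z.2, z.1.1))
  have h4 := h2.norm_le (vertexYL d z, vertexYR d z)
  rw [decay_zero, mul_one] at h4
  have h5 := decay_le_of_norm_le l one_le_two (norm_le_norm_quadrilateral (z.2, z.1.1))
  have h6 := decay_pos l z.2
  rw [pairingIntegrand, norm_mul, norm_mul, norm_mul, norm_mul, norm_phase, norm_phase, one_mul,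
    one_mul]
  calc _ ≤ C1 * (2 ^ l * decay l z.2) * C2 * ‖χ z.1‖ := by
        refine mul_le_mul_of_nonneg_right (mul_le_mul ?_ h4 (norm_nonneg _) (by positivity))
          (norm_nonneg _)
        exact h3.trans (mul_le_mul_of_nonneg_left h5 n1)
    _ = _ := by ring

lemma continuous_pairingIntegrand (Φ : 𝓢(Phase d × Phase d, ℂ)) (ψ χ : 𝓢(Phase d, ℂ)) :
    Continuous (pairingIntegrand B Φ ψ χ) := by
  have h1 : Continuous fun z : Phase d × TripleSpace d =>
      B.circulation (vertexXL d z) (vertexXR d z) :=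
    B.circulation_temperate.1.continuous.comp (f := fun z => (vertexXL d z, vertexXR d z))
      (by fun_prop)
  have h2 := (superWeylTransform B Φ).continuous
  have h3 := (weylTransform B ψ).continuous
  have h4 := χ.continuous
  have h5 := continuous_phase
  unfold pairingIntegrand
  fun_prop

/-- The integral in `ξ` is the one that defines the transformed test function. -/
lemma integral_pairingIntegrand (Φ : 𝓢(Phase d × Phase d, ℂ)) (ψ χ : 𝓢(Phase d, ℂ))
    (t : TripleSpace d) :
    ∫ X, pairingIntegrand B Φ ψ χ (X, t) = ∫ x, kernelPairing B Φ ψ χ (quadrilateral (t, x)) := by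
  obtain ⟨C, hC⟩ := exists_norm_pairingIntegrand_le B Φ ψ χ
  have hi : Integrable (fun X => pairingIntegrand B Φ ψ χ (X, t)) (volume.prod volume) := by
    have hχ : Integrable (fun X => ‖χ X‖) (volume : Measure (Phase d)) := χ.integrable.norm
    refine (hχ.const_mul (C * decay (decayOrder (TripleSpace d)) t)).mono'
      ((continuous_pairingIntegrand B Φ ψ χ).comp (by fun_prop)).aestronglyMeasurable
      (.of_forall fun X => (hC (X, t)).trans (le_of_eq (by ring)))
  refine (integral_prod _ hi).trans (integral_congr_ae (.of_forall fun x => ?_))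
  have e1 : vertexXL d ((x, 0), t) - vertexXR d ((x, 0), t) = sepMap d t := by
    simp [vertexXL, vertexXR]; module
  have e2 : (2⁻¹ : ℝ) • (vertexXL d ((x, 0), t) + vertexXR d ((x, 0), t)) = x := by
    have : posMap d ((x, 0), t) = x := rfl
    simp [vertexXL, vertexXR, this]; module
  have h1 := weylTransformT_symm_apply B χ (vertexXL d ((x, 0), t)) (vertexXR d ((x, 0), t))
  rw [e1, e2] at h1
  simp only [kernelPairing, quadrilateral]
  have h2 : ∀ y, pairingIntegrand B Φ ψ χ ((x, y), t) =
      phase (-⟪y, sepMap d t⟫_ℝ) *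
        phase (-B.circulation (vertexXL d ((x, 0), t)) (vertexXR d ((x, 0), t))) *
        (superWeylTransform B Φ ((vertexXL d ((x, 0), t), vertexXR d ((x, 0), t)),
          (vertexYL d ((x, 0), t), vertexYR d ((x, 0), t))) *
          weylTransform B ψ (vertexYL d ((x, 0), t), vertexYR d ((x, 0), t))) * χ (x, y) :=
    fun y => rfl
  simp_rw [h1, h2, mul_right_comm _ _ (χ _), integral_mul_const]
  ring

/-- The oscillatory integral computes the semi-super product of Schwartz functions: passing to the
vertices as integration variables yields the pairing of kernels. -/
lemma integral_symbolProduct_mul_schwartz (Φ : 𝓢(Phase d × Phase d, ℂ)) (ψ χ : 𝓢(Phase d, ℂ)) :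
    ∫ X, symbolProduct B Φ ψ X * χ X = ∫ p, kernelPairing B Φ ψ χ p := by
  obtain ⟨C, hC⟩ := exists_norm_pairingIntegrand_le B Φ ψ χ
  have hi : Integrable (pairingIntegrand B Φ ψ χ) (volume.prod volume) :=
    ((χ.integrable.norm.mul_prod (integrable_decay le_rfl)).const_mul C).mono'
      (continuous_pairingIntegrand B Φ ψ χ).aestronglyMeasurable (.of_forall hC)
  have hm := measurePreserving_quadrilateral (d := d)
  have hk := integrable_kernelPairing B Φ ψ χ
  have hk' := hm.integrable_comp_of_integrable hk
  have h1 : ∫ p, kernelPairing B Φ ψ χ p = ∫ q, kernelPairing B Φ ψ χ (quadrilateral q) := by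
    rw [← hm.map_eq, integral_map hm.aemeasurable (hm.map_eq ▸ hk.aestronglyMeasurable)]
  rw [h1]
  refine Eq.trans ?_ (integral_prod _ hk').symm
  simp_rw [Function.comp_apply, ← integral_pairingIntegrand]
  rw [integral_integral_swap (f := fun t X => pairingIntegrand B Φ ψ χ (X, t)) hi.swap]
  refine integral_congr_ae (.of_forall fun X => ?_)
  simp only [symbolProduct_schwartz, pairingIntegrand, integral_mul_const]

/-- Exchanging the arguments of the symbol reverses the order of the vertices in the kernel. -/
lemma superWeylTransform_swap (Φ : 𝓢(Phase d × Phase d, ℂ)) (xL xR yL yR : Pos d) :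
    superWeylTransform B (compEquiv (ContinuousLinearEquiv.prodComm ℝ (Phase d) (Phase d)) Φ)
      ((yR, yL), (xR, xL)) = superWeylTransform B Φ ((xL, xR), (yL, yR)) := by
  rw [superWeylTransform_apply, superWeylTransform_apply]
  congr 1
  have hm : MeasurePreserving (Prod.swap : Phase d → Phase d) volume volume :=
    Measure.measurePreserving_swap
  rw [← hm.integral_comp (Homeomorph.prodComm (Pos d) (Pos d)).measurableEmbedding]
  refine integral_congr_ae (.of_forall fun ξ => ?_)
  have h1 : ⟪ξ.2, yR - xR⟫_ℝ - ⟪ξ.1, yL - xL⟫_ℝ = ⟪ξ.1, xL - yL⟫_ℝ - ⟪ξ.2, xR - yR⟫_ℝ := by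
    simp only [inner_sub_right]; ring
  have h2 : B.circulation yR xR - B.circulation yL xL =
      B.circulation xL yL - B.circulation xR yR := by
    rw [B.circulation_swap xR yR, B.circulation_swap xL yL]; ring
  simp only [Prod.fst_swap, Prod.snd_swap, h1, h2, add_comm yR, add_comm yL]
  rfl

/-- On Schwartz functions, the transpose of the product with `Φ` is the product with `Φ` with exchanged
arguments: the pairing is an integral over quadrilaterals that is invariant under reversal. -/
lemma integral_symbolProduct_mul_comm_schwartz (Φ : 𝓢(Phase d × Phase d, ℂ))
    (ψ χ : 𝓢(Phase d, ℂ)) :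
    ∫ X, symbolProduct B Φ ψ X * χ X =
      ∫ X, symbolProduct B (fun p => Φ p.swap) χ X * ψ X := by
  have h0 : (fun p => Φ p.swap) =
    ⇑(compEquiv (ContinuousLinearEquiv.prodComm ℝ (Phase d) (Phase d)) Φ) := rfl
  rw [h0, integral_symbolProduct_mul_schwartz, integral_symbolProduct_mul_schwartz]
  have hs : MeasurePreserving (Prod.swap : Phase d → Phase d) volume volume :=
    Measure.measurePreserving_swap
  have hm : MeasurePreserving (fun p : Phase d × Phase d => (p.2.swap, p.1.swap))
      volume volume :=
    (Measure.measurePreserving_swap (μ := (volume : Measure (Phase d)))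
      (ν := (volume : Measure (Phase d)))).comp (hs.prod hs)
  let e : (Phase d × Phase d) ≃ₜ (Phase d × Phase d) :=
    ((Homeomorph.prodComm (Pos d) (Pos d)).prodCongr (Homeomorph.prodComm (Pos d) (Pos d))).trans
      (Homeomorph.prodComm (Phase d) (Phase d))
  rw [← hm.integral_comp e.measurableEmbedding]
  refine integral_congr_ae (.of_forall fun p => ?_)
  obtain ⟨⟨xL, xR⟩, ⟨yL, yR⟩⟩ := p
  simp only [kernelPairing, Prod.swap_prod_mk, superWeylTransform_swap, weylTransformT_symm_eq]
  ring

end SchwartzDuality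

/-! ### Approximation of symbols by Schwartz functions -/

section Cutoff
variable (E : Type) [NormedAddCommGroup E] [NormedSpace ℝ E] [FiniteDimensional ℝ E]

/-- A smooth compactly supported function with the value one at the origin. -/
def cutoff : 𝓢(E, ℂ) :=
  let b : ContDiffBump (0 : E) := ⟨1, 2, one_pos, one_lt_two⟩
  HasCompactSupport.toSchwartzMap (f := fun v : E => (b v : ℂ))
    (b.hasCompactSupport.comp_left Complex.ofReal_zero)
    (Complex.ofRealCLM.contDiff.comp b.contDiff)

lemma cutoff_zero : cutoff E 0 = 1 := by
  let b : ContDiffBump (0 : E) := ⟨1, 2, one_pos, one_lt_two⟩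
  have h : cutoff E 0 = (b 0 : ℂ) := rfl
  rw [h, b.one_of_mem_closedBall (by simp [b]), Complex.ofReal_one]

/-- As the cutoff is dilated, it tends to one in the topology of symbols with the weight
`1 + ‖x‖`. -/
lemma exists_derivBound_one_sub_cutoff (N : ℕ) : ∃ C : ℝ, 0 ≤ C ∧ ∀ ε : ℝ, 0 < ε → ε ≤ 1 →
    DerivBound (fun x : E => 1 + ‖x‖) N (ε * C) (fun x => 1 - cutoff E (ε • x)) := by
  have h := (derivBound_schwartz (cutoff E) 0 (N + 1)).fderiv
  set C := 2 ^ 0 * (Finset.Iic (0, N + 1)).sup (schwartzSeminormFamily ℂ E ℂ) (cutoff E)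
  have hC : 0 ≤ C := h.nonneg
  refine ⟨C, hC, fun ε hε hε1 => ?_⟩
  have hn : ∀ (F : Type) [NormedAddCommGroup F] [NormedSpace ℝ F],
      ‖ε • ContinuousLinearMap.id ℝ F‖ ≤ ε := fun F _ _ => by
    rw [norm_smul, Real.norm_of_nonneg hε.le]
    exact mul_le_of_le_one_right hε.le ContinuousLinearMap.norm_id_le
  have h1 := h.comp_clm (ε • ContinuousLinearMap.id ℝ E)
  have h2 := h1.clm_comp (-(ε • ContinuousLinearMap.id ℝ (E →L[ℝ] ℂ)))
  rw [max_eq_left ((hn E).trans hε1), one_pow, mul_one, norm_neg] at h2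
  have h3 := (h2.mono_const (fun x => (decay_pos _ _).le)
    (mul_le_mul_of_nonneg_right (hn (E →L[ℝ] ℂ)) hC)).mono_weight_one
    (W' := fun x : E => 1 + ‖x‖) (fun x => by rw [decay_zero]; linarith [norm_nonneg x])
  refine (DerivBound.of_hasFDerivAt (fun x => ?_) (fun x => ?_) h3).mono_order (Nat.le_succ N)
  · have hm := Convex.norm_image_sub_le_of_norm_fderiv_le (𝕜 := ℝ) (f := cutoff E) (C := C)
      (s := Set.univ) (x := ε • x) (y := 0) (fun y _ => ((cutoff E).hasFDerivAt y).differentiableAt)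
      (fun y _ => by simpa [decay_zero] using h.norm_le y) convex_univ trivial trivial
    rw [cutoff_zero, zero_sub, norm_neg, norm_smul, Real.norm_of_nonneg hε.le] at hm
    refine hm.trans ?_
    nlinarith [mul_nonneg hC hε.le]
  · have hd := ((cutoff E).hasFDerivAt (ε • x)).comp x
      ((hasFDerivAt_id x).const_smul ε)
    refine (hd.const_sub 1).congr_fderiv ?_
    ext v
    simp

end Cutoff

section Density
variable {E : Type} [NormedAddCommGroup E] [NormedSpace ℝ E] {W : E → ℝ}

lemma IsTempered.exists_le (hW : IsTempered W) :
    ∃ (k : ℕ) (C : ℝ), 0 < C ∧ ∀ x, W x ≤ C * (1 + ‖x‖) ^ k := by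
  obtain ⟨k, C, hC, h⟩ := hW.moderate
  exact ⟨k, C * W 0, mul_pos hC (hW.pos 0), fun x => by simpa using h 0 x⟩

lemma IsTempered.exists_decay_le (hW : IsTempered W) :
    ∃ (k : ℕ) (C : ℝ), 0 < C ∧ ∀ x, decay k x ≤ C * W x := by
  obtain ⟨k, C, hC, h⟩ := hW.inv.exists_le
  refine ⟨k, C, hC, fun x => ?_⟩
  have h1 := h x
  rw [inv_le_iff_one_le_mul₀ (hW.pos x)] at h1
  rw [decay, inv_le_iff_one_le_mul₀ (by positivity)]
  linarith

lemma IsTempered.mul_one_add_norm (hW : IsTempered W) : IsTempered (fun x => W x * (1 + ‖x‖)) := by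
  simpa using hW.mul (IsTempered.one_add_norm_pow 1)

lemma IsSymbol.hasTemperateGrowth (hW : IsTempered W) {f : E → ℂ} (hf : IsSymbol W f) :
    f.HasTemperateGrowth := by
  obtain ⟨k, C, hC, h⟩ := hW.exists_le
  refine ⟨hf.contDiff, fun n => ?_⟩
  obtain ⟨A, hA⟩ := hf n
  refine ⟨k, A * C, fun x => (hA.bound n le_rfl x).trans ?_⟩
  rw [mul_assoc]
  exact mul_le_mul_of_nonneg_left (h x) hA.nonneg

lemma isSymbol_schwartz_of_isTempered (hW : IsTempered W) (f : 𝓢(E, ℂ)) : IsSymbol W f := by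
  obtain ⟨k, C, hC, h⟩ := hW.exists_decay_le
  exact (isSymbol_schwartz f k).mono hC.le h

/-- An additive functional on symbols that is bounded by finitely many derivatives vanishes if it
vanishes on Schwartz functions. Schwartz functions are not dense in the symbols dominated by `W`,
but they approximate them if the weight is enlarged by a factor `1 + ‖x‖`. -/
theorem IsSymbol.eq_zero_of_schwartz [FiniteDimensional ℝ E] (hW : IsTempered W)
    {ℓ : (E → ℂ) → ℂ}
    (hadd : ∀ f g, IsSymbol (fun x => W x * (1 + ‖x‖)) f → IsSymbol (fun x => W x * (1 + ‖x‖)) g →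
      ℓ (fun x => f x + g x) = ℓ f + ℓ g)
    {N : ℕ} {C : ℝ} (hbd : ∀ A f, IsSymbol (fun x => W x * (1 + ‖x‖)) f →
      DerivBound (fun x => W x * (1 + ‖x‖)) N A f → ‖ℓ f‖ ≤ A * C)
    (h0 : ∀ f : 𝓢(E, ℂ), ℓ f = 0) {f : E → ℂ} (hf : IsSymbol W f) : ℓ f = 0 := by
  have hW' := hW.mul_one_add_norm
  obtain ⟨A, hA⟩ := hf N
  obtain ⟨D, hD, h⟩ := exists_derivBound_one_sub_cutoff E N
  have hA0 := hA.nonneg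
  have hC : 0 ≤ C := by
    have h1 := hbd 1 (fun _ => 0) ?_ ?_
    · rw [one_mul] at h1
      exact (norm_nonneg _).trans h1
    · exact isSymbol_schwartz_of_isTempered hW' (0 : 𝓢(E, ℂ))
    · refine ⟨zero_le_one, contDiff_const, fun n _ x => ?_⟩
      rw [iteratedFDeriv_fun_zero]
      simpa using (hW'.pos x).le
  have key : ∀ ε : ℝ, 0 < ε → ε ≤ 1 → ‖ℓ f‖ ≤ ε * (2 ^ N * A * D * C) := fun ε hε hε1 => by
    -- The product of `f` with a dilated cutoff is a Schwartz function close to `f`.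
    let γ : 𝓢(E, ℂ) := compEquiv (ContinuousLinearEquiv.smulLeft (Units.mk0 ε hε.ne')) (cutoff E)
    have hγ : ∀ x, γ x = cutoff E (ε • x) := fun x => rfl
    let f₁ : 𝓢(E, ℂ) := smulLeftCLM ℂ f γ
    have hf₁ : ∀ x, f₁ x = f x * cutoff E (ε • x) := fun x => by
      rw [smulLeftCLM_apply_apply (hf.hasTemperateGrowth hW), hγ, smul_eq_mul]
    have hs₁ := isSymbol_schwartz_of_isTempered hW' f₁
    have hs₂ : IsSymbol (fun x => W x * (1 + ‖x‖)) (fun x => f x * (1 - cutoff E (ε • x))) :=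
      fun N => by
        obtain ⟨A, hA⟩ := hf N
        obtain ⟨D, -, h⟩ := exists_derivBound_one_sub_cutoff E N
        exact ⟨_, hA.mul (h ε hε hε1)⟩
    have h2 := hbd _ _ hs₂ (hA.mul (h ε hε hε1))
    have h3 : f = fun x => f₁ x + f x * (1 - cutoff E (ε • x)) := by
      ext x; rw [hf₁]; ring
    rw [h3, hadd _ _ hs₁ hs₂, h0, zero_add]
    refine h2.trans (le_of_eq ?_)
    ring
  have h1 : ‖ℓ f‖ ≤ 0 := by
    refine le_of_forall_pos_le_add fun δ hδ => ?_
    set K := 2 ^ N * A * D * C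
    have hK : 0 ≤ K := by positivity
    have h2 := key (min 1 (δ / (K + 1))) (by positivity) (min_le_left _ _)
    have h3 : min 1 (δ / (K + 1)) * K ≤ δ := by
      calc min 1 (δ / (K + 1)) * K ≤ δ / (K + 1) * (K + 1) := by
            gcongr
            · exact min_le_right _ _
            · linarith
        _ = δ := by field_simp
    linarith
  exact norm_le_zero_iff.1 h1

variable [FiniteDimensional ℝ E] [MeasureSpace E] [BorelSpace E]
  [(volume : Measure E).IsAddHaarMeasure]

/-- Pairing with a fixed Schwartz function is bounded by the weighted supremum norm. -/
lemma exists_norm_integral_mul_schwartz_le (hW : IsTempered W) (χ : 𝓢(E, ℂ)) : ∃ C : ℝ, 0 ≤ C ∧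
    ∀ A (f : E → ℂ), DerivBound W 0 A f →
      Integrable (fun x => f x * χ x) ∧ ‖∫ x, f x * χ x‖ ≤ A * C := by
  obtain ⟨k, C, hC, h⟩ := hW.exists_le
  have h1 := derivBound_schwartz χ (decayOrder E + k) 0
  set D := 2 ^ (decayOrder E + k) *
    (Finset.Iic (decayOrder E + k, 0)).sup (schwartzSeminormFamily ℂ E ℂ) χ
  have hD : 0 ≤ D := h1.nonneg
  have hI : 0 ≤ ∫ x : E, decay (decayOrder E) x := integral_nonneg fun x => (decay_pos _ x).le
  refine ⟨C * D * ∫ x : E, decay (decayOrder E) x, by positivity, fun A f hf => ?_⟩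
  have hb : ∀ x, ‖f x * χ x‖ ≤ A * (C * D) * decay (decayOrder E) x := fun x => by
    rw [norm_mul]
    calc ‖f x‖ * ‖χ x‖ ≤ (A * (C * (1 + ‖x‖) ^ k)) * (D * decay (decayOrder E + k) x) :=
          mul_le_mul ((hf.norm_le x).trans (mul_le_mul_of_nonneg_left (h x) hf.nonneg))
            (h1.norm_le x) (norm_nonneg _) (by have := hf.nonneg; positivity)
      _ = A * (C * D) * ((1 + ‖x‖) ^ k * decay (decayOrder E + k) x) := by ring
      _ = _ := by rw [one_add_norm_pow_mul_decay]
  refine ⟨integrable_of_decay le_rfl (hf.contDiff.continuous.mul χ.continuous) hb, ?_⟩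
  refine (norm_integral_le_of_norm_le ((integrable_decay le_rfl).const_mul _)
    (.of_forall hb)).trans (le_of_eq ?_)
  rw [integral_const_mul]
  ring

end Density

/-! ### Duality for symbols -/

section Transpose
variable {d : ℕ} (B : MagneticField d) {M : Phase d × Phase d → ℝ} {m : Phase d → ℝ}
  {Φ : Phase d × Phase d → ℂ} {ψ : Phase d → ℂ}

lemma IsTempered.comp_swap (hM : IsTempered M) : IsTempered (fun p : Phase d × Phase d => M p.swap) :=
  hM.comp_clm (ContinuousLinearEquiv.prodComm ℝ (Phase d) (Phase d) :
    Phase d × Phase d →L[ℝ] Phase d × Phase d)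

lemma IsSymbol.comp_swap (hΦ : IsSymbol M Φ) : IsSymbol (fun p : Phase d × Phase d => M p.swap)
    (fun p : Phase d × Phase d => Φ p.swap) :=
  hΦ.comp_clm (ContinuousLinearEquiv.prodComm ℝ (Phase d) (Phase d) :
    Phase d × Phase d →L[ℝ] Phase d × Phase d)

lemma exists_derivBound_comp_swap (N : ℕ) : ∃ C, 0 ≤ C ∧
    ∀ (M : Phase d × Phase d → ℝ) (A : ℝ) (Φ : Phase d × Phase d → ℂ), DerivBound M N A Φ →
      DerivBound (fun p : Phase d × Phase d => M p.swap) N (A * C) (fun p : Phase d × Phase d => Φ p.swap) := by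
  let s : Phase d × Phase d →L[ℝ] Phase d × Phase d :=
    ContinuousLinearEquiv.prodComm ℝ (Phase d) (Phase d)
  exact ⟨max 1 ‖s‖ ^ N, by positivity, fun M A Φ h => h.comp_clm s⟩

lemma isTempered_diag (hM : IsTempered M) (hm : IsTempered m) :
    IsTempered (fun X => M (X, X) * m X) :=
  (hM.comp_clm ((ContinuousLinearMap.id ℝ (Phase d)).prod
    (ContinuousLinearMap.id ℝ (Phase d)))).mul hm

lemma exists_norm_integral_symbolProduct_le (hM : IsTempered M) (hm : IsTempered m)
    (χ : 𝓢(Phase d, ℂ)) : ∃ (N : ℕ) (C : ℝ), 0 ≤ C ∧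
      ∀ (A A' : ℝ) (Φ : Phase d × Phase d → ℂ) (ψ : Phase d → ℂ),
        DerivBound M N A Φ → DerivBound m N A' ψ →
        ‖∫ X, symbolProduct B Φ ψ X * χ X‖ ≤ A * A' * C := by
  obtain ⟨N, C, hC, h⟩ := exists_derivBound_symbolProduct B hM hm 0
  obtain ⟨D, hD, h'⟩ := exists_norm_integral_mul_schwartz_le (isTempered_diag hM hm) χ
  refine ⟨N, C * D, by positivity, fun A A' Φ ψ hΦ hψ => ?_⟩
  have := (h' _ _ (h A A' Φ ψ hΦ hψ)).2
  rwa [mul_assoc] at this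

lemma integrable_symbolProduct_mul (hM : IsTempered M) (hm : IsTempered m) (hΦ : IsSymbol M Φ)
    (hψ : IsSymbol m ψ) (χ : 𝓢(Phase d, ℂ)) :
    Integrable (fun X => symbolProduct B Φ ψ X * χ X) := by
  obtain ⟨D, hD, h'⟩ := exists_norm_integral_mul_schwartz_le (isTempered_diag hM hm) χ
  obtain ⟨A, hA⟩ := isSymbol_symbolProduct B hM hm hΦ hψ 0
  exact (h' _ _ hA).1

lemma integral_symbolProduct_add_left (hM : IsTempered M) (hm : IsTempered m)
    {Φ' : Phase d × Phase d → ℂ} (hΦ : IsSymbol M Φ) (hΦ' : IsSymbol M Φ') (hψ : IsSymbol m ψ)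
    (χ : 𝓢(Phase d, ℂ)) : ∫ X, symbolProduct B (fun p => Φ p + Φ' p) ψ X * χ X =
      (∫ X, symbolProduct B Φ ψ X * χ X) + ∫ X, symbolProduct B Φ' ψ X * χ X := by
  rw [← integral_add (integrable_symbolProduct_mul B hM hm hΦ hψ χ)
    (integrable_symbolProduct_mul B hM hm hΦ' hψ χ)]
  simp_rw [symbolProduct_add_left B hM hm hΦ hΦ' hψ, add_mul]

lemma integral_symbolProduct_add_right (hM : IsTempered M) (hm : IsTempered m)
    {ψ' : Phase d → ℂ} (hΦ : IsSymbol M Φ) (hψ : IsSymbol m ψ) (hψ' : IsSymbol m ψ')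
    (χ : 𝓢(Phase d, ℂ)) : ∫ X, symbolProduct B Φ (fun Y => ψ Y + ψ' Y) X * χ X =
      (∫ X, symbolProduct B Φ ψ X * χ X) + ∫ X, symbolProduct B Φ ψ' X * χ X := by
  rw [← integral_add (integrable_symbolProduct_mul B hM hm hΦ hψ χ)
    (integrable_symbolProduct_mul B hM hm hΦ hψ' χ)]
  simp_rw [symbolProduct_add_right B hM hm hΦ hψ hψ', add_mul]

/-- The test function against which `Φ` is integrated in `⟨Φ • ψ, χ⟩`. -/
def kernelTest (ψ χ : 𝓢(Phase d, ℂ)) : 𝓢(Phase d × Phase d, ℂ) :=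
  superWeylTransformT B (tensorRight (weylTransform B ψ) ((weylTransformT B).symm χ))

lemma semiSuperProduct_apply (u : 𝓢'(Phase d × Phase d, ℂ)) (ψ χ : 𝓢(Phase d, ℂ)) :
    semiSuperProduct B u ψ χ = u (kernelTest B ψ χ) := rfl

/-- For a symbol `Φ` and Schwartz functions, the oscillatory integral represents the semi-super
product defined by duality. -/
lemma integral_symbolProduct_mul (hM : IsTempered M) (hΦ : IsSymbol M Φ) (ψ χ : 𝓢(Phase d, ℂ)) :
    ∫ X, symbolProduct B Φ ψ X * χ X = ∫ p, Φ p * kernelTest B ψ χ p := by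
  have hM' := hM.mul_one_add_norm
  have hm : IsTempered (decay 0 : Phase d → ℝ) := isTempered_decay 0
  have hψ := isSymbol_schwartz ψ 0
  obtain ⟨N, C, hC, h⟩ := exists_norm_integral_symbolProduct_le B hM' hm χ
  obtain ⟨A', hA'⟩ := hψ N
  obtain ⟨D, hD, h'⟩ := exists_norm_integral_mul_schwartz_le hM' (kernelTest B ψ χ)
  rw [← sub_eq_zero]
  refine IsSymbol.eq_zero_of_schwartz hM (N := N) (C := A' * C + D)
    (ℓ := fun Φ => (∫ X, symbolProduct B Φ ψ X * χ X) - ∫ p, Φ p * kernelTest B ψ χ p)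
    (fun f g hf hg => ?_) (fun A f _ hf => ?_) (fun f => ?_) hΦ
  · obtain ⟨a, ha⟩ := hf 0
    obtain ⟨b, hb⟩ := hg 0
    simp_rw [add_mul]
    rw [integral_symbolProduct_add_left B hM' hm hf hg hψ, integral_add (h' _ _ ha).1 (h' _ _ hb).1]
    ring
  · refine (norm_sub_le _ _).trans ?_
    have h1 := h _ _ _ _ hf hA'
    have h2 := (h' _ _ (hf.mono_order (Nat.zero_le N))).2
    linarith
  · rw [sub_eq_zero]
    exact (integral_symbolProduct_mul_schwartz B f ψ χ).trans (integral_superWeylTransform_mul B f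
      (tensorRight (weylTransform B ψ) ((weylTransformT B).symm χ)))

/-- The semi-super product with a symbol `Φ`, as an operator on Schwartz space. -/
def schwartzProduct (hM : IsTempered M) (hΦ : IsSymbol M Φ) : 𝓢(Phase d, ℂ) →L[ℂ] 𝓢(Phase d, ℂ) :=
  mkCLM (fun ψ => symbolProduct B Φ ψ)
    (fun ψ ψ' X => symbolProduct_add_right B hM (isTempered_decay 0) hΦ (isSymbol_schwartz ψ 0)
      (isSymbol_schwartz ψ' 0) X)
    (fun c ψ X => symbolProduct_const_mul_right B c Φ ψ X)
    (fun ψ => (isSymbol_symbolProduct B hM (isTempered_decay 0) hΦ (isSymbol_schwartz ψ 0)).contDiff)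
    (fun ⟨k, n⟩ => by
      obtain ⟨K, D, hD, hK⟩ := (hM.comp_clm ((ContinuousLinearMap.id ℝ (Phase d)).prod
        (ContinuousLinearMap.id ℝ (Phase d)))).exists_le
      obtain ⟨N, C, hC, h⟩ := exists_derivBound_symbolProduct B hM
        (isTempered_decay (k + K) : IsTempered (decay (k + K) : Phase d → ℝ)) n
      obtain ⟨A, hA⟩ := hΦ N
      have hA0 := hA.nonneg
      refine ⟨Finset.Iic (k + K, N), A * C * D * 2 ^ (k + K), by positivity, fun ψ X => ?_⟩
      have hb := (h _ _ _ _ hA (derivBound_schwartz ψ (k + K) N)).bound n le_rfl X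
      set S := (Finset.Iic (k + K, N)).sup (schwartzSeminormFamily ℂ (Phase d) ℂ) ψ
      have hS : 0 ≤ S := apply_nonneg _ _
      have hd := one_add_norm_pow_mul_decay K k X
      have hd' : ‖X‖ ^ k * decay k X ≤ 1 := by
        rw [decay, ← div_eq_mul_inv, div_le_one (by positivity)]
        gcongr
        linarith
      have h1 := decay_pos (k + K) X
      calc ‖X‖ ^ k * ‖iteratedFDeriv ℝ n (symbolProduct B Φ ψ) X‖
          ≤ ‖X‖ ^ k * (A * (2 ^ (k + K) * S) * C * ((D * (1 + ‖X‖) ^ K) * decay (k + K) X)) := by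
            refine mul_le_mul_of_nonneg_left (hb.trans ?_) (by positivity)
            exact mul_le_mul_of_nonneg_left (mul_le_mul_of_nonneg_right (hK X) h1.le)
              (by positivity)
        _ = A * C * D * 2 ^ (k + K) * S * (‖X‖ ^ k * ((1 + ‖X‖) ^ K * decay (k + K) X)) := by ring
        _ ≤ A * C * D * 2 ^ (k + K) * S * 1 := by
            rw [hd]
            exact mul_le_mul_of_nonneg_left hd' (by positivity)
        _ = _ := mul_one _)

lemma schwartzProduct_apply (hM : IsTempered M) (hΦ : IsSymbol M Φ) (ψ : 𝓢(Phase d, ℂ))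
    (X : Phase d) : schwartzProduct B hM hΦ ψ X = symbolProduct B Φ ψ X := rfl

/-- The transpose of the product with `Φ` is the product with `Φ` with exchanged arguments. -/
theorem integral_symbolProduct_mul_comm (hM : IsTempered M) (hm : IsTempered m)
    (hΦ : IsSymbol M Φ) (hψ : IsSymbol m ψ) (χ : 𝓢(Phase d, ℂ)) :
    ∫ X, symbolProduct B Φ ψ X * χ X =
      ∫ X, symbolProduct B (fun p => Φ p.swap) χ X * ψ X := by
  have hM' := hM.mul_one_add_norm
  have hm' := hm.mul_one_add_norm
  have h0 : IsTempered (decay 0 : Phase d → ℝ) := isTempered_decay 0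
  -- For a Schwartz function `ψ`, both sides are bounded functionals of `Φ`; the case of a symbol `ψ`
  -- then follows because both sides are bounded functionals of `ψ`.
  have h1 : ∀ ψ : 𝓢(Phase d, ℂ), ∫ X, symbolProduct B Φ ψ X * χ X =
      ∫ X, symbolProduct B (fun p => Φ p.swap) χ X * ψ X := fun ψ => by
    have hψ := isSymbol_schwartz ψ 0
    have hχ := isSymbol_schwartz χ 0
    obtain ⟨N, C, hC, h⟩ := exists_norm_integral_symbolProduct_le B hM' h0 χ
    obtain ⟨N', C', hC', h'⟩ := exists_norm_integral_symbolProduct_le B hM'.comp_swap h0 ψ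
    obtain ⟨D, hD, hs⟩ := exists_derivBound_comp_swap (d := d) N'
    obtain ⟨A, hA⟩ := hψ N
    obtain ⟨A', hA'⟩ := hχ N'
    rw [← sub_eq_zero]
    refine IsSymbol.eq_zero_of_schwartz hM (N := max N N') (C := A * C + D * A' * C')
      (ℓ := fun Φ => (∫ X, symbolProduct B Φ ψ X * χ X) -
        ∫ X, symbolProduct B (fun p => Φ p.swap) χ X * ψ X)
      (fun f g hf hg => ?_) (fun a f _ hf => ?_) (fun f => ?_) hΦ
    · simp only
      rw [integral_symbolProduct_add_left B hM' h0 hf hg hψ,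
        integral_symbolProduct_add_left B hM'.comp_swap h0 hf.comp_swap hg.comp_swap hχ]
      ring
    · refine (norm_sub_le _ _).trans ?_
      have h2 := h _ _ _ _ (hf.mono_order (le_max_left N N')) hA
      have h3 := h' _ _ _ _ (hs _ _ _ (hf.mono_order (le_max_right N N'))) hA'
      linarith
    · rw [sub_eq_zero]
      exact integral_symbolProduct_mul_comm_schwartz B f ψ χ
  obtain ⟨N, C, hC, h⟩ := exists_norm_integral_symbolProduct_le B hM hm' χ
  obtain ⟨A, hA⟩ := hΦ N
  obtain ⟨D, hD, h'⟩ := exists_norm_integral_mul_schwartz_le hm'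
    (schwartzProduct B hM.comp_swap hΦ.comp_swap χ)
  simp only [schwartzProduct_apply, mul_comm _ (symbolProduct _ _ _ _)] at h'
  rw [← sub_eq_zero]
  refine IsSymbol.eq_zero_of_schwartz hm (N := N) (C := A * C + D)
    (ℓ := fun ψ => (∫ X, symbolProduct B Φ ψ X * χ X) -
      ∫ X, symbolProduct B (fun p => Φ p.swap) χ X * ψ X)
    (fun f g hf hg => ?_) (fun a f _ hf => ?_) (fun f => sub_eq_zero.2 (h1 f)) hψ
  · obtain ⟨a, ha⟩ := hf 0
    obtain ⟨b, hb⟩ := hg 0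
    simp_rw [mul_add]
    rw [integral_symbolProduct_add_right B hM hm' hΦ hf hg, integral_add (h' _ _ ha).1 (h' _ _ hb).1]
    ring
  · refine (norm_sub_le _ _).trans ?_
    have h2 := h _ _ _ _ hA hf
    have h3 := (h' _ _ (hf.mono_order (Nat.zero_le N))).2
    linarith

end Transpose

/-! ### The product on Hörmander classes -/

section Hormander
variable {V : Type} [NormedAddCommGroup V] [NormedSpace ℝ V] {m : TemperedWeight V}

namespace HormanderSpace

lemma norm_iteratedFDeriv_le (φ : HormanderSpace m) (n : ℕ) (x : V) :
    ‖iteratedFDeriv ℝ n φ x‖ ≤ seminorm m n φ * m x := by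
  have hb : BddAbove (Set.range fun x => (m x)⁻¹ * ‖iteratedFDeriv ℝ n φ x‖) := by
    obtain ⟨C, hC⟩ := φ.2.2 n
    exact ⟨C, by rintro _ ⟨x, rfl⟩; exact hC x⟩
  have h := le_ciSup hb x
  rw [inv_mul_le_iff₀ (m.pos x), mul_comm] at h
  exact h

/-- The sum of the seminorms of the Hörmander class up to the order `N`. -/
def sumSeminorm (m : TemperedWeight V) (N : ℕ) (φ : HormanderSpace m) : ℝ :=
  ∑ n ∈ Finset.range (N + 1), seminorm m n φ

lemma derivBound (φ : HormanderSpace m) (N : ℕ) : DerivBound m N (sumSeminorm m N φ) φ := by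
  refine ⟨Finset.sum_nonneg fun n _ => apply_nonneg _ _, φ.2.1.of_le (by exact_mod_cast le_top),
    fun n hn x => (norm_iteratedFDeriv_le φ n x).trans ?_⟩
  refine mul_le_mul_of_nonneg_right ?_ (m.pos x).le
  exact Finset.single_le_sum (f := fun n => seminorm m n φ) (fun n _ => apply_nonneg _ _)
    (Finset.mem_range.2 (by omega))

lemma isSymbol (φ : HormanderSpace m) : IsSymbol m φ := fun N => ⟨_, φ.derivBound N⟩

lemma seminorm_le {φ : HormanderSpace m} {N : ℕ} {A : ℝ} (h : DerivBound m N A φ) :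
    seminorm m N φ ≤ A :=
  ciSup_le fun x => by
    rw [inv_mul_le_iff₀ (m.pos x), mul_comm]
    exact h.bound N le_rfl x

lemma continuous_sumSeminorm_sub (N : ℕ) (φ₀ : HormanderSpace m) :
    Continuous fun φ => sumSeminorm m N (φ - φ₀) := by
  have := (withSeminorms m).topologicalAddGroup
  refine continuous_finsetSum _ fun n _ => ?_
  exact ((withSeminorms m).continuous_seminorm n).comp (continuous_id.sub continuous_const)

end HormanderSpace

/-- A symbol dominated by a tempered weight, as an element of its Hörmander class. -/
def IsSymbol.toHormander {f : V → ℂ} (hf : IsSymbol m f) : HormanderSpace m :=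
  ⟨f, hf.contDiff, fun n => by
    obtain ⟨A, hA⟩ := hf n
    refine ⟨A, fun x => ?_⟩
    rw [inv_mul_le_iff₀ (m.pos x), mul_comm]
    exact hA.bound n le_rfl x⟩

end Hormander

section Main
variable {d : ℕ} (B : MagneticField d)

/-- The semi-super product as a bilinear map of Hörmander classes. -/
def hormanderProduct (M : TemperedWeight (Phase d × Phase d)) (m : TemperedWeight (Phase d)) :
    HormanderSpace M →ₗ[ℂ] HormanderSpace m →ₗ[ℂ] HormanderSpace (M.diagMul m) :=
  LinearMap.mk₂ ℂ
    (fun Φ ψ => IsSymbol.toHormander (m := M.diagMul m) (f := symbolProduct B Φ ψ)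
      (isSymbol_symbolProduct B M.isTempered m.isTempered Φ.isSymbol ψ.isSymbol))
    (fun Φ Φ' ψ => Subtype.ext (funext fun X => symbolProduct_add_left B M.isTempered m.isTempered
      Φ.isSymbol Φ'.isSymbol ψ.isSymbol X))
    (fun c Φ ψ => Subtype.ext (funext fun X => symbolProduct_const_mul_left B c Φ ψ X))
    (fun Φ ψ ψ' => Subtype.ext (funext fun X => symbolProduct_add_right B M.isTempered m.isTempered
      Φ.isSymbol ψ.isSymbol ψ'.isSymbol X))
    (fun c Φ ψ => Subtype.ext (funext fun X => symbolProduct_const_mul_right B c Φ ψ X))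

lemma continuous_hormanderProduct (M : TemperedWeight (Phase d × Phase d))
    (m : TemperedWeight (Phase d)) :
    Continuous fun p : HormanderSpace M × HormanderSpace m => hormanderProduct B M m p.1 p.2 := by
  refine continuous_iff_continuousAt.2 fun p₀ => ?_
  refine ((HormanderSpace.withSeminorms (M.diagMul m)).tendsto_nhds _ _).2 fun n ε hε => ?_
  obtain ⟨N, C, hC, h⟩ := exists_derivBound_symbolProduct B M.isTempered m.isTempered n
  have hb : ∀ (Φ : HormanderSpace M) (ψ : HormanderSpace m),
      HormanderSpace.seminorm (M.diagMul m) n (hormanderProduct B M m Φ ψ) ≤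
        HormanderSpace.sumSeminorm M N Φ * HormanderSpace.sumSeminorm m N ψ * C := fun Φ ψ =>
    HormanderSpace.seminorm_le (h _ _ _ _ (Φ.derivBound N) (ψ.derivBound N))
  -- The bound from `Φ • ψ - Φ₀ • ψ₀ = (Φ - Φ₀) • ψ + Φ₀ • (ψ - ψ₀)`; writing `ψ` as `ψ - 0` gives all
  -- factors the same form.
  let g : HormanderSpace M × HormanderSpace m → ℝ := fun p =>
    HormanderSpace.sumSeminorm M N (p.1 - p₀.1) * HormanderSpace.sumSeminorm m N (p.2 - 0) * C +
      HormanderSpace.sumSeminorm M N p₀.1 * HormanderSpace.sumSeminorm m N (p.2 - p₀.2) * C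
  have hg : Continuous g := by
    have h1 := (HormanderSpace.continuous_sumSeminorm_sub N p₀.1).comp
      (continuous_fst (Y := HormanderSpace m))
    have h2 := (HormanderSpace.continuous_sumSeminorm_sub N p₀.2).comp
      (continuous_snd (X := HormanderSpace M))
    have h3 := (HormanderSpace.continuous_sumSeminorm_sub N (0 : HormanderSpace m)).comp
      (continuous_snd (X := HormanderSpace M))
    exact ((h1.mul h3).mul continuous_const).add ((continuous_const.mul h2).mul continuous_const)
  have hg0 : g p₀ = 0 := by simp [g, HormanderSpace.sumSeminorm]
  have hlt : ∀ᶠ p in nhds p₀, g p < ε :=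
    hg.continuousAt.eventually_lt continuousAt_const (hg0.trans_lt hε)
  filter_upwards [hlt] with p hp
  have e : hormanderProduct B M m p.1 p.2 - hormanderProduct B M m p₀.1 p₀.2 =
      hormanderProduct B M m (p.1 - p₀.1) (p.2 - 0) +
        hormanderProduct B M m p₀.1 (p.2 - p₀.2) := by
    simp
  rw [e]
  exact ((map_add_le_add _ _ _).trans (add_le_add (hb _ _) (hb _ _))).trans_lt hp

/-- The product with `Φ` with exchanged arguments is the formal transpose of the product with `Φ`, so
`Φ` lies in the semi-super Moyal space. -/
lemma isFormalTranspose_schwartzProduct {M : TemperedWeight (Phase d × Phase d)}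
    (Φ : HormanderSpace M) : IsFormalTranspose B Φ.toDist
      (schwartzProduct B M.isTempered.comp_swap Φ.isSymbol.comp_swap) := fun ψ χ => by
  rw [semiSuperProduct_apply, HormanderSpace.toDist_apply]
  simp_rw [schwartzProduct_apply, mul_comm (ψ _), mul_comm (kernelTest B ψ χ _)]
  rw [← integral_symbolProduct_mul B M.isTempered Φ.isSymbol,
    integral_symbolProduct_mul_comm B M.isTempered (isTempered_decay 0) Φ.isSymbol
      (isSymbol_schwartz ψ 0)]

end Main

end SuperWeyl
end

open SuperWeyl
theorem proposition4p2 (d : ℕ) (B : MagneticField d) :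
    hormanderUnion (Phase d × Phase d) ⊆ semiSuperMoyal B ∧
      ∀ (M : TemperedWeight (Phase d × Phase d)) (m : TemperedWeight (Phase d)),
        ∃ b : HormanderSpace M →ₗ[ℂ] HormanderSpace m →ₗ[ℂ] HormanderSpace (M.diagMul m),
          (∀ (Φ : HormanderSpace M) (ψ : HormanderSpace m) (hΦ : Φ.toDist ∈ semiSuperMoyal B),
            (b Φ ψ).toDist = semiSuperProductDist B ⟨Φ.toDist, hΦ⟩ ψ.toDist) ∧
          Continuous (fun p : HormanderSpace M × HormanderSpace m => b p.1 p.2) := by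
  refine ⟨?_, fun M m => ⟨hormanderProduct B M m, fun Φ ψ hΦ => ?_,
    continuous_hormanderProduct B M m⟩⟩
  · intro u hu
    obtain ⟨M, Φ, rfl⟩ := Set.mem_iUnion.1 hu
    exact ⟨_, isFormalTranspose_schwartzProduct B Φ⟩
  · have hT := hΦ.choose_spec.unique B (isFormalTranspose_schwartzProduct B Φ)
    ext χ
    have h1 : semiSuperProductDist B ⟨Φ.toDist, hΦ⟩ ψ.toDist χ = ψ.toDist (hΦ.choose χ) := rfl
    have h2 : ∀ X, hormanderProduct B M m Φ ψ X = symbolProduct B Φ ψ X := fun X => rfl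
    rw [h1, hT, HormanderSpace.toDist_apply, HormanderSpace.toDist_apply]
    simp_rw [h2, schwartzProduct_apply, mul_comm (χ _)]
    exact integral_symbolProduct_mul_comm B M.isTempered m.isTempered Φ.isSymbol ψ.isSymbol χ
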